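/- For a probability distribution $p$ on $[k]=\{1,\dots,k\}$ let $U_k$ be the uniform distribution on $[k]$ and $\chi^2(p\|U_k)=\sum_{i=1}^k \frac{(p_i-1/k)^2}{1/k}$. A *code* (synthesizer) for $p$ with $g$ garbage qubits is a unitary $U$ on $\lceil\log_2 k\rceil+g$ qubits such that $U|0\cdots0\rangle=\sum_{i\in[k]}\sqrt{p_i}\,|i\rangle|\psi_i\rangle$ for some normalized states $|\psi_i\rangle$ of the $g$ garbage qubits. A quantum algorithm that has black-box access to the code may apply $U$, $U^\dagger$ and controlled-$U$; each such application is one *use* of the code. **Theorem.** There is a computationally efficient quantum algorithm for uniformity testing with the following guarantees. For every integer $k\ge1$, every real $\varepsilon>0$, every probability distribution $p$ on $[k]$ (unknown to the algorithm) and every code for $p$, with any number $g\ge0$ of garbage qubits, the algorithm, given $k$, $g$ and $\varepsilon$ and black-box access to the code, always makes at most $O(k^{1/2}/\varepsilon)$ uses of the code, with an absolute implied constant, and distinguishes with probability at least $2/3$ between (1) $\chi^2(p\|U_k)\le \varepsilon^2/144$ and (2) $\chi^2(p\|U_k)>\varepsilon^2$; that is, it accepts with probability at least $2/3$ in case (1)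 and rejects with probability at least $2/3$ in case (2). Here "computationally efficient" means that one fixed program serves all $k,g,\varepsilon,p$ and all codes, and that its total number of elementary steps (classical bit operations, gates from the set NOT, Hadamard, $T=\mathrm{diag}(1,e^{i\pi/4})$, CNOT and Toffoli, one-qubit measurements, and uses of the code, each use counted as one step) and the number of work qubits that it needs are bounded by a polynomial in $k$, $g$ and $1/\varepsilon$. The real number $\varepsilon$ is given to the program through binary approximations of $1/\varepsilon$ of any precision that it asks for; reading $\lfloor 2^j/\varepsilon\rfloor$ costs at least $j$ steps. -/

import Mathlib

/-! ## Distributions -/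

namespace QTest

/-- The uniform distribution on a `k`-element set. -/
noncomputable def uniform (k : ℕ) : Fin k → ℝ := fun _ => 1 / (k : ℝ)

/-- The chi-squared divergence `∑ i, (p i - q i)² / q i` (for `q` with positive entries). -/
noncomputable def chiSquare {k : ℕ} (p q : Fin k → ℝ) : ℝ := ∑ i, (p i - q i) ^ 2 / q i

/-! ## Quantum states and the code for a distribution -/

/-- Computational basis states of `n` qubits. -/
abbrev Bits (n : ℕ) : Type := Fin n → Bool

/-- The (possibly unnormalized) pure states of `n` qubits. -/
abbrev QState (n : ℕ) : Type := Bits n → ℂ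

/-- The squared norm of a state. -/
noncomputable def normSq {n : ℕ} (ψ : QState n) : ℝ := ∑ x, ‖ψ x‖ ^ 2

/-- The basis state `|0…0⟩`, as a label. -/
def zeroBits (n : ℕ) : Bits n := fun _ => false

/-- The `l`-bit binary expansion of `i`, least significant bit first. -/
def binary (l i : ℕ) : Bits l := fun j => i.testBit j

/-- The number of qubits of a code for a distribution on `[k]`: `⌈log₂ k⌉` qubits that hold the
sample, in binary, followed by `g` garbage qubits. -/
abbrev codeSize (k g : ℕ) : ℕ := Nat.clog 2 k + g

/-- `U` is a synthesizer ("the code") for `p`: a unitary with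
`U |0…0⟩ = ∑ i, √(p i) |i⟩ |ψ i⟩` for some normalized garbage states `ψ i`. -/
def IsSynthesizer {k g : ℕ} (U : Matrix (Bits (codeSize k g)) (Bits (codeSize k g)) ℂ)
    (p : Fin k → ℝ) : Prop :=
  U ∈ Matrix.unitaryGroup (Bits (codeSize k g)) ℂ ∧
  ∃ ψ : Fin k → QState g, (∀ i, normSq (ψ i) = 1) ∧
    ∀ (a : Bits (Nat.clog 2 k)) (b : Bits g),
      U (Fin.append a b) (zeroBits _) =
        ∑ i : Fin k, if a = binary (Nat.clog 2 k) i then (√(p i) : ℂ) * ψ i b else 0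

/-! ## Quantum algorithms with black-box access to the code

An algorithm is one fixed program for a classical random access machine that controls a quantum
memory. The control flow consists of branching and of bounded loops. The quantum memory consists of
the `n` qubits on which the code `U` acts (addresses `0, …, n - 1`) and of `w` work qubits
(addresses `n, …, n + w - 1`). -/

/-- Arithmetic expressions in the classical registers, with values in `ℕ`
(`sub` is truncated and `div` is rounded down). -/
inductive Expr : Type
  | lit (c : ℕ)
  | reg (r : ℕ)
  | add (a b : Expr)
  | sub (a b : Expr)
  | mul (a b : Expr)
  | div (a b : Expr)

/-- The value of an expression. -/
def Expr.eval (m : ℕ → ℕ) : Expr → ℕ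
  | .lit c => c
  | .reg r => m r
  | .add a b => a.eval m + b.eval m
  | .sub a b => a.eval m - b.eval m
  | .mul a b => a.eval m * b.eval m
  | .div a b => a.eval m / b.eval m

/-- The bit cost of a binary arithmetic operation on `x` and `y`. -/
def opCost (x y : ℕ) : ℕ := (x.size + 1) * (y.size + 1)

/-- The number of elementary steps (bit operations) charged for evaluating an expression. -/
def Expr.cost (m : ℕ → ℕ) : Expr → ℕ
  | .lit c => c.size + 1
  | .reg r => (m r).size + 1
  | .add a b => a.cost m + b.cost m + opCost (a.eval m) (b.eval m)
  | .sub a b => a.cost m + b.cost m + opCost (a.eval m) (b.eval m)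
  | .mul a b => a.cost m + b.cost m + opCost (a.eval m) (b.eval m)
  | .div a b => a.cost m + b.cost m + opCost (a.eval m) (b.eval m)

/-- Programs. The arguments `q`, `q₁`, `q₂` are addresses of qubits. -/
inductive Prog : Type
  /-- do nothing -/
  | skip
  /-- `r := e` -/
  | set (r : ℕ) (e : Expr)
  /-- `r := ⌊2 ^ e / ε⌋`: read the accuracy parameter, in the form of the real number `1 / ε`,
  with `e` binary digits after the point -/
  | readAccuracy (r : ℕ) (e : Expr)
  /-- the NOT gate -/
  | gateX (q : Expr)
  /-- the Hadamard gate -/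
  | gateH (q : Expr)
  /-- the gate `diag(1, exp(iπ/4))` -/
  | gateT (q : Expr)
  /-- the controlled NOT gate, with control `q₁` and target `q` -/
  | gateCX (q₁ q : Expr)
  /-- the Toffoli gate, with controls `q₁`, `q₂` and target `q` -/
  | gateCCX (q₁ q₂ q : Expr)
  /-- measure a qubit in the computational basis and store the outcome in register `r` -/
  | measure (q : Expr) (r : ℕ)
  /-- apply the code `U` -/
  | code
  /-- apply the inverse `U†` of the code -/
  | codeInv
  /-- apply the controlled code, with a work qubit as the control -/
  | codeCtrl (q : Expr)
  /-- sequential composition -/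
  | seq (P Q : Prog)
  /-- if `e` is nonzero then `P` else `Q` -/
  | ite (e : Expr) (P Q : Prog)
  /-- repeat `P` as many times as the value of `e` before the first iteration -/
  | loop (e : Expr) (P : Prog)

/-- The label `x` with bit `q` flipped. -/
def flip {N : ℕ} (q : Fin N) (x : Bits N) : Bits N := Function.update x q (!x q)

/-- Apply a family of one-qubit operations at address `a`; an address outside the memory has
no effect. -/
def atAddr {N : ℕ} (a : ℕ) (f : Fin N → QState N → QState N) (ψ : QState N) : QState N :=
  if h : a < N then f ⟨a, h⟩ ψ else ψ

/-- The NOT gate. -/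
def opX {N : ℕ} (q : Fin N) (ψ : QState N) : QState N := fun x => ψ (flip q x)

/-- The Hadamard gate. -/
noncomputable def opH {N : ℕ} (q : Fin N) (ψ : QState N) : QState N := fun x =>
  (1 / (√2 : ℂ)) * (ψ (flip q x) + if x q then -ψ x else ψ x)

/-- The gate `diag(1, exp(iπ/4))`. -/
noncomputable def opT {N : ℕ} (q : Fin N) (ψ : QState N) : QState N := fun x =>
  if x q then Complex.exp (Complex.I * Real.pi / 4) * ψ x else ψ x

/-- The Toffoli gate with controls `a`, `b` and target `q`; it is the controlled NOT gate
if `a = b`, and it has no effect if the target is one of the controls. -/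
def opCCX {N : ℕ} (a b q : Fin N) (ψ : QState N) : QState N := fun x =>
  if a ≠ q ∧ b ≠ q ∧ x a = true ∧ x b = true then ψ (flip q x) else ψ x

/-- The projection onto the states in which qubit `q` has the value `v`. -/
def opProj {N : ℕ} (q : Fin N) (v : Bool) (ψ : QState N) : QState N := fun x =>
  if x q = v then ψ x else 0

/-- The operator `U ⊗ 1`, with `U` acting on the first `n` qubits. -/
noncomputable def opCode {n w : ℕ} (U : Matrix (Bits n) (Bits n) ℂ) (ψ : QState (n + w)) :
    QState (n + w) := fun x =>
  ∑ y : Bits n, U (fun j => x (Fin.castAdd w j)) y * ψ (Fin.append y (fun j => x (Fin.natAdd n j)))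

/-- The controlled operator `U`, acting on the first `n` qubits and controlled by qubit `q`; it
has no effect if the control is one of the qubits on which `U` acts. -/
noncomputable def opCodeCtrl {n w : ℕ} (U : Matrix (Bits n) (Bits n) ℂ) (q : Fin (n + w))
    (ψ : QState (n + w)) : QState (n + w) := fun x =>
  if n ≤ (q : ℕ) ∧ x q = true then opCode U ψ x else ψ x

/-- A branch of the execution of a program: the contents of the classical registers, the
unnormalized state of the quantum memory (its squared norm is the probability of the branch),
the number of uses of the code so far, and the number of elementary steps so far. -/
structure Branch (n w : ℕ) : Type where
  mem : ℕ → ℕ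
  state : QState (n + w)
  uses : ℕ
  steps : ℕ

/-- Charge `s` steps. -/
def Branch.tick {n w : ℕ} (s : ℕ) (c : Branch n w) : Branch n w :=
  { c with steps := c.steps + s }

/-- Write `v` into register `r`. -/
def Branch.write {n w : ℕ} (r v : ℕ) (c : Branch n w) : Branch n w :=
  { c with mem := Function.update c.mem r v }

/-- Apply an operation to the quantum memory. -/
def Branch.act {n w : ℕ} (f : QState (n + w) → QState (n + w)) (c : Branch n w) : Branch n w :=
  { c with state := f c.state }

/-- Charge one use of the code. -/
def Branch.use {n w : ℕ} (c : Branch n w) : Branch n w := { c with uses := c.uses + 1 }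

/-- Execute a program, with code `U` and accuracy parameter `ε`, from a given branch; the result
is the list of all branches that arise through the outcomes of the measurements. -/
noncomputable def run {n w : ℕ} (U : Matrix (Bits n) (Bits n) ℂ) (ε : ℝ) :
    Prog → Branch n w → List (Branch n w)
  | .skip => fun c => [c.tick 1]
  | .set r e => fun c => [(c.tick (1 + e.cost c.mem)).write r (e.eval c.mem)]
  | .readAccuracy r e => fun c =>
      let v := ⌊(2 : ℝ) ^ (e.eval c.mem) / ε⌋₊
      [(c.tick (1 + e.cost c.mem + e.eval c.mem + v.size)).write r v]
  | .gateX q => fun c => [(c.tick (1 + q.cost c.mem)).act (atAddr (q.eval c.mem) opX)]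
  | .gateH q => fun c => [(c.tick (1 + q.cost c.mem)).act (atAddr (q.eval c.mem) opH)]
  | .gateT q => fun c => [(c.tick (1 + q.cost c.mem)).act (atAddr (q.eval c.mem) opT)]
  | .gateCX q₁ q => fun c =>
      [(c.tick (1 + q₁.cost c.mem + q.cost c.mem)).act
        (atAddr (q₁.eval c.mem) fun a => atAddr (q.eval c.mem) fun t => opCCX a a t)]
  | .gateCCX q₁ q₂ q => fun c =>
      [(c.tick (1 + q₁.cost c.mem + q₂.cost c.mem + q.cost c.mem)).act
        (atAddr (q₁.eval c.mem) fun a => atAddr (q₂.eval c.mem) fun b =>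
          atAddr (q.eval c.mem) fun t => opCCX a b t)]
  | .measure q r => fun c =>
      let c' := c.tick (1 + q.cost c.mem)
      if h : q.eval c.mem < n + w then
        [(c'.act (opProj ⟨q.eval c.mem, h⟩ false)).write r 0,
          (c'.act (opProj ⟨q.eval c.mem, h⟩ true)).write r 1]
      else [c'.write r 0]
  | .code => fun c => [((c.tick 1).use).act (opCode U)]
  | .codeInv => fun c => [((c.tick 1).use).act (opCode U.conjTranspose)]
  | .codeCtrl q => fun c =>
      [((c.tick (1 + q.cost c.mem)).use).act (atAddr (q.eval c.mem) (opCodeCtrl U))]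
  | .seq P Q => fun c => (run U ε P c).flatMap (run U ε Q)
  | .ite e P Q => fun c =>
      if e.eval c.mem ≠ 0 then run U ε P (c.tick (1 + e.cost c.mem))
      else run U ε Q (c.tick (1 + e.cost c.mem))
  | .loop e P => fun c =>
      (fun L : List (Branch n w) => L.flatMap fun c' => run U ε P (c'.tick 1))^[e.eval c.mem]
        [c.tick (1 + e.cost c.mem)]

/-- The initial contents of the registers: the domain size `k` in register `0`, the number `n` of
qubits of the code in register `1`, and `0` elsewhere. -/
def startMem (k n : ℕ) : ℕ → ℕ := fun r => if r = 0 then k else if r = 1 then n else 0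

/-- The initial branch: all qubits are in the state `|0⟩`. -/
def start (k n w : ℕ) : Branch n w where
  mem := startMem k n
  state := Pi.single (zeroBits (n + w)) 1
  uses := 0
  steps := 0

/-- All final branches of the program `P` on a domain of size `k`, with accuracy parameter `ε`,
code `U` and `w` work qubits. -/
noncomputable def outcomes {n : ℕ} (P : Prog) (k : ℕ) (ε : ℝ) (U : Matrix (Bits n) (Bits n) ℂ)
    (w : ℕ) : List (Branch n w) :=
  run U ε P (start k n w)

/-- The probability that the program accepts: register `0` holds `1` at the end. -/
noncomputable def acceptProb {n : ℕ} (P : Prog) (k : ℕ) (ε : ℝ) (U : Matrix (Bits n) (Bits n) ℂ)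
    (w : ℕ) : ℝ :=
  ((outcomes P k ε U w).map fun c => if c.mem 0 = 1 then normSq c.state else 0).sum

/-- The probability that the program rejects: register `0` does not hold `1` at the end. -/
noncomputable def rejectProb {n : ℕ} (P : Prog) (k : ℕ) (ε : ℝ) (U : Matrix (Bits n) (Bits n) ℂ)
    (w : ℕ) : ℝ :=
  ((outcomes P k ε U w).map fun c => if c.mem 0 = 1 then 0 else normSq c.state).sum

end QTest

/-! Write u for the uniform distribution. Then χ²(p‖u) = k·‖p − u‖² with the Euclidean norm, so it
suffices to prepare a state with an amplitude proportional to ‖p − u‖ and to amplify it. The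
preparation B puts a branch qubit and m index qubits into uniform superposition, applies U, flips
the phase on branch 1, lets an oracle add to the label qubits either the sample (branch 1) or the
index modulo k (branch 0), and then applies U† and the Hadamard gates again. The amplitude of "code,
branch and index qubits 0, label z" is a signed sum of squared moduli over the basis states that the
oracle labels by z, namely ½(u_m(z) − p(z)), where u_m is the distribution of a random m-bit number
modulo k (`prepareOp_amplitude`). Thus two uses of the code yield amplitudes linear in p rather than
in √p, and the garbage disappears. The flagged part of the state has squared norm a = ¼‖u_m − p‖²
(`normSq_zeroProj_prepareOp`); m is so large that replacing u_m by u costs a negligible fraction of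
ε.

Phase and oracle are commuting involutions, so B is a self-adjoint involution and serves as its own
inverse in amplitude amplification. With sin²θ = a, one iteration is minus a rotation by 2θ
(`IsPreparation.groverOp_iterate`). Iterations alternate with measurements of the flag. If the flag
is found, the tester rejects; otherwise the state has collapsed to a multiple of the bad part, and
the next stage continues from there without a new preparation. With 0, 1, 2, 4, …, 2^(S−1)
iterations in the stages, the probability that no stage rejects is ∏_{i≤S} cos²(2^i θ)
(`IsPreparation.normSq_stages`). By the doubling formula this product times 4^(S+1)·a equals
sin²(2^(S+1) θ) ≤ 1, so acceptance is unlikely if 4^S·a is large; summing the losses of the factors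
gives the lower bound 1 − 4^(S+1)·a/3. Taking 4^S between 8k/ε² and 37.2k/ε² separates the two
cases, and 2 + 4(2^S − 1) uses suffice.

If, judged by a rational approximation of 1/ε, ε² exceeds k, then case (2) cannot occur and the
tester accepts without using the code. Otherwise √k/ε is bounded below, and all rounding is absorbed
into constants.

On the side of the machine model, a program logic shows that exactly one branch survives and that
all others carry the rejection flag. Probability is conserved (`sum_normSq_run`), so the rejection
probability is the complement of the squared norm of the survivor. The program is fixed and its
loops are bounded, so its cost is polynomial in a common bound for the registers, which is itself
polynomial in k, g and 1/ε. -/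

namespace QTest

/-! ## Bounds for the number of steps -/

/-- All registers hold values of at most `V`. -/
def Bdd (V : ℕ) (m : ℕ → ℕ) : Prop := ∀ r, m r ≤ V

/-- A bound for the value of an expression when the registers are bounded by `V`. -/
def Expr.bound (V : ℕ) : Expr → ℕ
  | .lit c => c
  | .reg _ => V
  | .add a b => a.bound V + b.bound V
  | .sub a _ => a.bound V
  | .mul a b => a.bound V * b.bound V
  | .div a _ => a.bound V

/-- A bound for the cost of an expression when the registers are bounded by `V`. -/
def Expr.costBound (V : ℕ) : Expr → ℕ
  | .lit c => c + 1
  | .reg _ => V + 1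
  | .add a b => a.costBound V + b.costBound V + (a.bound V + 1) * (b.bound V + 1)
  | .sub a b => a.costBound V + b.costBound V + (a.bound V + 1) * (b.bound V + 1)
  | .mul a b => a.costBound V + b.costBound V + (a.bound V + 1) * (b.bound V + 1)
  | .div a b => a.costBound V + b.costBound V + (a.bound V + 1) * (b.bound V + 1)

/-- A bound for the number of steps of a program when the registers are bounded by `V`. -/
def Prog.costBound (V : ℕ) : Prog → ℕ
  | .skip => 1
  | .set _ e => 1 + e.costBound V
  | .readAccuracy _ e => 1 + e.costBound V + e.bound V + V
  | .gateX q => 1 + q.costBound V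
  | .gateH q => 1 + q.costBound V
  | .gateT q => 1 + q.costBound V
  | .gateCX a q => 1 + a.costBound V + q.costBound V
  | .gateCCX a b q => 1 + a.costBound V + b.costBound V + q.costBound V
  | .measure q _ => 1 + q.costBound V
  | .code => 1
  | .codeInv => 1
  | .codeCtrl q => 1 + q.costBound V
  | .seq P Q => P.costBound V + Q.costBound V
  | .ite e P Q => 1 + e.costBound V + P.costBound V + Q.costBound V
  | .loop e P => 1 + e.costBound V + e.bound V * (P.costBound V + 1)

theorem size_le_self (x : ℕ) : x.size ≤ x := Nat.size_le.2 Nat.lt_two_pow_self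

theorem Expr.eval_le_bound {V : ℕ} {m : ℕ → ℕ} (h : Bdd V m) (e : Expr) :
    e.eval m ≤ e.bound V := by
  induction e with
  | lit c => exact le_rfl
  | reg r => exact h r
  | add a b iha ihb => exact Nat.add_le_add iha ihb
  | sub a b iha ihb => exact (Nat.sub_le _ _).trans iha
  | mul a b iha ihb => exact Nat.mul_le_mul iha ihb
  | div a b iha ihb => exact (Nat.div_le_self _ _).trans iha

theorem opCost_le {x y a b : ℕ} (hx : x ≤ a) (hy : y ≤ b) : opCost x y ≤ (a + 1) * (b + 1) :=
  Nat.mul_le_mul (Nat.succ_le_succ ((size_le_self x).trans hx))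
    (Nat.succ_le_succ ((size_le_self y).trans hy))

theorem Expr.cost_le_costBound {V : ℕ} {m : ℕ → ℕ} (h : Bdd V m) (e : Expr) :
    e.cost m ≤ e.costBound V := by
  induction e with
  | lit c => exact Nat.succ_le_succ (size_le_self c)
  | reg r => exact Nat.succ_le_succ ((size_le_self _).trans (h r))
  | add a b iha ihb =>
    exact Nat.add_le_add (Nat.add_le_add iha ihb)
      (opCost_le (a.eval_le_bound h) (b.eval_le_bound h))
  | sub a b iha ihb =>
    exact Nat.add_le_add (Nat.add_le_add iha ihb)
      (opCost_le (a.eval_le_bound h) (b.eval_le_bound h))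
  | mul a b iha ihb =>
    exact Nat.add_le_add (Nat.add_le_add iha ihb)
      (opCost_le (a.eval_le_bound h) (b.eval_le_bound h))
  | div a b iha ihb =>
    exact Nat.add_le_add (Nat.add_le_add iha ihb)
      (opCost_le (a.eval_le_bound h) (b.eval_le_bound h))

/-- `f` is bounded by a polynomial. -/
def PolyBdd (f : ℕ → ℕ) : Prop := ∃ C d : ℕ, ∀ V, f V ≤ C * (V + 1) ^ d

theorem PolyBdd.const (c : ℕ) : PolyBdd fun _ => c := ⟨c, 0, fun V => by simp⟩

theorem PolyBdd.id : PolyBdd fun V => V := ⟨1, 1, fun V => by simp⟩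

theorem PolyBdd.add {f g : ℕ → ℕ} : PolyBdd f → PolyBdd g → PolyBdd fun V => f V + g V := by
  rintro ⟨C, d, hf⟩ ⟨C', d', hg⟩
  refine ⟨C + C', d + d', fun V => ?_⟩
  rw [add_mul]
  have h1 : (V + 1) ^ d ≤ (V + 1) ^ (d + d') := Nat.pow_le_pow_right (by omega) (by omega)
  have h2 : (V + 1) ^ d' ≤ (V + 1) ^ (d + d') := Nat.pow_le_pow_right (by omega) (by omega)
  exact Nat.add_le_add ((hf V).trans (Nat.mul_le_mul_left _ h1))
    ((hg V).trans (Nat.mul_le_mul_left _ h2))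

theorem PolyBdd.mul {f g : ℕ → ℕ} : PolyBdd f → PolyBdd g → PolyBdd fun V => f V * g V := by
  rintro ⟨C, d, hf⟩ ⟨C', d', hg⟩
  refine ⟨C * C', d + d', fun V => (Nat.mul_le_mul (hf V) (hg V)).trans (le_of_eq ?_)⟩
  rw [pow_add]
  ring

theorem Expr.polyBdd_bound (e : Expr) : PolyBdd fun V => e.bound V := by
  induction e with
  | lit c => exact .const c
  | reg r => exact .id
  | add a b iha ihb => exact iha.add ihb
  | sub a b iha ihb => exact iha
  | mul a b iha ihb => exact iha.mul ihb
  | div a b iha ihb => exact iha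

theorem Expr.polyBdd_costBound (e : Expr) : PolyBdd fun V => e.costBound V := by
  have key : ∀ a b : Expr, (PolyBdd fun V => a.costBound V) → (PolyBdd fun V => b.costBound V) →
      PolyBdd fun V => a.costBound V + b.costBound V + (a.bound V + 1) * (b.bound V + 1) :=
    fun a b ha hb => (ha.add hb).add
      ((a.polyBdd_bound.add (.const 1)).mul (b.polyBdd_bound.add (.const 1)))
  induction e with
  | lit c => exact .const _
  | reg r => exact PolyBdd.id.add (.const 1)
  | add a b iha ihb => exact key a b iha ihb
  | sub a b iha ihb => exact key a b iha ihb
  | mul a b iha ihb => exact key a b iha ihb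
  | div a b iha ihb => exact key a b iha ihb

/-- A program is a fixed finite tree, and a loop multiplies the cost of its body by at most a
polynomial in `V`, so nesting only raises the degree. -/
theorem Prog.polyBdd_costBound (P : Prog) : PolyBdd fun V => P.costBound V := by
  have one : ∀ e : Expr, PolyBdd fun V => 1 + e.costBound V := fun e =>
    (PolyBdd.const 1).add e.polyBdd_costBound
  induction P with
  | skip => exact .const 1
  | set r e => exact one e
  | readAccuracy r e => exact ((one e).add e.polyBdd_bound).add .id
  | gateX q => exact one q
  | gateH q => exact one q
  | gateT q => exact one q
  | gateCX a q => exact (one a).add q.polyBdd_costBound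
  | gateCCX a b q => exact ((one a).add b.polyBdd_costBound).add q.polyBdd_costBound
  | measure q r => exact one q
  | code => exact .const 1
  | codeInv => exact .const 1
  | codeCtrl q => exact one q
  | seq P Q ihP ihQ => exact ihP.add ihQ
  | ite e P Q ihP ihQ => exact ((one e).add ihP).add ihQ
  | loop e P ih => exact (one e).add (e.polyBdd_bound.mul (ih.add (.const 1)))

/-! ## Program logic -/

/-- The register contents `m` agree with `f` on the registers below `s`. -/
def Env (s : ℕ) (f m : ℕ → ℕ) : Prop := ∀ r < s, m r = f r

/-- All registers of the expression are below `s`. -/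
def Expr.regsLT (s : ℕ) : Expr → Prop
  | .lit _ => True
  | .reg r => r < s
  | .add a b => a.regsLT s ∧ b.regsLT s
  | .sub a b => a.regsLT s ∧ b.regsLT s
  | .mul a b => a.regsLT s ∧ b.regsLT s
  | .div a b => a.regsLT s ∧ b.regsLT s

theorem Expr.eval_congr {s : ℕ} {f m : ℕ → ℕ} (h : Env s f m) {e : Expr} (he : e.regsLT s) :
    e.eval m = e.eval f := by
  induction e with
  | lit c => rfl
  | reg r => exact h r he
  | add a b iha ihb => simp only [Expr.eval, iha he.1, ihb he.2]
  | sub a b iha ihb => simp only [Expr.eval, iha he.1, ihb he.2]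
  | mul a b iha ihb => simp only [Expr.eval, iha he.1, ihb he.2]
  | div a b iha ihb => simp only [Expr.eval, iha he.1, ihb he.2]

theorem Expr.regsLT.mono {s t : ℕ} (hst : s ≤ t) {e : Expr} (he : e.regsLT s) : e.regsLT t := by
  induction e with
  | lit c => trivial
  | reg r => exact lt_of_lt_of_le he hst
  | add a b iha ihb => exact ⟨iha he.1, ihb he.2⟩
  | sub a b iha ihb => exact ⟨iha he.1, ihb he.2⟩
  | mul a b iha ihb => exact ⟨iha he.1, ihb he.2⟩
  | div a b iha ihb => exact ⟨iha he.1, ihb he.2⟩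

theorem Env.rfl' {s : ℕ} {f : ℕ → ℕ} : Env s f f := fun _ _ => rfl

theorem Env.trans {s : ℕ} {f g m : ℕ → ℕ} (h : Env s f g) (h' : Env s g m) : Env s f m :=
  fun r hr => (h' r hr).trans (h r hr)

theorem Env.mono {s t : ℕ} {f m : ℕ → ℕ} (hst : s ≤ t) (h : Env t f m) : Env s f m :=
  fun r hr => h r (lt_of_lt_of_le hr hst)

theorem Env.update_ge {s r : ℕ} {f m : ℕ → ℕ} (h : Env s f m) (hr : s ≤ r) (v : ℕ) :
    Env s f (Function.update m r v) := fun x hx => by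
  rw [Function.update_of_ne (by omega)]; exact h x hx

theorem Env.update {s r : ℕ} {f m : ℕ → ℕ} (h : Env s f m) (v : ℕ) :
    Env s (Function.update f r v) (Function.update m r v) := fun x hx => by
  by_cases hxr : x = r
  · subst hxr; simp
  · simp [hxr, h x hx]

theorem Env.update_succ {s : ℕ} {f m : ℕ → ℕ} (h : Env s f m) (v : ℕ) :
    Env (s + 1) (Function.update f s v) (Function.update m s v) := fun x hx => by
  by_cases hxr : x = s
  · subst hxr; simp
  · simp [hxr, h x (by omega)]

theorem Bdd.update {V r v : ℕ} {m : ℕ → ℕ} (h : Bdd V m) (hv : v ≤ V) :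
    Bdd V (Function.update m r v) := fun x => by
  by_cases hxr : x = r
  · subst hxr; simpa using hv
  · simpa [hxr] using h x

/-- The composition of the first `N` members of a sequence of operations, the first one being
applied first. -/
def opSeq {α : Type*} (F : ℕ → α → α) : ℕ → α → α
  | 0 => id
  | N + 1 => F N ∘ opSeq F N

theorem opSeq_succ' {α : Type*} (F : ℕ → α → α) (N : ℕ) :
    opSeq F (N + 1) = opSeq (fun i => F (i + 1)) N ∘ F 0 := by
  induction N with
  | zero => rfl
  | succ N ih =>
    rw [opSeq, ih]
    rfl

theorem opSeq_congr {α : Type*} {F G : ℕ → α → α} {N : ℕ} (h : ∀ i < N, F i = G i) :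
    opSeq F N = opSeq G N := by
  induction N with
  | zero => rfl
  | succ N ih => rw [opSeq, opSeq, ih fun i hi => h i (by omega), h N (by omega)]

theorem opSeq_const {α : Type*} (F : α → α) (N : ℕ) : opSeq (fun _ => F) N = F^[N] := by
  induction N with
  | zero => rfl
  | succ N ih => rw [opSeq, ih, Function.iterate_succ']

section Logic

variable {n w : ℕ} (U : Matrix (Bits n) (Bits n) ℂ) (ε : ℝ) (V : ℕ)

/-- From every branch whose registers are bounded by `V` and agree with `f` below `s`, the program
`P` leads to a single branch, whose registers are bounded by `V` and agree with `f'` below `s'`;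
it applies `F` to the quantum state and uses the code `u` times. -/
def Triple (s : ℕ) (P : Prog) (f : ℕ → ℕ) (s' : ℕ) (f' : ℕ → ℕ)
    (F : QState (n + w) → QState (n + w)) (u : ℕ) : Prop :=
  ∀ c : Branch n w, Bdd V c.mem → Env s f c.mem →
    ∃ m' t, Bdd V m' ∧ Env s' f' m' ∧ t ≤ P.costBound V ∧
      run U ε P c = [⟨m', F c.state, c.uses + u, c.steps + t⟩]

variable {U ε V}

theorem Triple.conseq {s s' t t' : ℕ} {P : Prog} {f f' g g' : ℕ → ℕ}
    {F F' : QState (n + w) → QState (n + w)} {u u' : ℕ} (h : Triple U ε V s P f s' f' F u)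
    (hst : s ≤ t) (hfg : Env s f g) (hst' : t' ≤ s') (hfg' : Env t' g' f') (hF : F = F')
    (hu : u = u') : Triple U ε V t P g t' g' F' u' := by
  subst hF hu
  intro c hc hm
  obtain ⟨m', x, h1, h2, h3⟩ := h c hc (hfg.trans (hm.mono hst))
  exact ⟨m', x, h1, hfg'.trans (h2.mono hst'), h3⟩

theorem Triple.op_congr {s s' : ℕ} {P : Prog} {f f' : ℕ → ℕ}
    {F F' : QState (n + w) → QState (n + w)} {u : ℕ} (h : Triple U ε V s P f s' f' F u)
    (hF : F = F') : Triple U ε V s P f s' f' F' u := hF ▸ h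

theorem Triple.skip {s : ℕ} {f : ℕ → ℕ} : Triple (n := n) (w := w) U ε V s .skip f s f id 0 :=
  fun c hc hm => ⟨c.mem, 1, hc, hm, le_rfl, rfl⟩

theorem Triple.set {s r s' : ℕ} {e : Expr} {f : ℕ → ℕ} (he : e.regsLT s) (hV : e.eval f ≤ V)
    (hs : s' ≤ s ∨ (s' = s + 1 ∧ r = s)) :
    Triple (n := n) (w := w) U ε V s (.set r e) f s' (Function.update f r (e.eval f)) id 0 := by
  intro c hc hm
  have hev := Expr.eval_congr hm he
  refine ⟨Function.update c.mem r (e.eval f), 1 + e.cost c.mem, hc.update hV, ?_,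
    Nat.add_le_add_left (e.cost_le_costBound hc) 1, ?_⟩
  · rcases hs with hs | ⟨rfl, rfl⟩
    · exact (hm.update _).mono hs
    · exact hm.update_succ _
  · simp [run, Branch.tick, Branch.write, hev]

theorem Triple.readAccuracy {s r s' : ℕ} {e : Expr} {f : ℕ → ℕ} (he : e.regsLT s)
    (hV : ⌊(2 : ℝ) ^ (e.eval f) / ε⌋₊ ≤ V) (hs : s' ≤ s) :
    Triple (n := n) (w := w) U ε V s (.readAccuracy r e) f s'
      (Function.update f r ⌊(2 : ℝ) ^ (e.eval f) / ε⌋₊) id 0 := by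
  intro c hc hm
  have hev := Expr.eval_congr hm he
  refine ⟨Function.update c.mem r ⌊(2 : ℝ) ^ (e.eval f) / ε⌋₊,
    1 + e.cost c.mem + e.eval c.mem + (⌊(2 : ℝ) ^ (e.eval f) / ε⌋₊).size, hc.update hV,
    (hm.update _).mono hs, ?_, ?_⟩
  · exact Nat.add_le_add (Nat.add_le_add (Nat.add_le_add_left (e.cost_le_costBound hc) 1)
      (e.eval_le_bound hc)) ((size_le_self _).trans hV)
  · simp [run, Branch.tick, Branch.write, hev]

theorem Triple.gateX {s : ℕ} {q : Expr} {f : ℕ → ℕ} (hq : q.regsLT s) :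
    Triple (n := n) (w := w) U ε V s (.gateX q) f s f (atAddr (q.eval f) opX) 0 := by
  intro c hc hm
  refine ⟨c.mem, 1 + q.cost c.mem, hc, hm, Nat.add_le_add_left (q.cost_le_costBound hc) 1, ?_⟩
  simp [run, Branch.tick, Branch.act, Expr.eval_congr hm hq]

theorem Triple.gateH {s : ℕ} {q : Expr} {f : ℕ → ℕ} (hq : q.regsLT s) :
    Triple (n := n) (w := w) U ε V s (.gateH q) f s f (atAddr (q.eval f) opH) 0 := by
  intro c hc hm
  refine ⟨c.mem, 1 + q.cost c.mem, hc, hm, Nat.add_le_add_left (q.cost_le_costBound hc) 1, ?_⟩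
  simp [run, Branch.tick, Branch.act, Expr.eval_congr hm hq]

theorem Triple.gateT {s : ℕ} {q : Expr} {f : ℕ → ℕ} (hq : q.regsLT s) :
    Triple (n := n) (w := w) U ε V s (.gateT q) f s f (atAddr (q.eval f) opT) 0 := by
  intro c hc hm
  refine ⟨c.mem, 1 + q.cost c.mem, hc, hm, Nat.add_le_add_left (q.cost_le_costBound hc) 1, ?_⟩
  simp [run, Branch.tick, Branch.act, Expr.eval_congr hm hq]

theorem Triple.gateCX {s : ℕ} {a q : Expr} {f : ℕ → ℕ} (ha : a.regsLT s) (hq : q.regsLT s) :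
    Triple (n := n) (w := w) U ε V s (.gateCX a q) f s f
      (atAddr (a.eval f) fun x => atAddr (q.eval f) fun t => opCCX x x t) 0 := by
  intro c hc hm
  refine ⟨c.mem, 1 + a.cost c.mem + q.cost c.mem, hc, hm,
    Nat.add_le_add (Nat.add_le_add_left (a.cost_le_costBound hc) 1) (q.cost_le_costBound hc), ?_⟩
  simp [run, Branch.tick, Branch.act, Expr.eval_congr hm hq, Expr.eval_congr hm ha]

theorem Triple.gateCCX {s : ℕ} {a b q : Expr} {f : ℕ → ℕ} (ha : a.regsLT s) (hb : b.regsLT s)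
    (hq : q.regsLT s) :
    Triple (n := n) (w := w) U ε V s (.gateCCX a b q) f s f
      (atAddr (a.eval f) fun x => atAddr (b.eval f) fun y =>
        atAddr (q.eval f) fun t => opCCX x y t) 0 := by
  intro c hc hm
  refine ⟨c.mem, 1 + a.cost c.mem + b.cost c.mem + q.cost c.mem, hc, hm,
    Nat.add_le_add (Nat.add_le_add (Nat.add_le_add_left (a.cost_le_costBound hc) 1)
      (b.cost_le_costBound hc)) (q.cost_le_costBound hc), ?_⟩
  simp [run, Branch.tick, Branch.act, Expr.eval_congr hm hq, Expr.eval_congr hm ha,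
    Expr.eval_congr hm hb]

theorem Triple.code {s : ℕ} {f : ℕ → ℕ} :
    Triple (n := n) (w := w) U ε V s .code f s f (opCode U) 1 :=
  fun c hc hm => ⟨c.mem, 1, hc, hm, le_rfl, rfl⟩

theorem Triple.codeInv {s : ℕ} {f : ℕ → ℕ} :
    Triple (n := n) (w := w) U ε V s .codeInv f s f (opCode U.conjTranspose) 1 :=
  fun c hc hm => ⟨c.mem, 1, hc, hm, le_rfl, rfl⟩

theorem Triple.seq {s s' s'' : ℕ} {P Q : Prog} {f f' f'' : ℕ → ℕ}
    {F G : QState (n + w) → QState (n + w)} {u v : ℕ} (hP : Triple U ε V s P f s' f' F u)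
    (hQ : Triple U ε V s' Q f' s'' f'' G v) :
    Triple U ε V s (.seq P Q) f s'' f'' (G ∘ F) (u + v) := by
  intro c hc hm
  obtain ⟨m1, t1, h1, h2, h3, h4⟩ := hP c hc hm
  obtain ⟨m2, t2, k1, k2, k3, k4⟩ := hQ ⟨m1, F c.state, c.uses + u, c.steps + t1⟩ h1 h2
  refine ⟨m2, t1 + t2, k1, k2, Nat.add_le_add h3 k3, ?_⟩
  simp only [run, h4, List.flatMap_cons, List.flatMap_nil, List.append_nil, k4]
  simp [add_assoc]

theorem Triple.ite {s s' : ℕ} {e : Expr} {P Q : Prog} {f f' : ℕ → ℕ}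
    {F : QState (n + w) → QState (n + w)} {u : ℕ} (he : e.regsLT s)
    (hP : e.eval f ≠ 0 → Triple U ε V s P f s' f' F u)
    (hQ : e.eval f = 0 → Triple U ε V s Q f s' f' F u) :
    Triple U ε V s (.ite e P Q) f s' f' F u := by
  intro c hc hm
  have hev := Expr.eval_congr hm he
  have hcost := e.cost_le_costBound hc
  by_cases h : e.eval f = 0
  · obtain ⟨m1, t1, h1, h2, h3, h4⟩ := hQ h (c.tick (1 + e.cost c.mem)) hc hm
    refine ⟨m1, 1 + e.cost c.mem + t1, h1, h2, ?_, ?_⟩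
    · simp only [Prog.costBound]; omega
    · simp only [run, hev, h, ne_eq, not_true_eq_false, if_false]
      rw [h4]
      simp [Branch.tick, add_assoc]
  · obtain ⟨m1, t1, h1, h2, h3, h4⟩ := hP h (c.tick (1 + e.cost c.mem)) hc hm
    refine ⟨m1, 1 + e.cost c.mem + t1, h1, h2, ?_, ?_⟩
    · simp only [Prog.costBound]; omega
    · simp only [run, hev]
      rw [if_pos h, h4]
      simp [Branch.tick, add_assoc]

theorem Triple.loop {s : ℕ} {e : Expr} {P : Prog} {f : ℕ → ℕ → ℕ} {N : ℕ}
    {F : ℕ → QState (n + w) → QState (n + w)} {u : ℕ → ℕ} (he : e.regsLT s)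
    (hN : e.eval (f 0) = N)
    (hP : ∀ i < N, Triple U ε V s P (f i) s (f (i + 1)) (F i) (u i)) :
    Triple U ε V s (.loop e P) (f 0) s (f N) (opSeq F N) (∑ i ∈ Finset.range N, u i) := by
  intro c hc hm
  have hev := Expr.eval_congr hm he
  have hcost := e.cost_le_costBound hc
  have hbd := e.eval_le_bound hc
  -- After `i` rounds the list of branches is still a singleton, so each `flatMap` is one run of
  -- `P`; the `+ 1` pays for the tick of the round.
  have key : ∀ i ≤ N, ∃ m' t, Bdd V m' ∧ Env s (f i) m' ∧ t ≤ i * (P.costBound V + 1) ∧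
      (fun L : List (Branch n w) => L.flatMap fun c' => run U ε P (c'.tick 1))^[i]
        [c.tick (1 + e.cost c.mem)] = [⟨m', opSeq F i c.state,
          c.uses + ∑ j ∈ Finset.range i, u j, c.steps + (1 + e.cost c.mem) + t⟩] := by
    intro i hi
    induction i with
    | zero => exact ⟨c.mem, 0, hc, hm, by simp, by simp [Branch.tick, opSeq]⟩
    | succ i ih =>
      obtain ⟨m1, t1, h1, h2, h3, h4⟩ := ih (by omega)
      obtain ⟨m2, t2, k1, k2, k3, k4⟩ := hP i (by omega) ⟨m1, opSeq F i c.state,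
          c.uses + ∑ j ∈ Finset.range i, u j, c.steps + (1 + e.cost c.mem) + t1 + 1⟩ h1 h2
      refine ⟨m2, t1 + 1 + t2, k1, k2, ?_, ?_⟩
      · rw [Nat.succ_mul]; omega
      · rw [Function.iterate_succ_apply', h4]
        simp only [List.flatMap_cons, List.flatMap_nil, List.append_nil]
        have : ∀ x : Branch n w, x.tick 1 = ⟨x.mem, x.state, x.uses, x.steps + 1⟩ := fun x => rfl
        rw [this, k4, Finset.sum_range_succ]
        simp [add_assoc, opSeq]
  obtain ⟨m1, t1, h1, h2, h3, h4⟩ := key N le_rfl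
  refine ⟨m1, 1 + e.cost c.mem + t1, h1, h2, ?_, ?_⟩
  · have : N * (P.costBound V + 1) ≤ e.bound V * (P.costBound V + 1) :=
      Nat.mul_le_mul_right _ (by omega)
    simp only [Prog.costBound]; omega
  · simp only [run]
    rw [hev, hN, h4]
    simp [add_assoc]

/-- Repeat `P` for the values `0, 1, …, e - 1` of register `r`. -/
def Prog.forUp (r : ℕ) (e : Expr) (P : Prog) : Prog :=
  .seq (.set r (.lit 0)) (.loop e (.seq P (.set r (.add (.reg r) (.lit 1)))))

/-- The counter lives in register `s`, the first one about which the precondition says nothing. It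
may therefore be forgotten afterwards, and nested loops take their counters from `s + 1` on without
any frame condition. -/
theorem Triple.forUp {s : ℕ} {e : Expr} {P : Prog} {f : ℕ → ℕ} {N : ℕ}
    {F : ℕ → QState (n + w) → QState (n + w)} {u : ℕ} (he : e.regsLT s)
    (hN : e.eval f = N) (hV : N ≤ V)
    (hP : ∀ i < N, Triple U ε V (s + 1) P (Function.update f s i) (s + 1)
      (Function.update f s i) (F i) u) :
    Triple U ε V s (.forUp s e P) f s f (opSeq F N) (N * u) := by
  have h0 : Triple (n := n) (w := w) U ε V s (.set s (.lit 0)) f (s + 1)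
      (Function.update f s 0) id 0 := Triple.set (s := s) trivial (by simp [Expr.eval]) (by simp)
  have hf : ∀ i, Env s f (Function.update f s i) := fun i => Env.rfl'.update_ge le_rfl i
  have h1 := Triple.loop (s := s + 1) (e := e) (f := fun i => Function.update f s i)
    (P := .seq P (.set s (.add (.reg s) (.lit 1)))) (N := N) (F := F) (u := fun _ => u)
    (U := U) (ε := ε) (V := V)
    (he.mono (by omega)) (by rw [Expr.eval_congr (hf 0) he, hN]) (fun i hi => by
      refine ((hP i hi).seq (Triple.set (s := s + 1) (s' := s + 1) ?_ ?_ (by simp))).conseq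
        le_rfl Env.rfl' le_rfl ?_ rfl (by simp)
      · simp [Expr.regsLT]
      · simp [Expr.eval]; omega
      · simp [Expr.eval, Env])
  exact (h0.seq h1).conseq le_rfl Env.rfl' (by omega) (hf N) rfl (by simp)

end Logic

/-! ## Program logic for programs that may reject -/

/-- A rejected branch (register `9` is set) with at most `u` uses and `t` steps. -/
structure Dead {n w : ℕ} (V u t : ℕ) (d : Branch n w) : Prop where
  rej : d.mem 9 = 1
  bdd : Bdd V d.mem
  uses : d.uses ≤ u
  steps : d.steps ≤ t

theorem Dead.mono {n w V u t u' t' : ℕ} {d : Branch n w} (h : Dead V u t d) (hu : u ≤ u')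
    (ht : t ≤ t') : Dead V u' t' d :=
  ⟨h.rej, h.bdd, h.uses.trans hu, h.steps.trans ht⟩

section Logic

variable {n w : ℕ} (U : Matrix (Bits n) (Bits n) ℂ) (ε : ℝ) (V : ℕ)

/-- As `Triple`, but for a program that may produce additional branches, all of them rejected. -/
def RejTriple (s : ℕ) (P : Prog) (f : ℕ → ℕ) (s' : ℕ) (f' : ℕ → ℕ)
    (F : QState (n + w) → QState (n + w)) (u : ℕ) : Prop :=
  ∀ c : Branch n w, Bdd V c.mem → Env s f c.mem →
    ∃ m' t ds, Bdd V m' ∧ Env s' f' m' ∧ t ≤ P.costBound V ∧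
      run U ε P c = ⟨m', F c.state, c.uses + u, c.steps + t⟩ :: ds ∧
      ∀ d ∈ ds, Dead V (c.uses + u) (c.steps + P.costBound V) d

/-- The program `P` keeps rejected branches rejected, without further use of the code. -/
def KeepsDead (w : ℕ) (P : Prog) : Prop :=
  ∀ (u t : ℕ) (c : Branch n w), Dead V u t c →
    ∀ d ∈ run U ε P c, Dead V u (t + P.costBound V) d

variable {U ε V}

theorem Triple.toRej {s s' : ℕ} {P : Prog} {f f' : ℕ → ℕ}
    {F : QState (n + w) → QState (n + w)} {u : ℕ} (h : Triple U ε V s P f s' f' F u) :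
    RejTriple U ε V s P f s' f' F u := by
  intro c hc hm
  obtain ⟨m', t, h1, h2, h3, h4⟩ := h c hc hm
  exact ⟨m', t, [], h1, h2, h3, h4, by simp⟩

theorem RejTriple.conseq {s s' t t' : ℕ} {P : Prog} {f f' g g' : ℕ → ℕ}
    {F F' : QState (n + w) → QState (n + w)} {u u' : ℕ} (h : RejTriple U ε V s P f s' f' F u)
    (hst : s ≤ t) (hfg : Env s f g) (hst' : t' ≤ s') (hfg' : Env t' g' f') (hF : F = F')
    (hu : u = u') : RejTriple U ε V t P g t' g' F' u' := by
  subst hF hu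
  intro c hc hm
  obtain ⟨m', x, ds, h1, h2, h3⟩ := h c hc (hfg.trans (hm.mono hst))
  exact ⟨m', x, ds, h1, hfg'.trans (h2.mono hst'), h3⟩

/-- The flag in register `9` is set in a rejected branch, so the guard skips `P`. The stages and the
continuations of their measurements have this shape. -/
theorem KeepsDead.guard {P : Prog} :
    KeepsDead (n := n) U ε V w (.ite (.reg 9) .skip P) := by
  intro u t c hc d hd
  have h9 : c.mem 9 = 1 := hc.rej
  simp only [run, Expr.eval, h9, ne_eq, one_ne_zero, not_false_eq_true, if_true,
    List.mem_singleton] at hd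
  subst hd
  refine ⟨h9, hc.bdd, hc.uses, ?_⟩
  have h1 := Expr.cost_le_costBound hc.bdd (.reg 9)
  have h2 := hc.steps
  simp only [Branch.tick, Prog.costBound]
  omega

/-- `P` does not branch, so all rejected branches arise in `Q` and none has to be traced through a
later program. -/
theorem Triple.seqRej {s s' s'' : ℕ} {P Q : Prog} {f f' f'' : ℕ → ℕ}
    {F G : QState (n + w) → QState (n + w)} {u v : ℕ} (hP : Triple U ε V s P f s' f' F u)
    (hQ : RejTriple U ε V s' Q f' s'' f'' G v) :
    RejTriple U ε V s (.seq P Q) f s'' f'' (G ∘ F) (u + v) := by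
  intro c hc hm
  obtain ⟨m1, t1, h1, h2, h3, h4⟩ := hP c hc hm
  obtain ⟨m2, t2, ds, k1, k2, k3, k4, k5⟩ := hQ ⟨m1, F c.state, c.uses + u, c.steps + t1⟩ h1 h2
  refine ⟨m2, t1 + t2, ds, k1, k2, Nat.add_le_add h3 k3, ?_, fun d hd => (k5 d hd).mono ?_ ?_⟩
  · simp only [run, h4, List.flatMap_cons, List.flatMap_nil, List.append_nil, k4]
    simp [add_assoc]
  · simp only; omega
  · simp only [Prog.costBound]; omega

theorem RejTriple.ite {s s' : ℕ} {e : Expr} {P Q : Prog} {f f' : ℕ → ℕ}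
    {F : QState (n + w) → QState (n + w)} {u : ℕ} (he : e.regsLT s)
    (hP : e.eval f ≠ 0 → RejTriple U ε V s P f s' f' F u)
    (hQ : e.eval f = 0 → RejTriple U ε V s Q f s' f' F u) :
    RejTriple U ε V s (.ite e P Q) f s' f' F u := by
  intro c hc hm
  have hev := Expr.eval_congr hm he
  have hcost := e.cost_le_costBound hc
  by_cases h : e.eval f = 0
  · obtain ⟨m1, t1, ds, h1, h2, h3, h4, h5⟩ := hQ h (c.tick (1 + e.cost c.mem)) hc hm
    refine ⟨m1, 1 + e.cost c.mem + t1, ds, h1, h2, ?_, ?_, fun d hd => (h5 d hd).mono le_rfl ?_⟩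
    · simp only [Prog.costBound]; omega
    · simp only [run, hev, h, ne_eq, not_true_eq_false, if_false]
      rw [h4]
      simp [Branch.tick, add_assoc]
    · simp only [Branch.tick, Prog.costBound]; omega
  · obtain ⟨m1, t1, ds, h1, h2, h3, h4, h5⟩ := hP h (c.tick (1 + e.cost c.mem)) hc hm
    refine ⟨m1, 1 + e.cost c.mem + t1, ds, h1, h2, ?_, ?_, fun d hd => (h5 d hd).mono le_rfl ?_⟩
    · simp only [Prog.costBound]; omega
    · simp only [run, hev]
      rw [if_pos h, h4]
      simp [Branch.tick, add_assoc]
    · simp only [Branch.tick, Prog.costBound]; omega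

/-- The surviving branch may shed rejected branches in every round, and the old ones run through `P`
again; `KeepsDead` makes sure that they only accumulate steps. -/
theorem RejTriple.loop {s : ℕ} {e : Expr} {P : Prog} {f : ℕ → ℕ → ℕ} {N : ℕ}
    {F : ℕ → QState (n + w) → QState (n + w)} {u : ℕ → ℕ} (he : e.regsLT s)
    (hN : e.eval (f 0) = N)
    (hP : ∀ i < N, RejTriple U ε V s P (f i) s (f (i + 1)) (F i) (u i))
    (hd : KeepsDead U ε V w P) :
    RejTriple U ε V s (.loop e P) (f 0) s (f N) (opSeq F N) (∑ i ∈ Finset.range N, u i) := by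
  intro c hc hm
  have hev := Expr.eval_congr hm he
  have hcost := e.cost_le_costBound hc
  have hbd := e.eval_le_bound hc
  have key : ∀ i ≤ N, ∃ m' t ds, Bdd V m' ∧ Env s (f i) m' ∧ t ≤ i * (P.costBound V + 1) ∧
      (fun L : List (Branch n w) => L.flatMap fun c' => run U ε P (c'.tick 1))^[i]
        [c.tick (1 + e.cost c.mem)] = ⟨m', opSeq F i c.state,
          c.uses + ∑ j ∈ Finset.range i, u j, c.steps + (1 + e.cost c.mem) + t⟩ :: ds ∧
      ∀ d ∈ ds, Dead V (c.uses + ∑ j ∈ Finset.range i, u j)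
        (c.steps + (1 + e.cost c.mem) + i * (P.costBound V + 1)) d := by
    intro i hi
    induction i with
    | zero => exact ⟨c.mem, 0, [], hc, hm, by simp, by simp [Branch.tick, opSeq], by simp⟩
    | succ i ih =>
      obtain ⟨m1, t1, ds, h1, h2, h3, h4, h5⟩ := ih (by omega)
      obtain ⟨m2, t2, ds', k1, k2, k3, k4, k5⟩ := hP i (by omega) ⟨m1, opSeq F i c.state,
          c.uses + ∑ j ∈ Finset.range i, u j, c.steps + (1 + e.cost c.mem) + t1 + 1⟩ h1 h2
      refine ⟨m2, t1 + 1 + t2, ds' ++ ds.flatMap fun c' => run U ε P (c'.tick 1), k1, k2,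
        ?_, ?_, ?_⟩
      · rw [Nat.succ_mul]; omega
      · rw [Function.iterate_succ_apply', h4]
        simp only [List.flatMap_cons]
        have : ∀ x : Branch n w, x.tick 1 = ⟨x.mem, x.state, x.uses, x.steps + 1⟩ := fun x => rfl
        rw [this, k4, Finset.sum_range_succ]
        simp [add_assoc, opSeq]
      · intro d hd'
        rw [Nat.succ_mul, Finset.sum_range_succ]
        rcases List.mem_append.1 hd' with hd' | hd'
        · refine (k5 d hd').mono ?_ ?_ <;> simp only <;> omega
        · obtain ⟨d', h6, h7⟩ := List.mem_flatMap.1 hd'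
          have h8 := h5 d' h6
          have h9 : Dead V (c.uses + ∑ j ∈ Finset.range i, u j)
              (c.steps + (1 + e.cost c.mem) + i * (P.costBound V + 1) + 1) (d'.tick 1) :=
            ⟨h8.rej, h8.bdd, h8.uses, Nat.succ_le_succ h8.steps⟩
          exact (hd _ _ _ h9 d h7).mono (by omega) (by omega)
  obtain ⟨m1, t1, ds, h1, h2, h3, h4, h5⟩ := key N le_rfl
  have : N * (P.costBound V + 1) ≤ e.bound V * (P.costBound V + 1) :=
    Nat.mul_le_mul_right _ (by omega)
  refine ⟨m1, 1 + e.cost c.mem + t1, ds, h1, h2, ?_, ?_, fun d hd => (h5 d hd).mono le_rfl ?_⟩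
  · simp only [Prog.costBound]; omega
  · simp only [run]
    rw [hev, hN, h4]
    simp [add_assoc]
  · simp only [Prog.costBound]; omega

/-- Measure a qubit, and reject if the outcome is `1`. -/
theorem RejTriple.measure {s : ℕ} {q : Expr} {Q : Prog} {f f' : ℕ → ℕ} {s' u : ℕ}
    {F : QState (n + w) → QState (n + w)} (hq : q.regsLT s) (h9 : 9 < s) (hV : 1 ≤ V)
    (hN : q.eval f < n + w) (hf : f 9 = 0)
    (hQ : Triple U ε V s Q f s' f' F u) :
    RejTriple U ε V s (.seq (.measure q 9) (.ite (.reg 9) .skip Q)) f s' f'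
      (F ∘ opProj ⟨q.eval f, hN⟩ false) u := by
  intro c hc hm
  have hev := Expr.eval_congr hm hq
  have hcost := q.cost_le_costBound hc
  have hm9 : c.mem 9 = 0 := (hm 9 h9).trans hf
  -- Outcome `0` overwrites the flag with the value it already has, so this branch keeps its
  -- precondition.
  have hmem : Function.update c.mem 9 0 = c.mem := by rw [← hm9, Function.update_eq_self]
  have hT : Triple (n := n) (w := w) U ε V s (.ite (.reg 9) .skip Q) f s' f' F u :=
    Triple.ite h9 (fun h => absurd hf h) fun _ => hQ
  obtain ⟨m1, t1, h1, h2, h3, h4⟩ := hT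
    ⟨c.mem, opProj ⟨q.eval f, hN⟩ false c.state, c.uses, c.steps + (1 + q.cost c.mem)⟩ hc hm
  have hb1 : Bdd V (Function.update c.mem 9 1) := hc.update hV
  -- The rejected branches are those after outcome `1`; there the guard skips `Q`.
  refine ⟨m1, 1 + q.cost c.mem + t1, run U ε (.ite (.reg 9) .skip Q)
    ⟨Function.update c.mem 9 1, opProj ⟨q.eval f, hN⟩ true c.state, c.uses,
      c.steps + (1 + q.cost c.mem)⟩, h1, h2, ?_, ?_, ?_⟩
  · simp only [Prog.costBound] at h3 ⊢; omega
  · rw [run]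
    simp only [run.eq_def U ε (.measure q 9), hev, hN, dite_true, List.flatMap_cons,
      List.flatMap_nil, List.append_nil, Branch.tick, Branch.act, Branch.write, hmem]
    rw [h4]
    simp [add_assoc]
  · intro d hd
    refine (KeepsDead.guard (c.uses + u) (c.steps + (1 + q.costBound V)) _ ?_ d hd).mono
      le_rfl ?_
    · exact ⟨by simp, hb1, Nat.le_add_right _ _, by simp only; omega⟩
    · simp only [Prog.costBound]; omega

end Logic

/-! ## Quantum operations at numerical addresses -/

section Ops

variable {N : ℕ}

/-- The value of bit `a`, which is `false` outside the memory. -/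
def getBit (x : Bits N) (a : ℕ) : Bool := if h : a < N then x ⟨a, h⟩ else false

theorem getBit_of_lt (x : Bits N) {a : ℕ} (h : a < N) : getBit x a = x ⟨a, h⟩ := dif_pos h

@[simp] theorem getBit_val (x : Bits N) (j : Fin N) : getBit x j = x j := getBit_of_lt x j.2

theorem bits_ext {x y : Bits N} (h : ∀ a < N, getBit x a = getBit y a) : x = y :=
  funext fun j => by simpa using h j j.2

/-- Flip bit `a`. -/
def flipAt (a : ℕ) (x : Bits N) : Bits N := fun j => if (j : ℕ) = a then !x j else x j

theorem getBit_flipAt {a : ℕ} (x : Bits N) {b : ℕ} (hb : b < N) :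
    getBit (flipAt a x) b = if b = a then !getBit x b else getBit x b := by
  simp only [getBit_of_lt _ hb, flipAt]

theorem flipAt_flipAt (a : ℕ) (x : Bits N) : flipAt a (flipAt a x) = x := by
  funext j
  simp only [flipAt]
  split_ifs <;> simp

theorem flip_eq_flipAt (q : Fin N) (x : Bits N) : flip q x = flipAt q x := by
  funext j
  by_cases h : j = q
  · subst h; simp [flip, flipAt]
  · have h' : (j : ℕ) ≠ q := fun e => h (Fin.ext e)
    simp [flip, flipAt, h, h']

/-- The operation that permutes the basis states, `g` being the inverse of the permutation. -/
def pull (g : Bits N → Bits N) (ψ : QState N) : QState N := fun x => ψ (g x)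

/-- `pull` is contravariant: a sequence of gates acts on labels in the reverse order. -/
theorem pull_comp (g h : Bits N → Bits N) : pull g ∘ pull h = pull (h ∘ g) := rfl

theorem pull_id : pull (id : Bits N → Bits N) = id := rfl

/-- The Toffoli gate on basis states. -/
def ccx (a b q : ℕ) (x : Bits N) : Bits N :=
  if a ≠ q ∧ b ≠ q ∧ getBit x a = true ∧ getBit x b = true then flipAt q x else x

theorem atAddr_opX (a : ℕ) : atAddr a (opX (N := N)) = pull (flipAt a) := by
  funext ψ x
  by_cases h : a < N
  · simp only [atAddr, h, dite_true, opX, pull, flip_eq_flipAt]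
  · have : flipAt a x = x := funext fun j => if_neg (by have := j.2; omega)
    simp only [atAddr, h, dite_false, pull, this]

theorem atAddr_opCCX (a b q : ℕ) :
    (atAddr a fun x => atAddr b fun y => atAddr q fun t => opCCX (N := N) x y t) =
      pull (ccx a b q) := by
  funext ψ x
  by_cases ha : a < N
  · by_cases hb : b < N
    · by_cases hq : q < N
      · simp only [atAddr, ha, hb, hq, dite_true, opCCX, pull, ccx, flip_eq_flipAt,
          getBit_of_lt x ha, getBit_of_lt x hb, ne_eq, Fin.mk.injEq]
        split_ifs <;> rfl
      · have : flipAt q x = x := funext fun j => if_neg (by have := j.2; omega)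
        simp [atAddr, ha, hb, hq, pull, ccx, this]
    · simp [atAddr, ha, hb, pull, ccx, getBit]
  · simp [atAddr, ha, pull, ccx, getBit]

theorem atAddr_opCX (a q : ℕ) :
    (atAddr a fun x => atAddr q fun t => opCCX (N := N) x x t) = pull (ccx a a q) := by
  rw [← atAddr_opCCX]
  funext ψ
  by_cases ha : a < N <;> simp [atAddr, ha]

/-- The phase flip controlled by bit `a`. -/
def zOp (a : ℕ) (ψ : QState N) : QState N := fun x => if getBit x a = true then -ψ x else ψ x

theorem atAddr_opT_four (a : ℕ) :
    atAddr a (opT (N := N)) ∘ atAddr a opT ∘ atAddr a opT ∘ atAddr a opT = zOp a := by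
  funext ψ x
  by_cases h : a < N
  · simp only [Function.comp, atAddr, h, dite_true, opT, zOp, getBit_of_lt x h]
    split_ifs with hx
    · have h4 : Complex.exp (Complex.I * Real.pi / 4) ^ 4 = -1 := by
        rw [← Complex.exp_nat_mul]
        have : ((4 : ℕ) : ℂ) * (Complex.I * Real.pi / 4) = Real.pi * Complex.I := by
          push_cast; ring
        rw [this, Complex.exp_pi_mul_I]
      linear_combination ψ x * h4
    · rfl
  · simp [atAddr, h, zOp, getBit]

/-! ### Adjoints -/

/-- The inner product of two states. -/
noncomputable def dot (χ ψ : QState N) : ℂ := ∑ x, star (χ x) * ψ x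

theorem dot_self (ψ : QState N) : dot ψ ψ = (normSq ψ : ℂ) := by
  simp only [dot, normSq, Complex.ofReal_sum]
  refine Finset.sum_congr rfl fun x _ => ?_
  rw [Complex.star_def, mul_comm, Complex.mul_conj, Complex.normSq_eq_norm_sq]

theorem dot_add (χ ψ φ : QState N) : dot χ (ψ + φ) = dot χ ψ + dot χ φ := by
  simp only [dot, Pi.add_apply, mul_add, Finset.sum_add_distrib]

theorem dot_smul (χ ψ : QState N) (a : ℂ) : dot χ (a • ψ) = a * dot χ ψ := by
  simp only [dot, Pi.smul_apply, smul_eq_mul, Finset.mul_sum]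
  exact Finset.sum_congr rfl fun x _ => by ring

theorem dot_single (x : Bits N) (ψ : QState N) : dot (Pi.single x 1) ψ = ψ x := by
  rw [dot, Finset.sum_eq_single x]
  · simp
  · intro y _ hy; simp [hy]
  · simp

/-- The operations `F` and `G` are adjoint to each other. -/
def Adj (F G : QState N → QState N) : Prop := ∀ χ ψ, dot χ (F ψ) = dot (G χ) ψ

theorem Adj.comp {F G F' G' : QState N → QState N} (h : Adj F G) (h' : Adj F' G') :
    Adj (F ∘ F') (G' ∘ G) := fun χ ψ => (h χ (F' ψ)).trans (h' (G χ) ψ)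

/-- Linearity comes for free from the existence of an adjoint: an amplitude is an inner product with
a basis state, and moving `F` to that side leaves an expression linear in the state. -/
theorem Adj.add {F G : QState N → QState N} (h : Adj F G) (ψ φ : QState N) :
    F (ψ + φ) = F ψ + F φ := by
  funext x
  rw [Pi.add_apply, ← dot_single x (F (ψ + φ)), ← dot_single x (F ψ), ← dot_single x (F φ), h, h, h, dot_add]

theorem Adj.smul {F G : QState N → QState N} (h : Adj F G) (a : ℂ) (ψ : QState N) :
    F (a • ψ) = a • F ψ := by
  funext x
  rw [Pi.smul_apply, ← dot_single x (F (a • ψ)), ← dot_single x (F ψ), h, h, dot_smul, smul_eq_mul]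

theorem Adj.normSq_eq {F G : QState N → QState N} (h : Adj F G) (hGF : G ∘ F = id)
    (ψ : QState N) : normSq (F ψ) = normSq ψ := by
  have h1 := h (F ψ) ψ
  rw [dot_self, show G (F ψ) = ψ from congrFun hGF ψ, dot_self] at h1
  exact_mod_cast h1

theorem Adj.pull {g : Bits N → Bits N} (hg : Function.Involutive g) : Adj (pull g) (pull g) :=
  fun χ ψ => Fintype.sum_equiv hg.toPerm _ _ fun x => by simp [QTest.pull, hg x]

theorem Adj.zOp (a : ℕ) : Adj (zOp (N := N) a) (zOp a) := fun χ ψ =>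
  Finset.sum_congr rfl fun x _ => by
    simp only [QTest.zOp]
    split_ifs <;> simp

theorem flip_flip (q : Fin N) (x : Bits N) : flip q (flip q x) = x := by
  simp only [flip_eq_flipAt, flipAt_flipAt]

theorem flip_involutive (q : Fin N) : Function.Involutive (flip q) := flip_flip q

theorem Adj.opH (q : Fin N) : Adj (opH q) (opH q) := by
  intro χ ψ
  have hc : (starRingEnd ℂ) (√2 : ℂ) = √2 := Complex.conj_ofReal _
  have h1 : ∑ x, star (χ x) * ψ (flip q x) = ∑ x, star (χ (flip q x)) * ψ x :=
    Fintype.sum_equiv ((flip_involutive q).toPerm) _ _ fun x => by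
      simp only [Function.Involutive.coe_toPerm, flip_flip]
  calc dot χ (QTest.opH q ψ)
      = (1 / (√2 : ℂ)) * (∑ x, star (χ x) * ψ (flip q x) +
          ∑ x, star (χ x) * (if x q then -ψ x else ψ x)) := by
        simp only [dot, QTest.opH]
        rw [← Finset.sum_add_distrib, Finset.mul_sum]
        exact Finset.sum_congr rfl fun x _ => by ring
    _ = dot (QTest.opH q χ) ψ := by
        rw [h1]
        simp only [dot, QTest.opH]
        rw [← Finset.sum_add_distrib, Finset.mul_sum]
        refine Finset.sum_congr rfl fun x _ => ?_
        split_ifs <;> simp [hc] <;> ring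

theorem one_div_sqrt_two_sq : (1 / (√2 : ℂ)) * (1 / (√2 : ℂ)) = 1 / 2 := by
  have h : (√2 : ℂ) * (√2 : ℂ) = 2 := by
    rw [← Complex.ofReal_mul, Real.mul_self_sqrt (by norm_num)]; norm_num
  rw [div_mul_div_comm, h, one_mul]

theorem flip_apply_self (q : Fin N) (x : Bits N) : flip q x q = !x q := by simp [flip]

theorem flip_apply_ne {p q : Fin N} (h : p ≠ q) (x : Bits N) : flip q x p = x p := by
  simp [flip, h]

theorem flip_comm (p q : Fin N) (x : Bits N) : flip p (flip q x) = flip q (flip p x) := by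
  by_cases h : p = q
  · rw [h]
  · simp only [flip_eq_flipAt]
    have h' : (p : ℕ) ≠ q := fun e => h (Fin.ext e)
    funext j
    simp only [flipAt]
    split_ifs <;> rfl

theorem opH_comp_self (q : Fin N) : opH q ∘ opH q = id := by
  funext ψ x
  have h := one_div_sqrt_two_sq
  simp only [Function.comp, opH, flip_flip, flip_apply_self, id]
  cases x q <;> simp <;> field_simp at h ⊢ <;> linear_combination ψ x * h

theorem opH_comm (p q : Fin N) : opH p ∘ opH q = opH q ∘ opH p := by
  by_cases hpq : p = q
  · rw [hpq]
  funext ψ x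
  simp only [Function.comp, opH, flip_apply_ne hpq, flip_apply_ne (Ne.symm hpq), flip_comm p q]
  cases x q <;> cases x p <;> simp <;> ring

/-- A Hadamard gate on a qubit whose value is `0`. -/
theorem opH_apply_of_support {q : Fin N} {ψ : QState N} (h : ∀ x, x q = true → ψ x = 0)
    (x : Bits N) : opH q ψ x = (1 / (√2 : ℂ)) * ψ (Function.update x q false) := by
  cases hx : x q with
  | false =>
    have : ψ (flip q x) = 0 := h _ (by rw [flip_apply_self, hx]; rfl)
    rw [← hx, Function.update_eq_self]
    simp [opH, hx, this]
  | true =>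
    have h0 : ψ x = 0 := h x hx
    simp [opH, hx, h0, flip]

end Ops

/-! ### The code as an operator on the full quantum memory. -/

section Code

variable {n w : ℕ}

theorem sum_bits_append {M : Type*} [AddCommMonoid M] (f : Bits (n + w) → M) :
    ∑ x, f x = ∑ r : Bits w, ∑ c : Bits n, f (Fin.append c r) := by
  rw [← (Fin.appendEquiv n w).sum_comp, Fintype.sum_prod_type, Finset.sum_comm]
  rfl

theorem opCode_append (U : Matrix (Bits n) (Bits n) ℂ) (ψ : QState (n + w)) (c : Bits n)
    (r : Bits w) : opCode U ψ (Fin.append c r) = U.mulVec (fun y => ψ (Fin.append y r)) c := by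
  simp [opCode, Matrix.mulVec, dotProduct]

theorem Adj.opCode (U : Matrix (Bits n) (Bits n) ℂ) :
    Adj (opCode (w := w) U) (opCode U.conjTranspose) := by
  intro χ ψ
  simp only [dot, sum_bits_append, opCode_append, Matrix.mulVec, dotProduct, star_sum,
    Finset.mul_sum, Finset.sum_mul, Matrix.conjTranspose_apply, star_mul', star_star]
  refine Finset.sum_congr rfl fun r _ => ?_
  rw [Finset.sum_comm]
  exact Finset.sum_congr rfl fun y _ => Finset.sum_congr rfl fun c _ => by ring

theorem opCode_comp (U W : Matrix (Bits n) (Bits n) ℂ) :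
    opCode (w := w) U ∘ opCode W = opCode (U * W) := by
  funext ψ x
  obtain ⟨⟨c, r⟩, rfl⟩ := (Fin.appendEquiv n w).surjective x
  change opCode U (opCode W ψ) (Fin.append c r) = opCode (U * W) ψ (Fin.append c r)
  rw [opCode_append, opCode_append, ← Matrix.mulVec_mulVec]
  congr 1
  funext y
  rw [opCode_append]

theorem opCode_one : opCode (w := w) (1 : Matrix (Bits n) (Bits n) ℂ) = id := by
  funext ψ x
  obtain ⟨⟨c, r⟩, rfl⟩ := (Fin.appendEquiv n w).surjective x
  change opCode 1 ψ (Fin.append c r) = ψ (Fin.append c r)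
  rw [opCode_append, Matrix.one_mulVec]

theorem opCode_inv_comp {U : Matrix (Bits n) (Bits n) ℂ} (hU : U ∈ Matrix.unitaryGroup (Bits n) ℂ) :
    opCode (w := w) U.conjTranspose ∘ opCode U = id := by
  rw [opCode_comp, ← Matrix.star_eq_conjTranspose, Matrix.mem_unitaryGroup_iff'.1 hU, opCode_one]

theorem opCode_comp_inv {U : Matrix (Bits n) (Bits n) ℂ} (hU : U ∈ Matrix.unitaryGroup (Bits n) ℂ) :
    opCode (w := w) U ∘ opCode U.conjTranspose = id := by
  rw [opCode_comp, ← Matrix.star_eq_conjTranspose, Matrix.mem_unitaryGroup_iff.1 hU, opCode_one]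

theorem sum_norm_sq_mulVec {U : Matrix (Bits n) (Bits n) ℂ}
    (hU : U ∈ Matrix.unitaryGroup (Bits n) ℂ) (v : Bits n → ℂ) :
    ∑ c, ‖U.mulVec v c‖ ^ 2 = ∑ c, ‖v c‖ ^ 2 := by
  have h := (Adj.opCode (w := 0) U).normSq_eq (opCode_inv_comp hU)
    fun x => v fun j => x (Fin.castAdd 0 j)
  simp only [normSq, sum_bits_append, opCode_append, Fin.append_left] at h
  simpa using h

/-- For fixed work qubits the operation is `U` or the identity on the code qubits. The tester never
applies the controlled code; this serves `sum_normSq_run`, which covers every program. -/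
theorem normSq_opCodeCtrl {U : Matrix (Bits n) (Bits n) ℂ}
    (hU : U ∈ Matrix.unitaryGroup (Bits n) ℂ) (q : Fin (n + w)) (ψ : QState (n + w)) :
    normSq (opCodeCtrl U q ψ) = normSq ψ := by
  by_cases hq : n ≤ (q : ℕ)
  · simp only [normSq, sum_bits_append]
    refine Finset.sum_congr rfl fun r _ => ?_
    obtain ⟨i, rfl⟩ : ∃ i : Fin w, q = Fin.natAdd n i :=
      ⟨⟨q - n, by have := q.2; omega⟩, Fin.ext (by simp; omega)⟩
    simp only [opCodeCtrl, hq, true_and, Fin.append_right, opCode_append]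
    by_cases hr : r i = true
    · simp only [hr, if_true]
      exact sum_norm_sq_mulVec hU _
    · simp only [hr]
      rfl
  · have : opCodeCtrl U q ψ = ψ := by
      funext x
      simp [opCodeCtrl, hq]
    rw [this]

end Code

/-! ### Conservation of probability -/

theorem normSq_opProj {N : ℕ} (q : Fin N) (ψ : QState N) :
    normSq (opProj q false ψ) + normSq (opProj q true ψ) = normSq ψ := by
  simp only [normSq, ← Finset.sum_add_distrib]
  refine Finset.sum_congr rfl fun x _ => ?_
  cases h : x q <;> simp [opProj, h]

theorem normSq_atAddr {N : ℕ} {f : Fin N → QState N → QState N}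
    (h : ∀ q ψ, normSq (f q ψ) = normSq ψ) (a : ℕ) (ψ : QState N) :
    normSq (atAddr a f ψ) = normSq ψ := by
  unfold atAddr
  split_ifs
  · exact h _ _
  · rfl

theorem normSq_opCCX {N : ℕ} (a b q : Fin N) (ψ : QState N) :
    normSq (opCCX a b q ψ) = normSq ψ := by
  have hinv : Function.Involutive (fun x : Bits N =>
      if a ≠ q ∧ b ≠ q ∧ x a = true ∧ x b = true then flip q x else x) := by
    intro x
    by_cases h : a ≠ q ∧ b ≠ q ∧ x a = true ∧ x b = true
    · simp only [if_pos h]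
      rw [if_pos, flip_flip]
      exact ⟨h.1, h.2.1, by rw [flip_apply_ne h.1]; exact h.2.2.1,
        by rw [flip_apply_ne h.2.1]; exact h.2.2.2⟩
    · simp only [if_neg h]
  rw [← (Adj.pull hinv).normSq_eq (by rw [pull_comp, hinv.comp_self]; rfl) ψ]
  congr 1
  funext x
  simp only [opCCX, pull]
  split_ifs <;> rfl

theorem normSq_opX {N : ℕ} (q : Fin N) (ψ : QState N) : normSq (opX q ψ) = normSq ψ :=
  Fintype.sum_equiv ((flip_involutive q).toPerm) _ _ fun _ => rfl

theorem normSq_opH {N : ℕ} (q : Fin N) (ψ : QState N) : normSq (opH q ψ) = normSq ψ :=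
  (Adj.opH q).normSq_eq (opH_comp_self q) ψ

theorem normSq_opT {N : ℕ} (q : Fin N) (ψ : QState N) : normSq (opT q ψ) = normSq ψ := by
  refine Finset.sum_congr rfl fun x _ => ?_
  simp only [opT]
  split_ifs
  · rw [norm_mul, show Complex.I * Real.pi / 4 = (Real.pi / 4 : ℝ) * Complex.I by push_cast; ring,
      Complex.norm_exp_ofReal_mul_I, one_mul]
  · rfl

theorem sum_map_flatMap {α : Type*} {L : List α} {f : α → List α} {v : α → ℝ}
    (h : ∀ c, ((f c).map v).sum = v c) : ((L.flatMap f).map v).sum = (L.map v).sum := by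
  induction L with
  | nil => rfl
  | cons c L ih => simp [h c, ih]

/-- The probabilities of the branches of a program add up to the probability of the branch
from which it started. -/
theorem sum_normSq_run {n w : ℕ} {U : Matrix (Bits n) (Bits n) ℂ}
    (hU : U ∈ Matrix.unitaryGroup (Bits n) ℂ) (ε : ℝ) (P : Prog) :
    ∀ c : Branch n w, ((run U ε P c).map fun d => normSq d.state).sum = normSq c.state := by
  induction P with
  | skip => intro c; simp [run, Branch.tick]
  | set r e => intro c; simp [run, Branch.tick, Branch.write]
  | readAccuracy r e => intro c; simp [run, Branch.tick, Branch.write]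
  | gateX q => intro c; simp [run, Branch.tick, Branch.act, normSq_atAddr normSq_opX]
  | gateH q => intro c; simp [run, Branch.tick, Branch.act, normSq_atAddr normSq_opH]
  | gateT q => intro c; simp [run, Branch.tick, Branch.act, normSq_atAddr normSq_opT]
  | gateCX a q =>
    intro c
    simp only [run, Branch.tick, Branch.act, List.map_cons, List.map_nil, List.sum_singleton]
    exact normSq_atAddr (fun x ψ => normSq_atAddr (fun y φ => normSq_opCCX _ _ _ _) _ _) _ _
  | gateCCX a b q =>
    intro c
    simp only [run, Branch.tick, Branch.act, List.map_cons, List.map_nil, List.sum_singleton]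
    exact normSq_atAddr (fun x ψ => normSq_atAddr (fun y φ =>
      normSq_atAddr (fun z φ' => normSq_opCCX _ _ _ _) _ _) _ _) _ _
  | measure q r =>
    intro c
    by_cases h : q.eval c.mem < n + w
    · simp [run, h, Branch.tick, Branch.act, Branch.write, normSq_opProj]
    · simp [run, h, Branch.tick, Branch.write]
  | code =>
    intro c
    simpa [run, Branch.tick, Branch.act, Branch.use] using
      (Adj.opCode U).normSq_eq (opCode_inv_comp hU) c.state
  | codeInv =>
    intro c
    have h := (Adj.opCode (w := w) U.conjTranspose).normSq_eq (by
      rw [Matrix.conjTranspose_conjTranspose]; exact opCode_comp_inv hU) c.state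
    simpa [run, Branch.tick, Branch.act, Branch.use] using h
  | codeCtrl q =>
    intro c
    simp [run, Branch.tick, Branch.act, Branch.use, normSq_atAddr (normSq_opCodeCtrl hU)]
  | seq P Q ihP ihQ => intro c; simp only [run]; rw [sum_map_flatMap ihQ, ihP]
  | ite e P Q ihP ihQ =>
    intro c
    simp only [run]
    split_ifs
    · exact ihP _
    · exact ihQ _
  | loop e P ih =>
    intro c
    simp only [run]
    generalize e.eval c.mem = i
    induction i with
    | zero => simp [Branch.tick]
    | succ i ih' =>
      rw [Function.iterate_succ_apply', sum_map_flatMap (fun c' => ih (c'.tick 1)), ih']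

/-! ## Classical reversible computations -/

section Labels

variable {N : ℕ}

theorem getBit_of_ge (x : Bits N) {a : ℕ} (h : N ≤ a) : getBit x a = false :=
  dif_neg (by omega)

theorem flipAt_comm (a b : ℕ) (x : Bits N) : flipAt a (flipAt b x) = flipAt b (flipAt a x) := by
  funext j
  simp only [flipAt]
  split_ifs <;> rfl

/-- Flip bit `q` if bit `a` is `1` and bit `b` is `0`. -/
def ncc (a b q : ℕ) (x : Bits N) : Bits N :=
  if getBit x a = true ∧ getBit x b = false then flipAt q x else x

theorem getBit_flipAt_ne {a b : ℕ} (h : b ≠ a) (x : Bits N) :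
    getBit (flipAt a x) b = getBit x b := by
  by_cases hb : b < N
  · rw [getBit_flipAt x hb, if_neg h]
  · rw [getBit_of_ge _ (by omega), getBit_of_ge _ (by omega)]

theorem getBit_ncc_ne {a b q j : ℕ} (h : j ≠ q) (x : Bits N) :
    getBit (ncc a b q x) j = getBit x j := by
  unfold ncc
  split_ifs
  · exact getBit_flipAt_ne h x
  · rfl

theorem ncc_ncc {a b q : ℕ} (ha : a ≠ q) (hb : b ≠ q) (x : Bits N) :
    ncc a b q (ncc a b q x) = x := by
  rw [ncc, getBit_ncc_ne ha, getBit_ncc_ne hb]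
  unfold ncc
  split_ifs
  · exact flipAt_flipAt _ _
  · rfl

/-- A negated control is obtained by conjugating with NOT. The condition `b < N` matters: outside
the memory the NOT is void while `getBit` still reads `false`. -/
theorem ncc_eq {a b q : ℕ} (ha : a ≠ q) (hb : b ≠ q) (hab : a ≠ b) (hN : b < N) (x : Bits N) :
    flipAt b (ccx a b q (flipAt b x)) = ncc a b q x := by
  simp only [ccx, ncc, getBit_flipAt_ne hab, getBit_flipAt x hN, if_true, ne_eq, ha, hb,
    not_false_eq_true, true_and, Bool.not_eq_true']
  split_ifs
  · rw [flipAt_comm, flipAt_flipAt]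
  · rw [flipAt_flipAt]

/-- Compute, into the bits `p + 1, …, p + t`, whether the bits `lo, …, lo + i - 1` are `0`, for
`i = 1, …, t`. -/
def fwd (p lo : ℕ) : ℕ → Bits N → Bits N
  | 0 => flipAt p
  | t + 1 => ncc (p + t) (lo + t) (p + t + 1) ∘ fwd p lo t

/-- The inverse of `fwd`. -/
def bwd (p lo : ℕ) : ℕ → Bits N → Bits N
  | 0 => flipAt p
  | t + 1 => bwd p lo t ∘ ncc (p + t) (lo + t) (p + t + 1)

/-- The tested bits end before the chain begins, so every gate has its target apart from its
controls and is an involution. -/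
theorem bwd_fwd {p lo t : ℕ} (h : lo + t ≤ p) (x : Bits N) : bwd p lo t (fwd p lo t x) = x := by
  induction t with
  | zero => exact flipAt_flipAt _ _
  | succ t ih =>
    simp only [bwd, fwd, Function.comp]
    rw [ncc_ncc (by omega) (by omega), ih (by omega)]

theorem getBit_fwd_of_lt {p lo t j : ℕ} (h : j < p ∨ p + t < j) (x : Bits N) :
    getBit (fwd p lo t x) j = getBit x j := by
  induction t with
  | zero => exact getBit_flipAt_ne (by omega) x
  | succ t ih =>
    simp only [fwd, Function.comp]
    rw [getBit_ncc_ne (by omega), ih (by omega)]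

/-- All bits from `p` on are `0`. -/
def AncZero (p : ℕ) (x : Bits N) : Prop := ∀ j, p ≤ j → getBit x j = false

/-- The chain computes a running conjunction: bit `p` becomes `1`, and each further ancilla receives
the previous one if the next tested bit is `0`. This requires the ancillas to be clean. -/
theorem getBit_fwd {p lo t : ℕ} (h : lo + t ≤ p) (hN : p + t < N) {x : Bits N}
    (hx : AncZero p x) :
    getBit (fwd p lo t x) (p + t) = true ↔ ∀ i < t, getBit x (lo + i) = false := by
  induction t with
  | zero =>
    rw [add_zero] at hN ⊢
    rw [fwd, getBit_flipAt x hN, if_pos rfl, hx p le_rfl]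
    simp
  | succ t ih =>
    have ih' := ih (by omega) (by omega)
    have h1 : getBit (fwd p lo t x) (lo + t) = getBit x (lo + t) :=
      getBit_fwd_of_lt (by omega) x
    have h2 : getBit (fwd p lo t x) (p + t + 1) = false := by
      rw [getBit_fwd_of_lt (by omega)]; exact hx _ (by omega)
    simp only [fwd, Function.comp, ncc]
    rw [Nat.forall_lt_succ_right, ← ih', h1, ← add_assoc]
    split_ifs with hc
    · rw [getBit_flipAt _ (by omega), if_pos rfl, h2]
      simp [hc]
    · rw [h2]
      simp only [Bool.false_eq_true, false_iff]
      exact hc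

/-- Add the bits `b 0, b 1, …` (modulo 2) to the bits of `x` from `base` on. -/
def xorFrom (base : ℕ) (b : ℕ → Bool) (x : Bits N) : Bits N :=
  fun j => if base ≤ (j : ℕ) then xor (x j) (b (j - base)) else x j

theorem xorFrom_zero (base : ℕ) (x : Bits N) : xorFrom base (fun _ => false) x = x := by
  funext j
  simp [xorFrom]

theorem xorFrom_comm (base base' : ℕ) (b b' : ℕ → Bool) (x : Bits N) :
    xorFrom base b (xorFrom base' b' x) = xorFrom base' b' (xorFrom base b x) := by
  funext j
  simp only [xorFrom]
  split_ifs <;> first | rfl | exact Bool.xor_right_comm _ _ _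

theorem xorFrom_xorFrom (base : ℕ) (b b' : ℕ → Bool) (x : Bits N) :
    xorFrom base b (xorFrom base b' x) = xorFrom base (fun i => xor (b' i) (b i)) x := by
  funext j
  simp only [xorFrom]
  split_ifs <;> simp

theorem xorFrom_self (base : ℕ) (b : ℕ → Bool) (x : Bits N) :
    xorFrom base b (xorFrom base b x) = x := by
  rw [xorFrom_xorFrom]
  simp [xorFrom_zero]

theorem xorFrom_flipAt (base : ℕ) (b : ℕ → Bool) (a : ℕ) (x : Bits N) :
    xorFrom base b (flipAt a x) = flipAt a (xorFrom base b x) := by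
  funext j
  simp only [xorFrom, flipAt]
  split_ifs <;> simp

theorem getBit_xorFrom_ge (base : ℕ) (b : ℕ → Bool) (x : Bits N) {a : ℕ} (h : base ≤ a)
    (ha : a < N) : getBit (xorFrom base b x) a = xor (getBit x a) (b (a - base)) := by
  simp [getBit_of_lt _ ha, xorFrom, h]

theorem getBit_xorFrom_of {base l : ℕ} {b : ℕ → Bool} (hb : ∀ i, l ≤ i → b i = false) {a : ℕ}
    (ha : a < base ∨ base + l ≤ a) (x : Bits N) : getBit (xorFrom base b x) a = getBit x a := by
  by_cases hN : a < N
  · by_cases hba : base ≤ a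
    · rw [getBit_xorFrom_ge _ _ _ hba hN, hb _ (by omega), Bool.xor_false]
    · simp [getBit_of_lt _ hN, xorFrom, hba]
  · rw [getBit_of_ge _ (by omega), getBit_of_ge _ (by omega)]

theorem xorFrom_ncc {base l : ℕ} {b : ℕ → Bool} (hb : ∀ i, l ≤ i → b i = false) {c d q : ℕ}
    (hc : c < base ∨ base + l ≤ c) (hd : d < base ∨ base + l ≤ d) (x : Bits N) :
    xorFrom base b (ncc c d q x) = ncc c d q (xorFrom base b x) := by
  unfold ncc
  rw [getBit_xorFrom_of hb hc, getBit_xorFrom_of hb hd]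
  split_ifs
  · rw [xorFrom_flipAt]
  · rfl

theorem xorFrom_fwd {base l p lo t : ℕ} {b : ℕ → Bool} (hb : ∀ i, l ≤ i → b i = false)
    (h : lo + t ≤ base) (hp : base + l ≤ p) (x : Bits N) :
    xorFrom base b (fwd p lo t x) = fwd p lo t (xorFrom base b x) := by
  induction t with
  | zero => exact xorFrom_flipAt _ _ _ _
  | succ t ih =>
    simp only [fwd, Function.comp]
    rw [xorFrom_ncc hb (by omega) (by omega), ih (by omega)]

theorem xorFrom_bwd {base l p lo t : ℕ} {b : ℕ → Bool} (hb : ∀ i, l ≤ i → b i = false)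
    (h : lo + t ≤ base) (hp : base + l ≤ p) (x : Bits N) :
    xorFrom base b (bwd p lo t x) = bwd p lo t (xorFrom base b x) := by
  induction t generalizing x with
  | zero => exact xorFrom_flipAt _ _ _ _
  | succ t ih =>
    simp only [bwd, Function.comp]
    rw [ih (by omega), xorFrom_ncc hb (by omega) (by omega)]

/-! ### Operations that add a computed value to a register -/

/-- `F` adds bits to the `l`-bit register at address `base` that depend on the other bits only;
they are `G y` if the bits of `y` after the register are `0`. -/
def XorOp (base l : ℕ) (F : QState N → QState N) (G : Bits N → ℕ → Bool) : Prop :=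
  ∃ g : Bits N → ℕ → Bool, F = pull (fun y => xorFrom base (g y) y) ∧
    (∀ y i, l ≤ i → g y i = false) ∧
    (∀ y d, (∀ i, l ≤ i → d i = false) → g (xorFrom base d y) = g y) ∧
    ∀ y, AncZero (base + l) y → g y = G y

theorem XorOp.id (base l : ℕ) : XorOp (N := N) base l id fun _ _ => false :=
  ⟨fun _ _ => false, by simp only [xorFrom_zero]; rfl, fun _ _ _ => rfl, fun _ _ _ => rfl,
    fun _ _ => rfl⟩

/-- Neither addend depends on the register that is written, so the second operation sees the same
control bits as the first and the addends are simply added modulo 2. -/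
theorem XorOp.comp {base l : ℕ} {F F' : QState N → QState N} {G G' : Bits N → ℕ → Bool}
    (h : XorOp base l F G) (h' : XorOp base l F' G') :
    XorOp base l (F' ∘ F) fun y i => xor (G y i) (G' y i) := by
  obtain ⟨g, rfl, h1, h2, h3⟩ := h
  obtain ⟨g', rfl, h1', h2', h3'⟩ := h'
  refine ⟨fun y i => xor (g y i) (g' y i), ?_, ?_, ?_, ?_⟩
  · rw [pull_comp]
    congr 1
    funext y
    simp only [Function.comp]
    rw [h2 y _ (h1' y), xorFrom_comm, xorFrom_xorFrom]
  · intro y i hi; simp only [h1 y i hi, h1' y i hi, Bool.xor_false]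
  · intro y d hd; simp only [h2 y d hd, h2' y d hd]
  · intro y hy; simp only [h3 y hy, h3' y hy]

/-- The addend survives the addition unchanged, so the label map is an involution. -/
theorem XorOp.adj {base l : ℕ} {F : QState N → QState N} {G : Bits N → ℕ → Bool}
    (h : XorOp base l F G) : Adj F F ∧ F ∘ F = _root_.id := by
  obtain ⟨g, rfl, h1, h2, -⟩ := h
  have : Function.Involutive fun y : Bits N => xorFrom base (g y) y := fun y => by
    simp only [h2 y _ (h1 y), xorFrom_self]
  exact ⟨Adj.pull this, by rw [pull_comp, this.comp_self]; rfl⟩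

end Labels

/-! ## Subprograms -/

section Programs

variable {n w : ℕ} {U : Matrix (Bits n) (Bits n) ℂ} {ε : ℝ} {V : ℕ}

/-- Flip qubit `q` if qubit `a` is `1` and qubit `b` is `0`. -/
def Prog.andNot (a b q : Expr) : Prog := .seq (.gateX b) (.seq (.gateCCX a b q) (.gateX b))

theorem Triple.andNot {s : ℕ} {a b q : Expr} {f : ℕ → ℕ} (ha : a.regsLT s) (hb : b.regsLT s)
    (hq : q.regsLT s) (haq : a.eval f ≠ q.eval f) (hbq : b.eval f ≠ q.eval f)
    (hab : a.eval f ≠ b.eval f) (hN : b.eval f < n + w) :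
    Triple (n := n) (w := w) U ε V s (.andNot a b q) f s f
      (pull (ncc (a.eval f) (b.eval f) (q.eval f))) 0 := by
  refine ((Triple.gateX hb).seq ((Triple.gateCCX ha hb hq).seq (Triple.gateX hb))).op_congr ?_
  rw [atAddr_opX, atAddr_opCCX, pull_comp, pull_comp]
  congr 1
  funext x
  exact ncc_eq haq hbq hab hN x

/-- One step of the computation of `fwd`; register `5` holds the first ancilla address. -/
def Prog.chainStep (lo i : Expr) : Prog :=
  .andNot (.add (.reg 5) i) (.add lo i) (.add (.add (.reg 5) i) (.lit 1))

/-- Compute whether the `L` qubits from `lo` on are all `0`. -/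
def Prog.compute (s : ℕ) (lo L : Expr) : Prog :=
  .seq (.gateX (.reg 5)) (.forUp s L (.chainStep lo (.reg s)))

/-- Undo `Prog.compute`. -/
def Prog.uncompute (s : ℕ) (lo L : Expr) : Prog :=
  .seq (.forUp s L (.chainStep lo (.sub (.sub L (.lit 1)) (.reg s)))) (.gateX (.reg 5))

/-- The gates are run in the order of `fwd`, but a state is transported by the inverse permutation,
hence `bwd`. In `opSeq_fwd` the countdown `t - 1 - i` gives the opposite order. -/
theorem opSeq_bwd {N : ℕ} (p lo t : ℕ) :
    opSeq (fun i => pull (ncc (N := N) (p + i) (lo + i) (p + i + 1))) t ∘ pull (flipAt p) =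
      pull (bwd p lo t) := by
  induction t with
  | zero => rfl
  | succ t ih => rw [opSeq, Function.comp_assoc, ih, pull_comp]; rfl

theorem opSeq_fwd {N : ℕ} (p lo t : ℕ) :
    pull (flipAt p) ∘ opSeq (fun i => pull (ncc (N := N) (p + (t - 1 - i)) (lo + (t - 1 - i))
      (p + (t - 1 - i) + 1))) t = pull (fwd p lo t) := by
  induction t with
  | zero => rfl
  | succ t ih =>
    rw [opSeq_succ', ← Function.comp_assoc]
    have : ∀ i, t + 1 - 1 - (i + 1) = t - 1 - i := fun i => by omega
    simp only [this]
    rw [ih, pull_comp]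
    rfl

theorem Triple.compute {s : ℕ} {lo L : Expr} {f : ℕ → ℕ} {p a t : ℕ} (hs : 5 < s)
    (hlo : lo.regsLT s) (hL : L.regsLT s) (ha : lo.eval f = a) (ht : L.eval f = t) (hp : f 5 = p)
    (hap : a + t ≤ p) (hpN : p + t < n + w) (hV : t ≤ V) :
    Triple (n := n) (w := w) U ε V s (.compute s lo L) f s f (pull (bwd p a t)) 0 := by
  refine ((Triple.gateX (q := .reg 5) hs).seq (Triple.forUp (u := 0) hL ht hV
    (F := fun i => pull (ncc (p + i) (a + i) (p + i + 1))) ?_)).conseq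
    le_rfl Env.rfl' le_rfl Env.rfl' ?_ (by simp)
  · intro i hi
    have e1 : (Expr.reg 5).eval (Function.update f s i) = p := by
      simp only [Expr.eval]; rw [Function.update_of_ne (by omega), hp]
    have e2 : lo.eval (Function.update f s i) = a := by
      rw [Expr.eval_congr (Env.rfl'.update_ge le_rfl i) hlo, ha]
    have e3 : (Expr.reg s).eval (Function.update f s i) = i := by simp [Expr.eval]
    have h5 : Expr.regsLT (s + 1) (.reg 5) := by simp only [Expr.regsLT]; omega
    have hs' : Expr.regsLT (s + 1) (.reg s) := by simp [Expr.regsLT]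
    have hlo' := hlo.mono (Nat.le_succ s)
    refine (Triple.andNot (a := .add (.reg 5) (.reg s)) (b := .add lo (.reg s))
      (q := .add (.add (.reg 5) (.reg s)) (.lit 1)) ⟨h5, hs'⟩ ⟨hlo', hs'⟩
      ⟨⟨h5, hs'⟩, trivial⟩ ?_ ?_ ?_ ?_).op_congr ?_
    all_goals simp only [Expr.eval] at e1 e2 e3 ⊢; simp only [e1, e2, e3]
    all_goals omega
  · rw [atAddr_opX, ← opSeq_bwd, ← hp]
    rfl

theorem Triple.uncompute {s : ℕ} {lo L : Expr} {f : ℕ → ℕ} {p a t : ℕ} (hs : 5 < s)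
    (hlo : lo.regsLT s) (hL : L.regsLT s) (ha : lo.eval f = a) (ht : L.eval f = t) (hp : f 5 = p)
    (hap : a + t ≤ p) (hpN : p + t < n + w) (hV : t ≤ V) :
    Triple (n := n) (w := w) U ε V s (.uncompute s lo L) f s f (pull (fwd p a t)) 0 := by
  refine ((Triple.forUp (u := 0) hL ht hV (F := fun i => pull (ncc (p + (t - 1 - i))
    (a + (t - 1 - i)) (p + (t - 1 - i) + 1))) ?_).seq (Triple.gateX (q := .reg 5) hs)).conseq
    le_rfl Env.rfl' le_rfl Env.rfl' ?_ (by simp)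
  · intro i hi
    have hf : Env s f (Function.update f s i) := Env.rfl'.update_ge le_rfl i
    have e1 : (Expr.reg 5).eval (Function.update f s i) = p := by
      simp only [Expr.eval]; rw [Function.update_of_ne (by omega), hp]
    have e2 : lo.eval (Function.update f s i) = a := by rw [Expr.eval_congr hf hlo, ha]
    have e3 : (Expr.sub (.sub L (.lit 1)) (.reg s)).eval (Function.update f s i) = t - 1 - i := by
      simp only [Expr.eval, Expr.eval_congr hf hL, ht, Function.update_self]
    have h5 : Expr.regsLT (s + 1) (.reg 5) := by simp only [Expr.regsLT]; omega
    have hs' : Expr.regsLT (s + 1) (.sub (.sub L (.lit 1)) (.reg s)) :=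
      ⟨⟨hL.mono (Nat.le_succ s), trivial⟩, by simp [Expr.regsLT]⟩
    have hlo' := hlo.mono (Nat.le_succ s)
    generalize hE : (Expr.sub (.sub L (.lit 1)) (.reg s)) = E at e3 hs'
    rw [Prog.chainStep]
    refine (Triple.andNot (a := .add (.reg 5) E) (b := .add lo E)
      (q := .add (.add (.reg 5) E) (.lit 1)) ⟨h5, hs'⟩ ⟨hlo', hs'⟩
      ⟨⟨h5, hs'⟩, trivial⟩ ?_ ?_ ?_ ?_).op_congr ?_
    all_goals simp only [Expr.eval] at e1 e2 e3 ⊢; simp only [e1, e2, e3]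
    all_goals omega
  · rw [atAddr_opX, ← opSeq_fwd, ← hp]
    rfl

/-- The phase flip controlled by qubit `q`. -/
def Prog.gateZ (q : Expr) : Prog :=
  .seq (.seq (.gateT q) (.gateT q)) (.seq (.gateT q) (.gateT q))

theorem Triple.gateZ {s : ℕ} {q : Expr} {f : ℕ → ℕ} (hq : q.regsLT s) :
    Triple (n := n) (w := w) U ε V s (.gateZ q) f s f (zOp (q.eval f)) 0 := by
  have h := (Triple.gateT (n := n) (w := w) (U := U) (ε := ε) (V := V) (f := f) hq)
  refine ((h.seq h).seq (h.seq h)).op_congr ?_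
  rw [← atAddr_opT_four]
  rfl

/-- Flip the phase if the first `L` qubits are all `0`. -/
def Prog.zeroPhase (s : ℕ) (L : Expr) : Prog :=
  .seq (.compute s (.lit 0) L) (.seq (.gateZ (.add (.reg 5) L)) (.uncompute s (.lit 0) L))

/-- The operation of `Prog.zeroPhase`. -/
def zeroPhaseOp {N : ℕ} (p t : ℕ) (ψ : QState N) : QState N :=
  fun x => if getBit (fwd p 0 t x) (p + t) = true then -ψ x else ψ x

theorem Triple.zeroPhase {s : ℕ} {L : Expr} {f : ℕ → ℕ} {p t : ℕ} (hs : 5 < s)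
    (hL : L.regsLT s) (ht : L.eval f = t) (hp : f 5 = p)
    (hap : t ≤ p) (hpN : p + t < n + w) (hV : t ≤ V) :
    Triple (n := n) (w := w) U ε V s (.zeroPhase s L) f s f (zeroPhaseOp p t) 0 := by
  refine ((Triple.compute (a := 0) hs (lo := .lit 0) trivial hL rfl ht hp (by omega) hpN hV).seq
    ((Triple.gateZ (q := .add (.reg 5) L) ⟨hs, hL⟩).seq
    (Triple.uncompute (a := 0) hs (lo := .lit 0) trivial hL rfl ht hp (by omega) hpN hV))).op_congr ?_
  have : (Expr.add (.reg 5) L).eval f = p + t := by simp only [Expr.eval, hp, ht]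
  rw [this]
  funext ψ x
  simp only [Function.comp, pull, zOp, zeroPhaseOp, bwd_fwd (show 0 + t ≤ p by omega)]

/-- For the bits `i < len` of the value of `v` that are `1`, run `P`, with `i` in register
`s + 1`. -/
def Prog.forBits (s : ℕ) (v len : Expr) (P : Prog) : Prog :=
  .seq (.set s v) (.seq (.set (s + 1) (.lit 0)) (.loop len
    (.seq (.ite (.sub (.reg s) (.mul (.lit 2) (.div (.reg s) (.lit 2)))) P .skip)
      (.seq (.set s (.div (.reg s) (.lit 2))) (.set (s + 1) (.add (.reg (s + 1)) (.lit 1)))))))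

theorem Triple.forBits {s : ℕ} {v len : Expr} {P : Prog} {f : ℕ → ℕ} {x t : ℕ}
    {F : ℕ → QState (n + w) → QState (n + w)} (hv : v.regsLT s) (hl : len.regsLT s)
    (hx : v.eval f = x) (ht : len.eval f = t) (hxV : x ≤ V) (htV : t ≤ V)
    (hP : ∀ i < t, ∀ y, Triple U ε V (s + 2) P
      (Function.update (Function.update f s y) (s + 1) i) (s + 2)
      (Function.update (Function.update f s y) (s + 1) i) (F i) 0) :
    Triple U ε V s (.forBits s v len P) f s f
      (opSeq (fun i => if x.testBit i = true then F i else id) t) 0 := by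
  -- After `i` rounds register `s` holds `x / 2 ^ i`, whose parity is bit `i` of `x`.
  let g : ℕ → ℕ → ℕ := fun i => Function.update (Function.update f s (x / 2 ^ i)) (s + 1) i
  have hg : ∀ i, Env s f (g i) := fun i =>
    (Env.rfl'.update_ge le_rfl _).update_ge (Nat.le_succ s) _
  have gs : ∀ i, g i s = x / 2 ^ i := fun i => by simp [g]
  have gs' : ∀ i, g i (s + 1) = i := fun i => by simp [g]
  have h1 : Triple (n := n) (w := w) U ε V s (.set s v) f (s + 1) (Function.update f s x) id 0 :=
    hx ▸ Triple.set hv (hx ▸ hxV) (by simp)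
  have h2 : Triple (n := n) (w := w) U ε V (s + 1) (.set (s + 1) (.lit 0))
      (Function.update f s x) (s + 2) (g 0) id 0 := by
    refine (Triple.set (e := .lit 0) trivial (by simp [Expr.eval]) (by simp)).conseq
      le_rfl Env.rfl' le_rfl ?_ rfl rfl
    simp [g, Expr.eval, Env]
  have h3 := Triple.loop (U := U) (ε := ε) (V := V) (s := s + 2) (e := len) (f := g) (N := t)
    (u := fun _ => 0) (F := fun i => if x.testBit i = true then F i else id)
    (P := (.seq (.ite (.sub (.reg s) (.mul (.lit 2) (.div (.reg s) (.lit 2)))) P .skip)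
      (.seq (.set s (.div (.reg s) (.lit 2))) (.set (s + 1) (.add (.reg (s + 1)) (.lit 1))))))
    (hl.mono (by omega)) (by rw [Expr.eval_congr (hg 0) hl, ht]) (by
      intro i hi
      have hbit : (Expr.sub (.reg s) (.mul (.lit 2) (.div (.reg s) (.lit 2)))).eval (g i) ≠ 0 ↔
          x.testBit i = true := by
        simp only [Expr.eval, gs, Nat.testBit_eq_decide_div_mod_eq, decide_eq_true_eq]
        omega
      refine ((Triple.ite (f' := g i) (F := if x.testBit i = true then F i else id) (u := 0) ?_
        (fun h => ?_) (fun h => ?_)).seq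
        ((Triple.set (s' := s + 2) (f := g i) ?_ ?_ (.inl le_rfl)).seq
          (Triple.set (s' := s + 2) ?_ ?_ (.inl le_rfl)))).conseq
          le_rfl Env.rfl' le_rfl ?_ rfl (by simp)
      · simp [Expr.regsLT]
      · rw [if_pos (hbit.1 h)]
        exact hP i hi _
      · rw [if_neg (fun h' => hbit.2 h' h)]
        exact Triple.skip
      · simp [Expr.regsLT]
      · simp only [Expr.eval, gs]
        exact (Nat.div_le_self _ _).trans ((Nat.div_le_self _ _).trans hxV)
      · simp [Expr.regsLT]
      · simp only [Expr.eval]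
        rw [Function.update_of_ne (by omega), gs']
        omega
      · intro r hr
        simp only [Expr.eval, gs]
        by_cases h1 : r = s + 1
        · subst h1
          rw [Function.update_self, Function.update_of_ne (by omega), gs', gs']
        · rw [Function.update_of_ne h1]
          by_cases h2 : r = s
          · subst h2
            rw [Function.update_self, gs, Nat.div_div_eq_div_mul, pow_succ]
          · rw [Function.update_of_ne h2]
            simp [g, h1, h2])
  exact (h1.seq (h2.seq h3)).conseq le_rfl Env.rfl' (by omega) (hg t) rfl (by simp)

end Programs

/-- No condition reads a bit that is being flipped, so the successive flips amount to one
simultaneous addition. -/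
theorem opSeq_condFlip {N : ℕ} (base t : ℕ) (h : ℕ → Bits N → Bool)
    (hh : ∀ i < t, ∀ j < t, ∀ y, h i (flipAt (base + j) y) = h i y) :
    opSeq (fun i => pull fun y => if h i y = true then flipAt (base + i) y else y) t =
      pull fun y => xorFrom base (fun i => decide (i < t) && h i y) y := by
  induction t with
  | zero => simp only [opSeq, Nat.not_lt_zero, decide_false, Bool.false_and, xorFrom_zero]; rfl
  | succ t ih =>
    rw [opSeq, ih fun i hi j hj => hh i (by omega) j (by omega), pull_comp]
    congr 1
    funext y
    have h1 : ∀ i < t, h i (if h t y = true then flipAt (base + t) y else y) = h i y := by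
      intro i hi
      split_ifs
      · exact hh i (by omega) t (by omega) y
      · rfl
    funext j
    simp only [Function.comp, xorFrom]
    by_cases hj : base ≤ (j : ℕ)
    · simp only [hj, if_true]
      rcases lt_trichotomy ((j : ℕ) - base) t with hlt | heq | hgt
      · rw [h1 _ hlt]
        have h2 : (j : ℕ) ≠ base + t := by omega
        have h3 : (j : ℕ) - base < t + 1 := by omega
        simp only [hlt, h3, decide_true, Bool.true_and]
        congr 1
        split_ifs
        · simp [flipAt, h2]
        · rfl
      · have h2 : (j : ℕ) = base + t := by omega
        simp only [heq, lt_irrefl, decide_false, Bool.false_and, Bool.xor_false, Nat.lt_succ_self,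
          decide_true, Bool.true_and]
        split_ifs with hc
        · simp [flipAt, h2, hc]
        · simp [hc]
      · have h2 : (j : ℕ) ≠ base + t := by omega
        have h3 : ¬ (j : ℕ) - base < t + 1 := by omega
        have h4 : ¬ (j : ℕ) - base < t := by omega
        simp only [h3, h4, decide_false, Bool.false_and, Bool.xor_false]
        split_ifs
        · simp [flipAt, h2]
        · rfl
    · have h2 : (j : ℕ) ≠ base + t := by omega
      simp only [hj, if_false]
      split_ifs
      · simp [flipAt, h2]
      · rfl

/-- The registers describe the layout of the quantum memory: the `n` code qubits, one branch
qubit, `m` index qubits, `l` label qubits and the ancillas, from address `n + 1 + m + l` on. -/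
structure Layout (V N k n l m : ℕ) (f : ℕ → ℕ) : Prop where
  reg0 : f 0 = k
  reg1 : f 1 = n
  reg2 : f 2 = l
  reg3 : f 3 = m
  reg4 : f 4 = 2 ^ m
  reg5 : f 5 = n + 1 + m + l
  pos : 0 < k
  le_pow : k ≤ 2 ^ l
  le_n : l ≤ n
  room : 2 * (n + 1 + m + l) < N
  qubits_le : n + 1 + m + l ≤ V
  pow_le : 2 ^ m ≤ V
  k_le : k ≤ V

theorem Layout.update {V N k n l m : ℕ} {f : ℕ → ℕ} (h : Layout V N k n l m f) {r : ℕ}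
    (hr : 6 ≤ r) (v : ℕ) : Layout V N k n l m (Function.update f r v) := by
  have e : ∀ x < 6, Function.update f r v x = f x := fun x hx => Function.update_of_ne (by omega) _ _
  exact { h with
    reg0 := (e 0 (by omega)).trans h.reg0
    reg1 := (e 1 (by omega)).trans h.reg1
    reg2 := (e 2 (by omega)).trans h.reg2
    reg3 := (e 3 (by omega)).trans h.reg3
    reg4 := (e 4 (by omega)).trans h.reg4
    reg5 := (e 5 (by omega)).trans h.reg5 }

/-- The number held by the index qubits. -/
def indexVal {N : ℕ} (n m : ℕ) (y : Bits N) : ℕ := Nat.ofBits fun i : Fin m => getBit y (n + 1 + i)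

theorem indexVal_lt {N : ℕ} (n m : ℕ) (y : Bits N) : indexVal n m y < 2 ^ m :=
  Nat.ofBits_lt_two_pow _

theorem indexVal_eq_iff {N n m j : ℕ} (hj : j < 2 ^ m) (y : Bits N) :
    indexVal n m y = j ↔ ∀ i < m, getBit y (n + 1 + i) = j.testBit i := by
  constructor
  · rintro rfl i hi
    rw [indexVal, Nat.testBit_ofBits_lt _ _ hi]
  · intro h
    refine Nat.eq_of_testBit_eq fun i => ?_
    by_cases hi : i < m
    · rw [indexVal, Nat.testBit_ofBits_lt _ _ hi, h i hi]
    · rw [Nat.testBit_lt_two_pow (lt_of_lt_of_le (indexVal_lt n m y)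
        (Nat.pow_le_pow_right (by omega) (by omega))),
        Nat.testBit_lt_two_pow (lt_of_lt_of_le hj (Nat.pow_le_pow_right (by omega) (by omega)))]

/-- The bits that the oracle adds to the label qubits: the sample, if the branch qubit is `1`, and
otherwise the value of the index qubits modulo `k`. -/
def oracleBits {N : ℕ} (k n l m : ℕ) (y : Bits N) (i : ℕ) : Bool :=
  decide (i < l) && (if getBit y n then getBit y i else (indexVal n m y % k).testBit i)

/-! ### The circuits of the oracle and of the state preparation. -/

section Programs

variable {n w : ℕ} {U : Matrix (Bits n) (Bits n) ℂ} {ε : ℝ} {V : ℕ}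

/-- Add the bits of `v` to the index qubits. -/
def Prog.mask (s : ℕ) (v : Expr) : Prog :=
  .forBits s v (.reg 3) (.gateX (.add (.add (.reg 1) (.lit 1)) (.reg (s + 1))))

theorem Triple.mask {s k l m : ℕ} {v : Expr} {f : ℕ → ℕ} {x : ℕ}
    (hf : Layout V (n + w) k n l m f) (hs : 6 ≤ s)
    (hv : v.regsLT s) (hx : v.eval f = x) (hxV : x ≤ V) :
    Triple (n := n) (w := w) U ε V s (.mask s v) f s f
      (pull (xorFrom (n + 1) fun i => decide (i < m) && x.testBit i)) 0 := by
  have hm : m ≤ V := by have := hf.qubits_le; omega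
  refine (Triple.forBits hv (len := .reg 3) (show 3 < s by omega) hx hf.reg3 hxV hm
    (F := fun i => pull (flipAt (n + 1 + i))) ?_).op_congr ?_
  · intro i hi y
    refine (Triple.gateX ?_).op_congr ?_
    · simp only [Expr.regsLT, and_true]; omega
    · have hf' := (hf.update hs y).update (show 6 ≤ s + 1 by omega) i
      rw [atAddr_opX]
      simp only [Expr.eval, hf'.reg1, Function.update_self]
  · rw [← opSeq_condFlip (n + 1) m (fun i _ => x.testBit i) fun _ _ _ _ _ => rfl]
    refine opSeq_congr fun i _ => ?_
    split_ifs <;> rfl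

/-- Add the bits of `v` to the label qubits, if the chain over the branch qubit and the index
qubits has found zeros only. -/
def Prog.addLabel (s : ℕ) (v : Expr) : Prog :=
  .forBits s v (.reg 2) (.gateCX (.add (.reg 5) (.add (.reg 3) (.lit 1)))
    (.add (.add (.reg 1) (.add (.reg 3) (.lit 1))) (.reg (s + 1))))

theorem Triple.addLabel {s k l m : ℕ} {v : Expr} {f : ℕ → ℕ} {x : ℕ}
    (hf : Layout V (n + w) k n l m f) (hs : 6 ≤ s)
    (hv : v.regsLT s) (hx : v.eval f = x) (hxV : x ≤ V) :
    Triple (n := n) (w := w) U ε V s (.addLabel s v) f s f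
      (pull fun y => xorFrom (n + 1 + m) (fun i => decide (i < l) &&
        (x.testBit i && getBit y (n + 1 + m + l + (m + 1)))) y) 0 := by
  have hm : l ≤ V := by have := hf.qubits_le; omega
  refine (Triple.forBits hv (len := .reg 2) (show 2 < s by omega) hx hf.reg2 hxV hm
    (F := fun i => pull fun y => if getBit y (n + 1 + m + l + (m + 1)) = true then
      flipAt (n + 1 + m + i) y else y) ?_).op_congr ?_
  · intro i hi y
    refine (Triple.gateCX ?_ ?_).op_congr ?_
    · simp only [Expr.regsLT, and_true]; omega
    · simp only [Expr.regsLT, and_true]; omega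
    · have hf' := (hf.update hs y).update (show 6 ≤ s + 1 by omega) i
      rw [atAddr_opCX]
      simp only [Expr.eval, hf'.reg1, hf'.reg3, hf'.reg5, Function.update_self]
      congr 1
      funext y
      have h1 : n + 1 + m + l + (m + 1) ≠ n + 1 + m + i := by omega
      rw [show n + (m + 1) + i = n + 1 + m + i by omega]
      simp only [ccx, ne_eq, h1, not_false_eq_true, true_and, and_self]
  · rw [← opSeq_condFlip (n + 1 + m) l (fun i y => x.testBit i &&
      getBit y (n + 1 + m + l + (m + 1))) fun i hi j hj y => by
        rw [getBit_flipAt_ne (by omega)]]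
    refine opSeq_congr fun i _ => ?_
    cases x.testBit i
    · simp [← pull_id]; rfl
    · simp

/-- Add the sample to the label qubits, if the branch qubit is `1`. -/
def Prog.copySample (s : ℕ) : Prog :=
  .forUp s (.reg 2) (.gateCCX (.reg 1) (.reg s)
    (.add (.add (.reg 1) (.add (.reg 3) (.lit 1))) (.reg s)))

theorem Triple.copySample {s k l m : ℕ} {f : ℕ → ℕ}
    (hf : Layout V (n + w) k n l m f) (hs : 6 ≤ s) :
    Triple (n := n) (w := w) U ε V s (.copySample s) f s f
      (pull fun y => xorFrom (n + 1 + m) (fun i => decide (i < l) &&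
        (getBit y n && getBit y i)) y) 0 := by
  have hl : l ≤ V := by have := hf.qubits_le; omega
  have hln := hf.le_n
  refine (Triple.forUp (u := 0) (e := .reg 2) (show 2 < s by omega) hf.reg2 hl
    (F := fun i => pull fun y => if (getBit y n && getBit y i) = true then
      flipAt (n + 1 + m + i) y else y) ?_).conseq le_rfl Env.rfl' le_rfl Env.rfl' ?_ (by simp)
  · intro i hi
    refine (Triple.gateCCX ?_ ?_ ?_).op_congr ?_
    · simp only [Expr.regsLT]; omega
    · simp only [Expr.regsLT]; omega
    · simp only [Expr.regsLT, and_true]; omega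
    · have hf' := hf.update hs i
      rw [atAddr_opCCX]
      simp only [Expr.eval, hf'.reg1, hf'.reg3, Function.update_self]
      congr 1
      funext y
      have h1 : n ≠ n + 1 + m + i := by omega
      have h2 : i ≠ n + 1 + m + i := by omega
      rw [show n + (m + 1) + i = n + 1 + m + i by omega]
      simp only [ccx, ne_eq, h1, h2, not_false_eq_true, true_and, Bool.and_eq_true]
  · refine opSeq_condFlip (n + 1 + m) l (fun i y => getBit y n && getBit y i)
      fun i hi j hj y => ?_
    rw [getBit_flipAt_ne (by omega), getBit_flipAt_ne (by omega)]

theorem xorOp_copySample {N k l m : ℕ} {f : ℕ → ℕ} (hf : Layout V N k n l m f) :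
    XorOp (N := N) (n + 1 + m) l (pull fun y => xorFrom (n + 1 + m) (fun i => decide (i < l) &&
        (getBit y n && getBit y i)) y) fun y i => decide (i < l) && (getBit y n && getBit y i) := by
  have hln := hf.le_n
  refine ⟨_, rfl, fun y i hi => by simp [hi], fun y d hd => ?_, fun y _ => rfl⟩
  funext i
  rw [getBit_xorFrom_of hd (by omega)]
  by_cases hi : i < l
  · rw [getBit_xorFrom_of hd (by omega)]
  · simp [hi]

/-- If the branch qubit is `0` and the index qubits hold the value of register `s`, then add this
value modulo `k` to the label qubits. -/
def Prog.lookupStep (s : ℕ) : Prog :=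
  .seq (.mask (s + 1) (.reg s)) (.seq (.compute (s + 1) (.reg 1) (.add (.reg 3) (.lit 1)))
    (.seq (.addLabel (s + 1) (.sub (.reg s) (.mul (.reg 0) (.div (.reg s) (.reg 0)))))
      (.seq (.uncompute (s + 1) (.reg 1) (.add (.reg 3) (.lit 1))) (.mask (s + 1) (.reg s)))))

/-- The operation of `Prog.lookupStep`. -/
def lookupOp {N : ℕ} (k n l m j : ℕ) : QState N → QState N :=
  let mask : Bits N → Bits N := xorFrom (n + 1) fun i => decide (i < m) && j.testBit i
  pull fun y => xorFrom (n + 1 + m) (fun i => decide (i < l) && ((j % k).testBit i &&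
    getBit (fwd (n + 1 + m + l) n (m + 1) (mask y)) (n + 1 + m + l + (m + 1)))) y

/-- The mask turns "index = `j`" into "masked index = 0", which the chain tests together with
"branch = 0", since the branch qubit directly precedes the index qubits. The label addition commutes
with the chain and the mask, so these cancel in pairs and only the addition remains. -/
theorem Triple.lookupStep {s k l m j : ℕ} {f : ℕ → ℕ}
    (hf : Layout V (n + w) k n l m f) (hs : 6 ≤ s) (hj : f s = j) (hjV : j ≤ V) :
    Triple (n := n) (w := w) U ε V (s + 1) (.lookupStep s) f (s + 1) f (lookupOp k n l m j) 0 := by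
  have hroom := hf.room
  have hq := hf.qubits_le
  have hn : Expr.regsLT (s + 1) (.reg 1) := by simp only [Expr.regsLT]; omega
  have hL : Expr.regsLT (s + 1) (.add (.reg 3) (.lit 1)) := by simp only [Expr.regsLT, and_true]; omega
  have hLe : (Expr.add (.reg 3) (.lit 1)).eval f = m + 1 := by simp only [Expr.eval, hf.reg3]
  have hmod : (Expr.sub (.reg s) (.mul (.reg 0) (.div (.reg s) (.reg 0)))).eval f = j % k := by
    simp only [Expr.eval, hf.reg0, hj]
    have := Nat.div_add_mod j k
    omega
  have h1 := Triple.mask (U := U) (ε := ε) hf (show 6 ≤ s + 1 by omega) (v := .reg s)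
    (by simp [Expr.regsLT]) hj hjV
  have h2 := Triple.compute (U := U) (ε := ε) (w := w) (V := V) (show 5 < s + 1 by omega) hn hL
    hf.reg1 hLe hf.reg5 (by omega) (by omega) (by omega)
  have h3 := Triple.addLabel (U := U) (ε := ε) hf (show 6 ≤ s + 1 by omega)
    (v := .sub (.reg s) (.mul (.reg 0) (.div (.reg s) (.reg 0))))
    (by simp only [Expr.regsLT]; omega) hmod ((Nat.mod_le _ _).trans hjV)
  have h4 := Triple.uncompute (U := U) (ε := ε) (w := w) (V := V) (show 5 < s + 1 by omega) hn hL
    hf.reg1 hLe hf.reg5 (by omega) (by omega) (by omega)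
  refine (h1.seq (h2.seq (h3.seq (h4.seq h1)))).op_congr ?_
  simp only [pull_comp]
  unfold lookupOp
  congr 1
  funext y
  simp only [Function.comp]
  rw [← xorFrom_bwd (l := l) (fun i hi => by simp [hi]) (by omega) le_rfl, bwd_fwd (by omega),
    xorFrom_comm, xorFrom_self]

/-- The last ancilla of the chain carries the conjunction only if the ancillas start clean; this is
the reason for the proviso on the later bits in `XorOp`. -/
theorem xorOp_lookup {N k l m j : ℕ} {f : ℕ → ℕ} (hf : Layout V N k n l m f) (hj : j < 2 ^ m) :
    XorOp (N := N) (n + 1 + m) l (lookupOp k n l m j) fun y i => decide (i < l) &&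
      (!getBit y n && (decide (indexVal n m y = j) && (j % k).testBit i)) := by
  have hroom := hf.room
  refine ⟨_, rfl, fun y i hi => by simp [hi], fun y d hd => ?_, fun y hy => ?_⟩
  · funext i
    rw [xorFrom_comm, ← xorFrom_fwd hd (by omega) le_rfl, getBit_xorFrom_of hd (by omega)]
  · have hy' : AncZero (n + 1 + m + l) (xorFrom (n + 1)
        (fun i => decide (i < m) && j.testBit i) y) := fun a ha => by
      rw [getBit_xorFrom_of (l := m) (fun i hi => by simp [hi]) (by omega)]
      exact hy a ha
    have key := getBit_fwd (lo := n) (t := m + 1) (by omega) (by omega) hy'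
    have key2 : (∀ i < m + 1, getBit (xorFrom (n + 1)
        (fun i => decide (i < m) && j.testBit i) y) (n + i) = false) ↔
        (getBit y n = false ∧ indexVal n m y = j) := by
      rw [indexVal_eq_iff hj]
      constructor
      · intro h
        constructor
        · have h0 := h 0 (by omega)
          rwa [getBit_xorFrom_of (l := m) (fun i hi => by simp [hi]) (by omega)] at h0
        · intro i hi
          have h0 := h (i + 1) (by omega)
          rw [show n + (i + 1) = n + 1 + i by omega, getBit_xorFrom_ge _ _ _ (by omega) (by omega),
            show n + 1 + i - (n + 1) = i by omega] at h0
          simpa [hi] using h0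
      · rintro ⟨h0, h1⟩ i hi
        rcases i with _ | i
        · rwa [getBit_xorFrom_of (l := m) (fun i hi => by simp [hi]) (by omega)]
        · rw [show n + (i + 1) = n + 1 + i by omega, getBit_xorFrom_ge _ _ _ (by omega) (by omega),
            show n + 1 + i - (n + 1) = i by omega, h1 i (by omega)]
          have : i < m := by omega
          simp [this]
    rw [key2] at key
    have key3 : getBit (fwd (n + 1 + m + l) n (m + 1) (xorFrom (n + 1)
        (fun i => decide (i < m) && j.testBit i) y)) (n + 1 + m + l + (m + 1)) =
        (!getBit y n && decide (indexVal n m y = j)) := by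
      rw [Bool.eq_iff_iff, key]; simp
    funext i
    simp only [key3]
    cases (j % k).testBit i <;> simp

/-- If the branch qubit is `0`, then add the value of the index qubits modulo `k` to the label
qubits. -/
def Prog.lookup (s : ℕ) : Prog := .forUp s (.reg 4) (.lookupStep s)

theorem Triple.lookup {s k l m : ℕ} {f : ℕ → ℕ}
    (hf : Layout V (n + w) k n l m f) (hs : 6 ≤ s) :
    Triple (n := n) (w := w) U ε V s (.lookup s) f s f
      (opSeq (fun j => lookupOp k n l m j) (2 ^ m)) 0 := by
  have hV := hf.pow_le
  refine (Triple.forUp (u := 0) (e := .reg 4) (show 4 < s by omega) hf.reg4 hf.pow_le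
    (fun j hj => ?_)).conseq le_rfl Env.rfl' le_rfl Env.rfl' rfl (by simp)
  exact Triple.lookupStep (hf.update hs j) hs (by simp) (by omega)

/-- The index equals at most one of the tried values, so at most one addition takes effect. A table
of `2 ^ m` entries replaces reversible division and is affordable because `2 ^ m` is polynomially
bounded. -/
theorem xorOp_opSeq_lookup {N k l m t : ℕ} {f : ℕ → ℕ} (hf : Layout V N k n l m f)
    (ht : t ≤ 2 ^ m) :
    XorOp (N := N) (n + 1 + m) l (opSeq (fun j => lookupOp k n l m j) t) fun y i =>
      decide (i < l) && (!getBit y n && (decide (indexVal n m y < t) &&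
        (indexVal n m y % k).testBit i)) := by
  induction t with
  | zero => simpa [opSeq] using XorOp.id (N := N) (n + 1 + m) l
  | succ t ih =>
    have h := (ih (by omega)).comp (xorOp_lookup (N := N) (j := t) hf (by omega))
    rw [opSeq]
    convert h using 3 with y i
    rcases lt_trichotomy (indexVal n m y) t with hlt | heq | hgt
    · have h1 : indexVal n m y < t + 1 := by omega
      have h2 : indexVal n m y ≠ t := by omega
      simp [hlt, h1, h2]
    · simp [heq]
    · have h1 : ¬ indexVal n m y < t + 1 := by omega
      have h2 : indexVal n m y ≠ t := by omega
      have h3 : ¬ indexVal n m y < t := by omega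
      simp [h1, h2, h3]

/-- The oracle. -/
def Prog.oracle (s : ℕ) : Prog := .seq (.copySample s) (.lookup s)

/-- `F` is chosen before `s` and `g`: all calls of the oracle must denote one operator, so that
repeated state preparations cancel. -/
theorem Triple.oracle {k l m : ℕ} {f : ℕ → ℕ} (hf : Layout V (n + w) k n l m f) :
    ∃ F : QState (n + w) → QState (n + w), XorOp (n + 1 + m) l F (oracleBits k n l m) ∧
      ∀ (s : ℕ) (g : ℕ → ℕ), 6 ≤ s → Layout V (n + w) k n l m g →
        Triple U ε V s (.oracle s) g s g F 0 := by
  refine ⟨_, ?_, fun s g hs hg => (Triple.copySample hg hs).seq (Triple.lookup hg hs)⟩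
  convert (xorOp_copySample hf).comp (xorOp_opSeq_lookup hf le_rfl) using 3 with y i
  simp only [oracleBits, indexVal_lt, decide_true, Bool.true_and]
  cases getBit y n <;> simp

/-- Hadamard gates on the branch qubit and on the index qubits. -/
def Prog.hadamards (s : ℕ) : Prog :=
  .forUp s (.add (.reg 3) (.lit 1)) (.gateH (.add (.reg 1) (.reg s)))

/-- Hadamard gates on the `t` qubits from address `a` on. -/
noncomputable def hadamardsOp {N : ℕ} (a t : ℕ) : QState N → QState N :=
  opSeq (fun i => atAddr (a + i) opH) t

theorem Triple.hadamards {s k l m : ℕ} {f : ℕ → ℕ}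
    (hf : Layout V (n + w) k n l m f) (hs : 6 ≤ s) :
    Triple (n := n) (w := w) U ε V s (.hadamards s) f s f (hadamardsOp n (m + 1)) 0 := by
  have hq := hf.qubits_le
  refine (Triple.forUp (u := 0) (N := m + 1) (e := .add (.reg 3) (.lit 1))
    (by simp only [Expr.regsLT, and_true]; omega) (by simp only [Expr.eval, hf.reg3]) (by omega)
    (fun j hj => ?_)).conseq le_rfl Env.rfl' le_rfl Env.rfl' rfl (by simp)
  refine (Triple.gateH (by simp only [Expr.regsLT]; omega)).op_congr ?_
  simp only [Expr.eval, (hf.update hs j).reg1, Function.update_self]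

/-- The state preparation. -/
def Prog.prepare (s : ℕ) : Prog :=
  .seq (.hadamards s) (.seq .code (.seq (.gateZ (.reg 1)) (.seq (.oracle s)
    (.seq .codeInv (.hadamards s)))))

/-- The operation of the state preparation, with the operation `F` of the oracle. -/
noncomputable def prepareOp (U : Matrix (Bits n) (Bits n) ℂ) (m : ℕ)
    (F : QState (n + w) → QState (n + w)) : QState (n + w) → QState (n + w) :=
  hadamardsOp n (m + 1) ∘ opCode U.conjTranspose ∘ F ∘ zOp n ∘ opCode U ∘ hadamardsOp n (m + 1)

theorem Triple.prepare {s k l m : ℕ} {f : ℕ → ℕ} {F : QState (n + w) → QState (n + w)}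
    (hf : Layout V (n + w) k n l m f) (hs : 6 ≤ s)
    (hF : Triple U ε V s (.oracle s) f s f F 0) :
    Triple U ε V s (.prepare s) f s f (prepareOp U m F) 2 := by
  have hH := Triple.hadamards (U := U) (ε := ε) hf hs
  have hZ := Triple.gateZ (w := w) (U := U) (ε := ε) (V := V) (f := f) (q := .reg 1)
    (show 1 < s by omega)
  simp only [Expr.eval, hf.reg1] at hZ
  exact hH.seq (Triple.code.seq (hZ.seq (hF.seq (Triple.codeInv.seq hH))))

end Programs

/-! ## The state preparation as an operator -/

section Operator

variable {N : ℕ}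

theorem atAddr_of_lt {a : ℕ} (h : a < N) (f : Fin N → QState N → QState N) :
    atAddr a f = f ⟨a, h⟩ := funext fun _ => dif_pos h

theorem atAddr_of_ge {a : ℕ} (h : ¬ a < N) (f : Fin N → QState N → QState N) :
    atAddr a f = id := funext fun _ => dif_neg h

theorem atAddr_comp_self (a : ℕ) : atAddr a (opH (N := N)) ∘ atAddr a opH = id := by
  by_cases h : a < N
  · rw [atAddr_of_lt h]; exact opH_comp_self ⟨a, h⟩
  · rw [atAddr_of_ge h]; rfl

theorem atAddr_opH_comm (a b : ℕ) :
    atAddr a (opH (N := N)) ∘ atAddr b opH = atAddr b opH ∘ atAddr a opH := by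
  by_cases ha : a < N
  · by_cases hb : b < N
    · rw [atAddr_of_lt ha, atAddr_of_lt hb]; exact opH_comm ⟨a, ha⟩ ⟨b, hb⟩
    · rw [atAddr_of_ge hb]; rfl
  · rw [atAddr_of_ge ha]; rfl

theorem adj_atAddr_opH (a : ℕ) : Adj (atAddr a (opH (N := N))) (atAddr a opH) := by
  by_cases h : a < N
  · rw [atAddr_of_lt h]; exact Adj.opH ⟨a, h⟩
  · rw [atAddr_of_ge h]; exact fun _ _ => rfl

theorem hadamardsOp_comm (a t b : ℕ) :
    hadamardsOp (N := N) a t ∘ atAddr b opH = atAddr b opH ∘ hadamardsOp a t := by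
  induction t with
  | zero => rfl
  | succ t ih =>
    change (atAddr (a + t) opH ∘ hadamardsOp a t) ∘ atAddr b opH =
      atAddr b opH ∘ (atAddr (a + t) opH ∘ hadamardsOp a t)
    rw [Function.comp_assoc, ih, ← Function.comp_assoc, atAddr_opH_comm, Function.comp_assoc]

theorem hadamardsOp_comp_self (a t : ℕ) : hadamardsOp (N := N) a t ∘ hadamardsOp a t = id := by
  induction t with
  | zero => rfl
  | succ t ih =>
    change (atAddr (a + t) opH ∘ hadamardsOp a t) ∘ (atAddr (a + t) opH ∘ hadamardsOp a t) = id
    nth_rewrite 2 [← hadamardsOp_comm]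
    rw [Function.comp_assoc, ← Function.comp_assoc (hadamardsOp a t), ih, Function.id_comp,
      atAddr_comp_self]

theorem adj_hadamardsOp (a t : ℕ) : Adj (hadamardsOp (N := N) a t) (hadamardsOp a t) := by
  induction t with
  | zero => exact fun _ _ => rfl
  | succ t ih =>
    have h := (adj_atAddr_opH (N := N) (a + t)).comp ih
    rw [hadamardsOp_comm] at h
    exact h

/-- Set the `t` bits from address `a` on to `0`. -/
def clear (a t : ℕ) (x : Bits N) : Bits N := fun j => if a ≤ (j : ℕ) ∧ (j : ℕ) < a + t then false else x j

theorem hadamardsOp_apply {a t : ℕ} (hN : a + t ≤ N) {ψ : QState N}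
    (hψ : ∀ x i, i < t → getBit x (a + i) = true → ψ x = 0) (x : Bits N) :
    hadamardsOp a t ψ x = (1 / (√2 : ℂ)) ^ t * ψ (clear a t x) := by
  induction t generalizing x with
  | zero =>
    have : clear a 0 x = x := funext fun j => if_neg (by omega)
    simp [hadamardsOp, opSeq, this]
  | succ t ih =>
    have ih' := ih (by omega) (fun x i hi => hψ x i (by omega))
    have h : hadamardsOp a (t + 1) ψ = opH ⟨a + t, by omega⟩ (hadamardsOp a t ψ) := by
      change atAddr (a + t) opH (hadamardsOp a t ψ) = _
      rw [atAddr, dif_pos (by omega)]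
    rw [h, opH_apply_of_support, ih', pow_succ', mul_assoc]
    · congr 3
      funext j
      by_cases hj : (j : ℕ) = a + t
      · have h1 : j = ⟨a + t, by omega⟩ := Fin.ext hj
        simp [clear, h1]
      · have h1 : j ≠ ⟨a + t, by omega⟩ := fun e => hj (by rw [e])
        have h2 : (a ≤ (j : ℕ) ∧ (j : ℕ) < a + t) ↔ (a ≤ (j : ℕ) ∧ (j : ℕ) < a + (t + 1)) := by
          omega
        simp [clear, h1, h2]
    · intro y hy
      rw [ih', hψ _ t (by omega), mul_zero]
      rw [getBit_of_lt _ (by omega)]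
      simp [clear, hy]

/-- The state vanishes unless all bits from `p` on are `0`. -/
def Supported (p : ℕ) (ψ : QState N) : Prop := ∀ x, ¬ AncZero p x → ψ x = 0

theorem Supported.pull {p : ℕ} {g : Bits N → Bits N} (hg : ∀ x, AncZero p (g x) → AncZero p x)
    {ψ : QState N} (h : Supported p ψ) : Supported p (pull g ψ) := fun x hx =>
  h _ fun h' => hx (hg x h')

theorem Supported.zOp {p : ℕ} (a : ℕ) {ψ : QState N} (h : Supported p ψ) :
    Supported p (zOp a ψ) := fun x hx => by
  simp [QTest.zOp, h x hx]

theorem Supported.add {p : ℕ} {ψ φ : QState N} (h : Supported p ψ) (h' : Supported p φ) :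
    Supported p (ψ + φ) := fun x hx => by simp [h x hx, h' x hx]

theorem Supported.smul {p : ℕ} (a : ℂ) {ψ : QState N} (h : Supported p ψ) :
    Supported p (a • ψ) := fun x hx => by simp [h x hx]

theorem Supported.hadamardsOp {p a t : ℕ} (hp : a + t ≤ p) {ψ : QState N} (h : Supported p ψ) :
    Supported p (hadamardsOp a t ψ) := by
  induction t with
  | zero => exact h
  | succ t ih =>
    have ih' := ih (by omega)
    intro x hx
    change atAddr (a + t) opH (QTest.hadamardsOp a t ψ) x = 0
    unfold atAddr
    split_ifs with ha
    · have h1 : ¬ AncZero p (flip ⟨a + t, ha⟩ x) := fun h1 => hx fun j hj => by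
        rw [← h1 j hj, flip_eq_flipAt, getBit_flipAt_ne (by simp only; omega)]
      simp [opH, ih' _ hx, ih' _ h1]
    · exact ih' x hx

theorem XorOp.supported {base l : ℕ} {F : QState N → QState N} {G : Bits N → ℕ → Bool}
    (h : XorOp base l F G) {ψ : QState N} (hψ : Supported (base + l) ψ) :
    Supported (base + l) (F ψ) := by
  obtain ⟨g, rfl, h1, h2, h3⟩ := h
  refine hψ.pull fun x hx j hj => ?_
  rw [← hx j hj, getBit_xorFrom_of (h1 x) (.inr hj)]

theorem XorOp.zOp_comm {base l a : ℕ} (ha : a < base) {F : QState N → QState N}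
    {G : Bits N → ℕ → Bool} (h : XorOp base l F G) : F ∘ zOp a = zOp a ∘ F := by
  obtain ⟨g, rfl, h1, -, -⟩ := h
  funext ψ x
  simp only [Function.comp, QTest.pull, QTest.zOp, getBit_xorFrom_of (h1 x) (.inl ha)]

theorem zOp_comp_self (a : ℕ) : zOp (N := N) a ∘ zOp a = id := by
  funext ψ x
  simp only [Function.comp, zOp, id]
  split_ifs <;> simp

/-- The projection onto the states in which the first `t` qubits are `0`. -/
def zeroProj (t : ℕ) (ψ : QState N) : QState N :=
  fun x => if ∀ i < t, getBit x i = false then ψ x else 0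

/-- With clean ancillas the last bit of the chain indicates the range of the projection Π, so the
conditional sign is the reflection 1 − 2Π. -/
theorem zeroPhaseOp_eq {p t : ℕ} (hp : t ≤ p) (hN : p + t < N) {ψ : QState N}
    (hψ : Supported p ψ) : zeroPhaseOp p t ψ = ψ + (-2 : ℂ) • zeroProj t ψ := by
  funext x
  by_cases hx : AncZero p x
  · have h := getBit_fwd (lo := 0) (by omega) hN hx
    simp only [zero_add] at h
    simp only [zeroPhaseOp, h, Pi.add_apply, Pi.smul_apply, zeroProj, smul_eq_mul]
    split_ifs <;> ring
  · simp [zeroPhaseOp, zeroProj, hψ x hx]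

theorem eq_zeroBits_iff {p : ℕ} {x : Bits N} (hx : AncZero p x) :
    (∀ i < p, getBit x i = false) ↔ x = zeroBits N := by
  constructor
  · intro h
    refine bits_ext fun a ha => ?_
    rw [getBit_of_lt (zeroBits N) ha, zeroBits]
    by_cases hap : a < p
    · exact h a hap
    · exact hx a (by omega)
  · rintro rfl i -
    by_cases hi : i < N
    · rw [getBit_of_lt _ hi]; rfl
    · exact getBit_of_ge _ (by omega)

/-- On states with clean ancillas, the zero label is the only one left when the first `p` bits
vanish, so the projection has rank one there. -/
theorem zeroProj_full {p : ℕ} {ψ : QState N} (hψ : Supported p ψ) :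
    zeroProj p ψ = ψ (zeroBits N) • Pi.single (zeroBits N) 1 := by
  funext x
  by_cases hx : AncZero p x
  · simp only [zeroProj, eq_zeroBits_iff hx, Pi.smul_apply, smul_eq_mul]
    by_cases h : x = zeroBits N
    · subst h; simp
    · simp [h]
  · have : x ≠ zeroBits N := by
      rintro rfl
      refine hx fun j hj => ?_
      by_cases hi : j < N
      · rw [getBit_of_lt _ hi]; rfl
      · exact getBit_of_ge _ (by omega)
    simp [zeroProj, hψ x hx, this]

theorem supported_single {p : ℕ} {x : Bits N} (hx : AncZero p x) :
    Supported p (Pi.single x (1 : ℂ)) := fun y hy => by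
  have : y ≠ x := fun e => hy (e ▸ hx)
  simp [this]

theorem Supported.zeroProj {p t : ℕ} {ψ : QState N} (h : Supported p ψ) :
    Supported p (zeroProj t ψ) := fun x hx => by simp [QTest.zeroProj, h x hx]

theorem ancZero_zeroBits (p : ℕ) : AncZero p (zeroBits N) := fun j _ => by
  by_cases hi : j < N
  · rw [getBit_of_lt _ hi]; rfl
  · exact getBit_of_ge _ (by omega)

end Operator

/-! ### Symmetry of the state preparation, and coordinates for labels with clean ancillas. -/

section Prepare

variable {n w k l m : ℕ} {U : Matrix (Bits n) (Bits n) ℂ} {F : QState (n + w) → QState (n + w)}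

theorem Supported.opCode {p : ℕ} (hp : n ≤ p) {ψ : QState (n + w)} (h : Supported p ψ) :
    Supported p (opCode U ψ) := fun x hx => by
  refine Finset.sum_eq_zero fun y _ => ?_
  rw [h, mul_zero]
  refine fun h' => hx fun j hj => ?_
  by_cases hj' : j < n + w
  · have h1 := h' j hj
    rw [getBit_of_lt _ hj'] at h1 ⊢
    obtain ⟨i, hi⟩ : ∃ i : Fin w, (⟨j, hj'⟩ : Fin (n + w)) = Fin.natAdd n i :=
      ⟨⟨j - n, by omega⟩, Fin.ext (by simp; omega)⟩
    rw [hi, Fin.append_right] at h1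
    rw [hi, h1]
  · exact getBit_of_ge _ (by omega)

/-- The product H U† (F Z) U H is a palindrome up to adjoints. Its middle is self-adjoint because
the phase is diagonal in a qubit that the oracle does not write, so F and Z commute. -/
theorem adj_prepareOp {G : Bits (n + w) → ℕ → Bool} (hF : XorOp (n + 1 + m) l F G) :
    Adj (prepareOp U m F) (prepareOp U m F) := by
  have hH := adj_hadamardsOp (N := n + w) n (m + 1)
  have hU := Adj.opCode (w := w) U
  have hU' := Adj.opCode (w := w) U.conjTranspose
  rw [Matrix.conjTranspose_conjTranspose] at hU'
  have hFZ := hF.adj.1.comp (Adj.zOp n)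
  rw [← hF.zOp_comm (by omega)] at hFZ
  have h := hH.comp (hU'.comp (hFZ.comp (hU.comp hH)))
  simpa only [prepareOp, Function.comp_assoc] using h

/-- The outer factors cancel in pairs, and (F Z)² = 1 because F and Z are commuting involutions. -/
theorem prepareOp_comp_self (hU : U ∈ Matrix.unitaryGroup (Bits n) ℂ)
    {G : Bits (n + w) → ℕ → Bool} (hF : XorOp (n + 1 + m) l F G) :
    prepareOp U m F ∘ prepareOp U m F = id := by
  have h1 := hadamardsOp_comp_self (N := n + w) n (m + 1)
  have h2 := opCode_comp_inv (w := w) hU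
  have h3 := opCode_inv_comp (w := w) hU
  have h4 : (F ∘ zOp n) ∘ (F ∘ zOp n) = id := by
    nth_rewrite 1 [hF.zOp_comm (by omega)]
    rw [Function.comp_assoc, ← Function.comp_assoc F, hF.adj.2, Function.id_comp, zOp_comp_self]
  funext ψ
  have e1 := fun φ => congrFun h1 φ
  have e2 := fun φ => congrFun h2 φ
  have e3 := fun φ => congrFun h3 φ
  have e4 := fun φ => congrFun h4 φ
  simp only [Function.comp, id] at e1 e2 e3 e4
  simp only [prepareOp, Function.comp, id, e1, e2, e4, e3]

theorem Supported.prepareOp {G : Bits (n + w) → ℕ → Bool} (hF : XorOp (n + 1 + m) l F G)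
    {ψ : QState (n + w)} (h : Supported (n + 1 + m + l) ψ) :
    Supported (n + 1 + m + l) (prepareOp U m F ψ) :=
  Supported.hadamardsOp (by omega) (Supported.opCode (by omega) (hF.supported
    ((Supported.opCode (by omega) (h.hadamardsOp (by omega))).zOp n)))

/-- The basis state with code qubits `c`, branch and index qubits `A` and label qubits `z`. -/
def label (w : ℕ) (c : Bits n) (A : Bits (m + 1)) (z : Bits l) : Bits (n + w) := fun j =>
  if h : (j : ℕ) < n then c ⟨j, h⟩
  else if h : (j : ℕ) < n + (m + 1) then A ⟨j - n, by omega⟩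
  else if h : (j : ℕ) < n + 1 + m + l then z ⟨j - (n + 1 + m), by omega⟩
  else false

theorem getBit_label_code (c : Bits n) (A : Bits (m + 1)) (z : Bits l) (i : Fin n) :
    getBit (label w c A z) i = c i := by
  rw [getBit_of_lt _ (by omega)]
  simp [label]

theorem getBit_label_index (hN : n + 1 + m + l ≤ n + w) (c : Bits n) (A : Bits (m + 1))
    (z : Bits l) (i : Fin (m + 1)) : getBit (label w c A z) (n + i) = A i := by
  have h : ¬ m < (i : ℕ) := by omega
  rw [getBit_of_lt _ (by omega)]
  simp [label, h]

theorem getBit_label_label (hN : n + 1 + m + l ≤ n + w) (c : Bits n) (A : Bits (m + 1))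
    (z : Bits l) (i : Fin l) : getBit (label w c A z) (n + 1 + m + i) = z i := by
  have h1 : ¬ n + 1 + m + i < n := by omega
  have h2 : ¬ n + 1 + m + i < n + (m + 1) := by omega
  rw [getBit_of_lt _ (by omega)]
  simp [label, h1, h2]

theorem ancZero_label (c : Bits n) (A : Bits (m + 1)) (z : Bits l) :
    AncZero (n + 1 + m + l) (label w c A z) := by
  intro j hj
  by_cases hj' : j < n + w
  · rw [getBit_of_lt _ hj', label, dif_neg (by simp only; omega), dif_neg (by simp only; omega),
      dif_neg (by simp only; omega)]
  · exact getBit_of_ge _ (by omega)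

theorem label_injective (hN : n + 1 + m + l ≤ n + w) {c c' : Bits n} {A A' : Bits (m + 1)}
    {z z' : Bits l} (h : label w c A z = label w c' A' z') : c = c' ∧ A = A' ∧ z = z' := by
  refine ⟨funext fun i => ?_, funext fun i => ?_, funext fun i => ?_⟩
  · rw [← getBit_label_code (w := w) c A z i, h, getBit_label_code]
  · rw [← getBit_label_index hN c A z i, h, getBit_label_index hN]
  · rw [← getBit_label_label hN c A z i, h, getBit_label_label hN]

/-- Every label whose ancillas are `0` is of the form `label w c A z`. -/
theorem exists_label (hN : n + 1 + m + l ≤ n + w) {y : Bits (n + w)}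
    (hy : AncZero (n + 1 + m + l) y) :
    y = label w (fun i : Fin n => getBit y i) (fun i : Fin (m + 1) => getBit y (n + i))
      (fun i : Fin l => getBit y (n + 1 + m + i)) := by
  refine bits_ext fun a ha => ?_
  by_cases h1 : a < n
  · exact (getBit_label_code (fun i : Fin n => getBit y i)
      (fun i : Fin (m + 1) => getBit y (n + i)) (fun i : Fin l => getBit y (n + 1 + m + i))
      ⟨a, h1⟩).symm
  by_cases h2 : a < n + (m + 1)
  · have h := getBit_label_index hN (fun i : Fin n => getBit y i)
      (fun i : Fin (m + 1) => getBit y (n + i)) (fun i : Fin l => getBit y (n + 1 + m + i))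
      ⟨a - n, by omega⟩
    rw [show n + (⟨a - n, by omega⟩ : Fin (m + 1)).val = a by simp only; omega] at h
    exact h.symm
  by_cases h3 : a < n + 1 + m + l
  · have h := getBit_label_label hN (fun i : Fin n => getBit y i)
      (fun i : Fin (m + 1) => getBit y (n + i)) (fun i : Fin l => getBit y (n + 1 + m + i))
      ⟨a - (n + 1 + m), by omega⟩
    rw [show n + 1 + m + (⟨a - (n + 1 + m), by omega⟩ : Fin l).val = a by simp only; omega] at h
    exact h.symm
  · rw [hy a (by omega), ancZero_label _ _ _ a (by omega)]

end Prepare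

/-! ## The amplitudes of the prepared state -/

theorem sum_bits_succ {M : Type*} [AddCommMonoid M] {m : ℕ} (f : Bits (m + 1) → M) :
    ∑ A, f A = ∑ J : Bits m, f (Fin.cons true J) + ∑ J : Bits m, f (Fin.cons false J) := by
  rw [← (Fin.consEquiv fun _ => Bool).sum_comp, Fintype.sum_prod_type, Fintype.sum_bool]
  rfl

theorem sum_ofBits {M : Type*} [AddCommMonoid M] {m : ℕ} (f : ℕ → M) :
    ∑ J : Bits m, f (Nat.ofBits J) = ∑ j ∈ Finset.range (2 ^ m), f j := by
  refine Finset.sum_nbij' (fun J => Nat.ofBits J) (fun j => binary m j) ?_ ?_ ?_ ?_ ?_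
  · intro J _; simpa using Nat.ofBits_lt_two_pow J
  · intro j _; simp
  · intro J _; funext i; simp [binary]
  · intro j hj
    change (Nat.ofBits fun i : Fin m => j.testBit i) = j
    rw [Nat.ofBits_testBit]
    exact Nat.mod_eq_of_lt (by simpa using hj)
  · intro J _; rfl

section Amplitude

variable {n w k l m : ℕ} {U : Matrix (Bits n) (Bits n) ℂ} {F : QState (n + w) → QState (n + w)}

open Classical in
-- The Hadamard gates spread the zero branch and index qubits uniformly, the code turns the zero
-- code label into the first column of `U`, and all bits behind them are untouched.
theorem opCode_hadamardsOp_single (hN : n + 1 + m ≤ n + w) {x : Bits (n + w)}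
    (hx : ∀ j < n + 1 + m, getBit x j = false) (y : Bits (n + w)) :
    opCode U (hadamardsOp n (m + 1) (Pi.single x 1)) y =
      (1 / (√2 : ℂ)) ^ (m + 1) * U (fun j => y (Fin.castAdd w j)) (zeroBits n) *
        if ∀ j, n + 1 + m ≤ j → getBit y j = getBit x j then 1 else 0 := by
  have hsupp : ∀ x' i, i < m + 1 → getBit x' (n + i) = true →
      (Pi.single x 1 : QState (n + w)) x' = 0 := by
    intro x' i hi h
    have : x' ≠ x := by
      rintro rfl
      rw [hx _ (by omega)] at h
      exact absurd h (by simp)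
    simp [this]
  have hget : ∀ c : Bits n, ∀ j (hj : j < n + w), getBit (clear n (m + 1)
      (Fin.append c fun i => y (Fin.natAdd n i))) j =
      if h : j < n then c ⟨j, h⟩ else if j < n + 1 + m then false else getBit y j := by
    intro c j hj
    rw [getBit_of_lt _ hj, getBit_of_lt _ hj, clear]
    by_cases h1 : j < n
    · rw [if_neg (by simp only; omega), dif_pos h1]
      exact Fin.append_left c _ ⟨j, h1⟩
    · rw [dif_neg h1]
      by_cases h2 : j < n + 1 + m
      · rw [if_pos (by simp only; omega), if_pos h2]
      · rw [if_neg (by simp only; omega), if_neg h2]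
        have h3 : (⟨j, hj⟩ : Fin (n + w)) = Fin.natAdd n ⟨j - n, by omega⟩ :=
          Fin.ext (by simp; omega)
        rw [h3, Fin.append_right]
  simp only [opCode, hadamardsOp_apply (show n + (m + 1) ≤ n + w by omega) hsupp]
  rw [Finset.sum_eq_single (zeroBits n)]
  · have hiff : clear n (m + 1) (Fin.append (zeroBits n) fun i => y (Fin.natAdd n i)) = x ↔
        ∀ j, n + 1 + m ≤ j → getBit y j = getBit x j := by
      constructor
      · rintro rfl j hj
        by_cases hjN : j < n + w
        · rw [hget _ j hjN, dif_neg (by omega), if_neg (by omega)]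
        · rw [getBit_of_ge _ (by omega), getBit_of_ge _ (by omega)]
      · intro h
        refine bits_ext fun j hj => ?_
        rw [hget _ j hj]
        split_ifs with h1 h2
        · exact (hx j (by omega)).symm
        · exact (hx j h2).symm
        · exact h j (by omega)
    rw [Pi.single_apply]
    by_cases h : clear n (m + 1) (Fin.append (zeroBits n) fun i => y (Fin.natAdd n i)) = x
    · rw [if_pos h, if_pos (hiff.1 h)]; ring
    · rw [if_neg h, if_neg fun h' => h (hiff.2 h')]; ring
  · intro c _ hc
    have : clear n (m + 1) (Fin.append c fun i => y (Fin.natAdd n i)) ≠ x := by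
      intro e
      refine hc (funext fun i => ?_)
      have h := hget c i (by omega)
      rw [e, hx i (by omega), dif_pos i.2] at h
      exact h.symm
    simp [this]
  · simp

/-- The fraction of the numbers `j < 2 ^ m` for which `j % k` has the binary expansion `z`. -/
noncomputable def modFreq (k m : ℕ) (z : Bits l) : ℝ :=
  (∑ j ∈ Finset.range (2 ^ m), if binary l (j % k) = z then 1 else 0) / 2 ^ m

/-- The probability that a measurement of the code applied to `0` yields the sample `z`. -/
noncomputable def sampleProb (U : Matrix (Bits n) (Bits n) ℂ) (z : Bits l) : ℝ :=
  ∑ c, if ∀ i : Fin l, getBit c i = z i then ‖U c (zeroBits n)‖ ^ 2 else 0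

theorem sum_norm_sq_column (hU : U ∈ Matrix.unitaryGroup (Bits n) ℂ) :
    ∑ c, ‖U c (zeroBits n)‖ ^ 2 = 1 := by
  have h := (sum_norm_sq_mulVec hU (Pi.single (zeroBits n) 1)).trans
    (Finset.sum_eq_single (zeroBits n) (fun b _ hb => by simp [hb]) (by simp))
  simpa using h

theorem indexVal_label (hN : n + 1 + m + l ≤ n + w) (c : Bits n) (A : Bits (m + 1)) (z : Bits l) :
    indexVal n m (label w c A z) = Nat.ofBits fun i : Fin m => A i.succ := by
  unfold indexVal
  congr 1
  funext i
  rw [show n + 1 + (i : ℕ) = n + (i.succ : ℕ) by simp; omega, getBit_label_index hN]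

theorem sq_one_div_sqrt_two_pow (t : ℕ) :
    star ((1 / (√2 : ℂ)) ^ t) * (1 / (√2 : ℂ)) ^ t = (1 / 2) ^ t := by
  rw [star_pow, ← mul_pow, ← one_div_sqrt_two_sq]
  simp

/-- Seen from both ends the circuit produces the same state U H|0⟩, up to the label qubits. The
amplitude is therefore a sum of squared moduli of its entries, over the code and index labels to
which the oracle assigns `z`, with the sign of the branch. Each branch has weight ½ and contributes
the probability that its sample is `z`. -/
theorem prepareOp_amplitude (hln : l ≤ n) (hN : n + 1 + m + l ≤ n + w)
    (hU : U ∈ Matrix.unitaryGroup (Bits n) ℂ)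
    (hF : XorOp (n + 1 + m) l F (oracleBits k n l m)) (z : Bits l) :
    prepareOp U m F (Pi.single (zeroBits (n + w)) 1)
      (label w (zeroBits n) (zeroBits (m + 1)) z) =
      ((1 / 2 * (modFreq k m z - sampleProb U z) : ℝ) : ℂ) := by
  have hF' := hF
  obtain ⟨g, rfl, h1, -, h3⟩ := hF
  set x := label w (zeroBits n) (zeroBits (m + 1)) z with hx
  have hx0 : ∀ j < n + 1 + m, getBit x j = false := by
    intro j hj
    by_cases hjn : j < n
    · exact getBit_label_code _ _ _ ⟨j, hjn⟩
    · have h := getBit_label_index hN (zeroBits n) (zeroBits (m + 1)) z ⟨j - n, by omega⟩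
      rwa [show n + (⟨j - n, by omega⟩ : Fin (m + 1)).val = j by simp only; omega] at h
  have hxl : ∀ i : Fin l, getBit x (n + 1 + m + i) = z i := fun i => getBit_label_label hN _ _ _ i
  have hz0 : ∀ j, getBit (zeroBits (n + w)) j = false := fun j => ancZero_zeroBits 0 j (by omega)
  have hxor : ∀ a b : Bool, xor a b = false → b = a := by decide
  have hU' := Adj.opCode (w := w) U.conjTranspose
  rw [Matrix.conjTranspose_conjTranspose] at hU'
  have hadj := (adj_hadamardsOp (N := n + w) n (m + 1)).comp hU'
  let ind : Bits n → Bits (m + 1) → ℂ := fun c A => if ∀ i : Fin l,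
    (if A 0 then getBit c i else ((Nat.ofBits fun i : Fin m => A i.succ) % k).testBit i) = z i
    then 1 else 0
  -- The last two operations, U† and the Hadamard gates, are moved to the left side of the inner
  -- product.
  calc prepareOp U m _ (Pi.single (zeroBits (n + w)) 1) x
      = dot (opCode U (hadamardsOp n (m + 1) (Pi.single x 1)))
          (pull (fun y => xorFrom (n + 1 + m) (g y) y)
            (zOp n (opCode U (hadamardsOp n (m + 1) (Pi.single (zeroBits (n + w)) 1))))) := by
        rw [← dot_single x (prepareOp _ _ _ _)]
        exact hadj _ _
    -- The left factor lives on labels with label qubits `z` and clean ancillas. The right factor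
    -- requires that the oracle clears the label qubits, that is, that its output is `z`.
    _ = ∑ cA : Bits n × Bits (m + 1), (1 / 2) ^ (m + 1) * ((‖U cA.1 (zeroBits n)‖ ^ 2 : ℝ) : ℂ) *
          (if cA.2 0 then -1 else 1) * ind cA.1 cA.2 := by
        symm
        refine Fintype.sum_of_injective (fun cA : Bits n × Bits (m + 1) => label w cA.1 cA.2 z)
          (fun cA cA' h => ?_) _ _ (fun y hy => ?_) fun cA => ?_
        · obtain ⟨e1, e2, -⟩ := label_injective hN h
          exact Prod.ext e1 e2
        · rw [opCode_hadamardsOp_single (by omega) hx0, if_neg, mul_zero, star_zero, zero_mul]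
          intro h
          have hy0 : AncZero (n + 1 + m + l) y := fun j hj => by
            rw [h j (by omega)]; exact ancZero_label _ _ _ j hj
          refine hy ⟨(fun i : Fin n => getBit y i, fun i : Fin (m + 1) => getBit y (n + i)), ?_⟩
          refine Eq.trans ?_ (exists_label hN hy0).symm
          simp only
          congr 1
          funext i
          rw [h _ (by omega), hxl]
        · obtain ⟨c, A⟩ := cA
          simp only
          have hy0 : AncZero (n + 1 + m + l) (label w c A z) := ancZero_label c A z
          have hcode : ∀ i : Fin n, getBit (xorFrom (n + 1 + m) (g (label w c A z))
              (label w c A z)) i = c i := fun i => by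
            rw [getBit_xorFrom_of (h1 _) (by omega), getBit_label_code]
          have hc1 : (fun j => label w c A z (Fin.castAdd w j)) = c := funext fun i => by
            rw [← getBit_label_code (w := w) c A z i, getBit_of_lt _ (by omega)]; rfl
          have hc2 : (fun j => xorFrom (n + 1 + m) (g (label w c A z)) (label w c A z)
              (Fin.castAdd w j)) = c := funext fun i => by
            rw [← hcode i, getBit_of_lt _ (by omega)]; rfl
          have hA : getBit (xorFrom (n + 1 + m) (g (label w c A z)) (label w c A z)) n = A 0 := by
            rw [getBit_xorFrom_of (h1 _) (by omega)]
            exact getBit_label_index hN c A z 0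
          have hi1 : ∀ j, n + 1 + m ≤ j → getBit (label w c A z) j = getBit x j := by
            intro j hj
            by_cases hj2 : j < n + 1 + m + l
            · have e1 := getBit_label_label hN c A z ⟨j - (n + 1 + m), by omega⟩
              have e2 := hxl ⟨j - (n + 1 + m), by omega⟩
              rw [show n + 1 + m + (⟨j - (n + 1 + m), by omega⟩ : Fin l).val = j by
                simp only; omega] at e1 e2
              rw [e1, e2]
            · rw [hy0 j (by omega), hx, ancZero_label _ _ _ j (by omega)]
          have hi2 : (∀ j, n + 1 + m ≤ j → getBit (xorFrom (n + 1 + m) (g (label w c A z))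
              (label w c A z)) j = getBit (zeroBits (n + w)) j) ↔ ∀ i : Fin l,
              (if A 0 then getBit c i else
                ((Nat.ofBits fun i : Fin m => A i.succ) % k).testBit i) = z i := by
            have e1 : ∀ i : Fin l, g (label w c A z) i = (if A 0 then getBit c i else
                ((Nat.ofBits fun i : Fin m => A i.succ) % k).testBit i) := fun i => by
              have e2 : getBit (label w c A z) n = A 0 := getBit_label_index hN c A z 0
              have e3 : getBit (label w c A z) i = getBit c i := by
                have := getBit_label_code (w := w) c A z ⟨i, by omega⟩
                rw [getBit_of_lt c (by omega : (i : ℕ) < n)]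
                exact this
              rw [h3 _ hy0, oracleBits, e2, e3, indexVal_label hN]
              simp
            constructor
            · intro h i
              have e4 := h (n + 1 + m + i) (by omega)
              rw [hz0, getBit_xorFrom_ge _ _ _ (by omega) (by omega), getBit_label_label hN,
                show n + 1 + m + (i : ℕ) - (n + 1 + m) = i by omega, e1 i] at e4
              exact hxor _ _ e4
            · intro h j hj
              rw [hz0]
              by_cases hj2 : j < n + 1 + m + l
              · rw [getBit_xorFrom_ge _ _ _ hj (by omega)]
                have e4 := getBit_label_label hN c A z ⟨j - (n + 1 + m), by omega⟩
                rw [show n + 1 + m + (⟨j - (n + 1 + m), by omega⟩ : Fin l).val = j by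
                  simp only; omega] at e4
                have e5 := e1 ⟨j - (n + 1 + m), by omega⟩
                simp only at e5
                rw [e4, e5, h ⟨j - (n + 1 + m), by omega⟩, Bool.xor_self]
              · rw [getBit_xorFrom_of (h1 _) (by omega), hy0 j (by omega)]
          have hnorm : star (U c (zeroBits n)) * U c (zeroBits n) =
              ((‖U c (zeroBits n)‖ ^ 2 : ℝ) : ℂ) := by
            rw [Complex.star_def, mul_comm, Complex.mul_conj, Complex.normSq_eq_norm_sq]
          rw [opCode_hadamardsOp_single (by omega) hx0, if_pos hi1, hc1, pull, zOp, hA,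
            opCode_hadamardsOp_single (by omega) (fun j _ => hz0 j), hc2, ← hnorm,
            ← sq_one_div_sqrt_two_pow]
          simp only [hi2, ind, star_mul', mul_one]
          split_ifs <;> ring
    _ = ((1 / 2 * (modFreq k m z - sampleProb U z) : ℝ) : ℂ) := by
        rw [Fintype.sum_prod_type]
        -- The sum is split by the branch bit. On branch `1` the index is irrelevant and contributes
        -- `2 ^ m * (1 / 2) ^ (m + 1) = 1 / 2`; on branch `0` the code label is irrelevant.
        have e1 : ∀ c : Bits n, ∑ A, (1 / 2) ^ (m + 1) * ((‖U c (zeroBits n)‖ ^ 2 : ℝ) : ℂ) *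
            (if A 0 then -1 else 1) * ind c A = (1 / 2) ^ (m + 1) *
            ((‖U c (zeroBits n)‖ ^ 2 : ℝ) : ℂ) * ((2 ^ m * modFreq k m z : ℝ) : ℂ) -
            (1 / 2) * (((if ∀ i : Fin l, getBit c i = z i then
              ‖U c (zeroBits n)‖ ^ 2 else 0 : ℝ)) : ℂ) := by
          intro c
          have e2 : ((2 ^ m * modFreq k m z : ℝ) : ℂ) =
              ∑ J : Bits m, if binary l (Nat.ofBits J % k) = z then (1 : ℂ) else 0 := by
            rw [sum_ofBits (fun j => if binary l (j % k) = z then (1 : ℂ) else 0), modFreq,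
              mul_div_cancel₀ _ (by positivity)]
            push_cast
            exact Finset.sum_congr rfl fun j _ => by split_ifs <;> simp
          have e3 : ∀ j : ℕ, (∀ i : Fin l, j.testBit i = z i) ↔ binary l j = z :=
            fun j => ⟨fun h => funext h, fun h i => congrFun h i⟩
          rw [sum_bits_succ, e2]
          simp only [ind, Fin.cons_zero, Fin.cons_succ, if_true, e3, Bool.false_eq_true, if_false,
            Finset.sum_const, Finset.card_univ, Fintype.card_pi, Fintype.card_bool,
            Finset.prod_const, Fintype.card_fin, nsmul_eq_mul, mul_one]
          rw [← Finset.mul_sum]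
          push_cast
          have e4 : (2 : ℂ) ^ m * (1 / 2) ^ (m + 1) = 1 / 2 := by
            rw [pow_succ, ← mul_assoc, ← mul_pow]; norm_num
          split_ifs
          · push_cast
            linear_combination (-(‖U c (zeroBits n)‖ : ℂ) ^ 2) * e4
          · push_cast
            ring
        simp only [e1]
        rw [Finset.sum_sub_distrib, ← Finset.sum_mul, ← Finset.mul_sum, ← Finset.mul_sum,
          ← Complex.ofReal_sum, ← Complex.ofReal_sum, sum_norm_sq_column hU, ← sampleProb]
        have e4 : (1 / 2) ^ (m + 1) * (2 : ℂ) ^ m = 1 / 2 := by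
          rw [pow_succ, mul_right_comm, ← mul_pow]; norm_num
        push_cast
        linear_combination (modFreq k m z : ℂ) * e4

/-- The probability of finding the code, branch and index qubits in the state `0`. -/
theorem normSq_zeroProj_prepareOp (hln : l ≤ n) (hN : n + 1 + m + l ≤ n + w)
    (hU : U ∈ Matrix.unitaryGroup (Bits n) ℂ)
    (hF : XorOp (n + 1 + m) l F (oracleBits k n l m)) :
    normSq (zeroProj (n + 1 + m) (prepareOp U m F (Pi.single (zeroBits (n + w)) 1))) =
      1 / 4 * ∑ z : Bits l, (modFreq k m z - sampleProb U z) ^ 2 := by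
  have hs : Supported (n + 1 + m + l) (prepareOp U m F (Pi.single (zeroBits (n + w)) 1)) :=
    Supported.prepareOp hF (supported_single (ancZero_zeroBits _))
  rw [Finset.mul_sum]
  symm
  refine Fintype.sum_of_injective (fun z => label w (zeroBits n) (zeroBits (m + 1)) z)
    (fun z z' h => (label_injective hN h).2.2) _ _ (fun y hy => ?_) fun z => ?_
  · rw [zeroProj]
    split_ifs with h
    · rw [hs, norm_zero, zero_pow two_ne_zero]
      intro hy0
      refine hy ⟨fun i => getBit y (n + 1 + m + i), ?_⟩
      refine Eq.trans ?_ (exists_label hN hy0).symm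
      simp only
      congr 1
      · funext i; exact (h i (by omega)).symm
      · funext i; exact (h (n + i) (by omega)).symm
    · simp
  · rw [zeroProj, if_pos, prepareOp_amplitude hln hN hU hF, Complex.norm_real, Real.norm_eq_abs,
      sq_abs]
    · ring
    · intro j hj
      by_cases hjn : j < n
      · exact getBit_label_code _ _ _ ⟨j, hjn⟩
      · have h := getBit_label_index hN (zeroBits n) (zeroBits (m + 1)) z ⟨j - n, by omega⟩
        rwa [show n + (⟨j - n, by omega⟩ : Fin (m + 1)).val = j by simp only; omega] at h

end Amplitude

/-! ## Amplitude amplification -/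

section Grover

variable {N : ℕ}

/-- One iteration of amplitude amplification, for the state preparation `B`. -/
def groverOp (p t : ℕ) (B : QState N → QState N) : QState N → QState N :=
  B ∘ zeroPhaseOp p p ∘ B ∘ zeroPhaseOp p t

theorem zeroProj_zeroProj (t : ℕ) (ψ : QState N) : zeroProj t (zeroProj t ψ) = zeroProj t ψ := by
  funext x
  simp only [zeroProj]
  split_ifs <;> rfl

theorem zeroProj_add (t : ℕ) (ψ φ : QState N) :
    zeroProj t (ψ + φ) = zeroProj t ψ + zeroProj t φ := by
  funext x
  simp only [zeroProj, Pi.add_apply]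
  split_ifs <;> simp

theorem zeroProj_smul (t : ℕ) (a : ℂ) (ψ : QState N) :
    zeroProj t (a • ψ) = a • zeroProj t ψ := by
  funext x
  simp only [zeroProj, Pi.smul_apply]
  split_ifs <;> simp

theorem normSq_smul (a : ℝ) (ψ : QState N) : normSq ((a : ℂ) • ψ) = a ^ 2 * normSq ψ := by
  simp [normSq, mul_pow, Finset.mul_sum]

theorem dot_zeroProj (t : ℕ) (ψ : QState N) :
    dot ψ (zeroProj t ψ) = (normSq (zeroProj t ψ) : ℂ) := by
  rw [← dot_self]
  refine Finset.sum_congr rfl fun x _ => ?_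
  simp only [zeroProj]
  split_ifs <;> simp

theorem normSq_sub_zeroProj (t : ℕ) (ψ : QState N) :
    normSq (ψ + (-1 : ℂ) • zeroProj t ψ) = normSq ψ - normSq (zeroProj t ψ) := by
  simp only [normSq, ← Finset.sum_sub_distrib]
  refine Finset.sum_congr rfl fun x _ => ?_
  simp only [zeroProj, Pi.add_apply, Pi.smul_apply]
  split_ifs <;> simp

theorem normSq_single (x : Bits N) : normSq (Pi.single x (1 : ℂ)) = 1 := by
  have h := dot_self (Pi.single x (1 : ℂ) : QState N)
  rw [dot_single, Pi.single_eq_same] at h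
  exact_mod_cast h.symm

variable {p t : ℕ} {B : QState N → QState N}

/-- The hypotheses on the state preparation. -/
structure IsPreparation (p t : ℕ) (B : QState N → QState N) : Prop where
  adj : Adj B B
  inv : B ∘ B = id
  supp : ∀ ψ, Supported p ψ → Supported p (B ψ)
  le : t ≤ p
  room : 2 * p < N

/-- The prepared state. -/
def prepState (B : QState N → QState N) : QState N := B (Pi.single (zeroBits N) 1)

/-- The part of the prepared state that is orthogonal to the states with `t` leading zeros. -/
def badPart (t : ℕ) (B : QState N → QState N) : QState N :=
  prepState B + (-1 : ℂ) • zeroProj t (prepState B)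

theorem IsPreparation.supported (h : IsPreparation p t B) : Supported p (prepState B) :=
  h.supp _ (supported_single (ancZero_zeroBits _))

theorem IsPreparation.normSq_prepState (h : IsPreparation p t B) : normSq (prepState B) = 1 := by
  rw [prepState, h.adj.normSq_eq h.inv, normSq_single]

theorem IsPreparation.supported_badPart (h : IsPreparation p t B) : Supported p (badPart t B) :=
  h.supported.add (h.supported.zeroProj.smul _)

theorem zeroProj_badPart : zeroProj t (badPart t B) = 0 := by
  rw [badPart, zeroProj_add, zeroProj_smul, zeroProj_zeroProj]
  simp

/-- Let φ = β + γ be the prepared state with good part γ, and a = ‖γ‖². The first reflection negates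
γ. Since B is a self-adjoint involution, B(1 − 2|0⟩⟨0|)B is the reflection 1 − 2|φ⟩⟨φ|, and ⟨φ, β⟩ =
1 − a, ⟨φ, γ⟩ = a. The vectors β and γ are not normalized, which accounts for the asymmetric
coefficients. -/
theorem IsPreparation.groverOp_apply (h : IsPreparation p t B) (x y : ℂ) :
    groverOp p t B (x • badPart t B + y • zeroProj t (prepState B)) =
      (-((1 - 2 * normSq (zeroProj t (prepState B))) * x -
        2 * normSq (zeroProj t (prepState B)) * y)) • badPart t B +
      (-(2 * (1 - normSq (zeroProj t (prepState B))) * x +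
        (1 - 2 * normSq (zeroProj t (prepState B))) * y)) • zeroProj t (prepState B) := by
  have hle := h.le
  have hroom := h.room
  set γ := zeroProj t (prepState B) with hγ
  set β := badPart t B with hβ
  have hφ : prepState B = β + γ := by simp [hβ, hγ, badPart]
  have hsγ : Supported p γ := h.supported.zeroProj
  have hsβ : Supported p β := h.supported_badPart
  have h1 : zeroPhaseOp p t (x • β + y • γ) = x • β + (-y) • γ := by
    rw [zeroPhaseOp_eq hle (by omega) ((hsβ.smul _).add (hsγ.smul _)), zeroProj_add, zeroProj_smul,
      zeroProj_smul, hβ, zeroProj_badPart, hγ, zeroProj_zeroProj]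
    module
  set χ := x • β + (-y) • γ with hχ
  have hsχ : Supported p χ := (hsβ.smul _).add (hsγ.smul _)
  have hBB : ∀ ψ, B (B ψ) = ψ := fun ψ => congrFun h.inv ψ
  have h2 : B (zeroPhaseOp p p (B χ)) = χ + (-2 * B χ (zeroBits N)) • prepState B := by
    rw [zeroPhaseOp_eq le_rfl (by omega) (h.supp _ hsχ), zeroProj_full (h.supp _ hsχ), smul_smul,
      h.adj.add, h.adj.smul, hBB]
    rfl
  have h3 : B χ (zeroBits N) = x * (1 - normSq γ) - y * normSq γ := by
    have e1 : dot (prepState B) γ = normSq γ := dot_zeroProj _ _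
    have e2 : dot (prepState B) β = 1 - normSq γ := by
      rw [hβ, badPart, dot_add, dot_smul, ← hγ, e1, dot_self, h.normSq_prepState]
      push_cast; ring
    rw [← dot_single (zeroBits N) (B χ), h.adj]
    change dot (prepState B) χ = _
    rw [hχ, dot_add, dot_smul, dot_smul, e1, e2]
    ring
  change B (zeroPhaseOp p p (B (zeroPhaseOp p t (x • β + y • γ)))) = _
  rw [h1, h2, h3, hφ, hχ]
  module

/-- On the plane of the two parts an iteration is minus a rotation by `2 * θ`. The good coordinate
would be a quotient by `sin θ`; it is stated multiplied out so that `sin θ = 0` is covered. -/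
theorem IsPreparation.groverOp_iterate (h : IsPreparation p t B) {θ : ℝ}
    (hθ : Real.sin θ ^ 2 = normSq (zeroProj t (prepState B))) (j : ℕ) :
    ∃ y : ℝ, Real.sin θ * y = (-1) ^ j * (Real.cos θ * Real.sin (2 * j * θ)) ∧
      (groverOp p t B)^[j] (badPart t B) =
        (((-1) ^ j * Real.cos (2 * j * θ) : ℝ) : ℂ) • badPart t B +
          (y : ℂ) • zeroProj t (prepState B) := by
  induction j with
  | zero => exact ⟨0, by simp, by simp⟩
  | succ j ih =>
    obtain ⟨y, hy, hj⟩ := ih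
    have hc : Real.cos θ ^ 2 = 1 - Real.sin θ ^ 2 := Real.cos_sq' θ
    have e1 : Real.cos (2 * (j + 1 : ℕ) * θ) =
        Real.cos (2 * j * θ) * (1 - 2 * Real.sin θ ^ 2) -
          Real.sin (2 * j * θ) * (2 * Real.sin θ * Real.cos θ) := by
      rw [show 2 * ((j + 1 : ℕ) : ℝ) * θ = 2 * j * θ + 2 * θ by push_cast; ring, Real.cos_add,
        Real.cos_two_mul, Real.sin_two_mul, hc]
      ring
    have e2 : Real.sin (2 * (j + 1 : ℕ) * θ) =
        Real.sin (2 * j * θ) * (1 - 2 * Real.sin θ ^ 2) +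
          Real.cos (2 * j * θ) * (2 * Real.sin θ * Real.cos θ) := by
      rw [show 2 * ((j + 1 : ℕ) : ℝ) * θ = 2 * j * θ + 2 * θ by push_cast; ring, Real.sin_add,
        Real.cos_two_mul, Real.sin_two_mul, hc]
      ring
    refine ⟨-(2 * (1 - Real.sin θ ^ 2) * ((-1) ^ j * Real.cos (2 * j * θ)) +
      (1 - 2 * Real.sin θ ^ 2) * y), ?_, ?_⟩
    · rw [e2, pow_succ (-1 : ℝ) j]
      linear_combination (-(1 - 2 * Real.sin θ ^ 2)) * hy +
        (-1) ^ j * 2 * Real.sin θ * Real.cos (2 * j * θ) * hc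
    · have e3 : (-1) ^ (j + 1) * Real.cos (2 * (j + 1 : ℕ) * θ) =
          -((1 - 2 * Real.sin θ ^ 2) * ((-1) ^ j * Real.cos (2 * j * θ)) -
            2 * Real.sin θ ^ 2 * y) := by
        rw [e1, pow_succ (-1 : ℝ) j]
        linear_combination (-2 * Real.sin θ) * hy
      rw [Function.iterate_succ_apply', hj, h.groverOp_apply, ← hθ, e3]
      congr 2 <;> push_cast <;> ring

/-- The operation on the quantum memory when `groverOp` is applied `j` times and a measurement
does not find `t` leading zeros. -/
def stageOp (p t : ℕ) (hN : p + t < N) (B : QState N → QState N) (j : ℕ) : QState N → QState N :=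
  pull (fwd p 0 t) ∘ opProj ⟨p + t, hN⟩ false ∘ pull (bwd p 0 t) ∘ (groverOp p t B)^[j]

/-- Computing the flag, projecting it to `0` and uncomputing it is the projection 1 − Π, with no
trace left in the ancillas. -/
theorem measureOp_eq (hp : t ≤ p) (hN : p + t < N) {ψ : QState N} (hψ : Supported p ψ) :
    pull (fwd p 0 t) (opProj ⟨p + t, hN⟩ false (pull (bwd p 0 t) ψ)) =
      ψ + (-1 : ℂ) • zeroProj t ψ := by
  funext x
  simp only [pull, opProj, bwd_fwd (show 0 + t ≤ p by omega), ← getBit_of_lt _ hN]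
  by_cases hx : AncZero p x
  · have h := getBit_fwd (lo := 0) (by omega) hN hx
    simp only [zero_add] at h
    simp only [Pi.add_apply, Pi.smul_apply, zeroProj, ← h]
    cases getBit (fwd p 0 t x) (p + t) <;> simp
  · simp [zeroProj, hψ x hx]

/-- Not finding the flag removes the good component, so a stage maps the line of the bad part to
itself; only the cosine of the rotation survives. This is why no new preparation is needed between
stages. -/
theorem IsPreparation.stageOp_smul (h : IsPreparation p t B) {θ : ℝ}
    (hθ : Real.sin θ ^ 2 = normSq (zeroProj t (prepState B))) (hN : p + t < N) (j : ℕ) (z : ℝ) :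
    stageOp p t hN B j ((z : ℂ) • badPart t B) =
      ((z * ((-1) ^ j * Real.cos (2 * j * θ)) : ℝ) : ℂ) • badPart t B := by
  obtain ⟨y, -, hj⟩ := h.groverOp_iterate hθ j
  have hsmul : ∀ i : ℕ, ∀ ψ, Supported p ψ → (groverOp p t B)^[i] ((z : ℂ) • ψ) =
      (z : ℂ) • (groverOp p t B)^[i] ψ ∧ Supported p ((groverOp p t B)^[i] ψ) := by
    intro i ψ hψ
    induction i with
    | zero => exact ⟨rfl, hψ⟩
    | succ i ih =>
      have hS : ∀ q ≤ p, ∀ χ : QState N, Supported p χ → Supported p (zeroPhaseOp p q χ) := by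
        intro q hq χ hχ
        rw [zeroPhaseOp_eq hq (by have := h.room; omega) hχ]
        exact hχ.add (hχ.zeroProj.smul _)
      have hsm : ∀ (q : ℕ) (χ : QState N), zeroPhaseOp p q ((z : ℂ) • χ) = (z : ℂ) • zeroPhaseOp p q χ := by
        intro q χ
        funext x
        simp only [zeroPhaseOp, Pi.smul_apply, smul_eq_mul]
        split_ifs <;> ring
      rw [Function.iterate_succ_apply', Function.iterate_succ_apply', ih.1]
      refine ⟨?_, ?_⟩
      · simp only [groverOp, Function.comp, hsm, h.adj.smul]
      · exact h.supp _ (hS p le_rfl _ (h.supp _ (hS t h.le _ ih.2)))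
  have h1 := hsmul j _ h.supported_badPart
  change pull (fwd p 0 t) (opProj ⟨p + t, hN⟩ false (pull (bwd p 0 t)
    ((groverOp p t B)^[j] ((z : ℂ) • badPart t B)))) = _
  rw [h1.1, measureOp_eq h.le hN (h1.2.smul _), zeroProj_smul, hj, zeroProj_add, zeroProj_smul,
    zeroProj_smul, zeroProj_badPart, zeroProj_zeroProj]
  push_cast
  module

theorem IsPreparation.stageOp_zero (h : IsPreparation p t B) (hN : p + t < N) :
    stageOp p t hN B 0 (prepState B) = badPart t B :=
  measureOp_eq h.le hN h.supported

/-- The number of iterations in stage `i`. -/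
def stageLen (i : ℕ) : ℕ := if i = 0 then 0 else 2 ^ (i - 1)

/-- The probability that none of the first `S + 1` stages rejects. -/
theorem IsPreparation.normSq_stages (h : IsPreparation p t B) {θ : ℝ}
    (hθ : Real.sin θ ^ 2 = normSq (zeroProj t (prepState B))) (hN : p + t < N) (S : ℕ) :
    normSq (opSeq (fun i => stageOp p t hN B (stageLen i)) (S + 1) (prepState B)) =
      ∏ i ∈ Finset.range (S + 1), Real.cos (2 ^ i * θ) ^ 2 := by
  -- Stage `0` makes no iteration and only projects the prepared state to the bad part, whose
  -- squared norm `cos θ ^ 2` is the factor for `i = 0`. Stage `i + 1` makes `2 ^ i` iterations and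
  -- contributes `cos (2 ^ (i + 1) * θ)`.
  have key : ∃ z : ℝ, z ^ 2 = ∏ i ∈ Finset.range S, Real.cos (2 ^ (i + 1) * θ) ^ 2 ∧
      opSeq (fun i => stageOp p t hN B (stageLen i)) (S + 1) (prepState B) =
        (z : ℂ) • badPart t B := by
    induction S with
    | zero =>
      refine ⟨1, by simp, ?_⟩
      change stageOp p t hN B 0 (prepState B) = _
      rw [h.stageOp_zero hN]
      simp
    | succ S ih =>
      obtain ⟨z, hz, hS⟩ := ih
      refine ⟨z * ((-1) ^ (2 ^ S) * Real.cos (2 * (2 ^ S : ℕ) * θ)), ?_, ?_⟩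
      · rw [Finset.prod_range_succ, ← hz, mul_pow, mul_pow, ← pow_mul, mul_comm _ 2, pow_mul,
          neg_one_sq, one_pow, one_mul]
        congr 3
        push_cast
        ring
      · rw [opSeq, Function.comp, hS]
        exact h.stageOp_smul hθ hN (2 ^ S) z
  obtain ⟨z, hz, hS⟩ := key
  rw [hS, normSq_smul, hz, badPart, normSq_sub_zeroProj, h.normSq_prepState, ← hθ,
    ← Real.cos_sq', Finset.prod_range_succ']
  simp

/-! ### The probability that all stages accept -/

theorem sin_two_pow_mul (θ : ℝ) (S : ℕ) :
    Real.sin (2 ^ S * θ) = 2 ^ S * Real.sin θ * ∏ i ∈ Finset.range S, Real.cos (2 ^ i * θ) := by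
  induction S with
  | zero => simp
  | succ S ih =>
    rw [Finset.prod_range_succ, show (2 : ℝ) ^ (S + 1) * θ = 2 * (2 ^ S * θ) by ring,
      Real.sin_two_mul, ih]
    ring

/-- By the iterated doubling formula the left side is the square of `sin (2 ^ S * θ)`. Soundness
follows without any prior knowledge of the size of `θ`. -/
theorem four_pow_mul_prod_cos_sq_le (θ : ℝ) (S : ℕ) :
    4 ^ S * Real.sin θ ^ 2 * ∏ i ∈ Finset.range S, Real.cos (2 ^ i * θ) ^ 2 ≤ 1 := by
  have h := Real.sin_sq_le_one (2 ^ S * θ)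
  rw [sin_two_pow_mul, mul_pow, mul_pow, ← pow_mul, mul_comm S 2, pow_mul,
    ← Finset.prod_pow] at h
  norm_num at h
  exact h

theorem sin_sq_two_pow_mul_le (θ : ℝ) (S : ℕ) :
    Real.sin (2 ^ S * θ) ^ 2 ≤ 4 ^ S * Real.sin θ ^ 2 := by
  induction S with
  | zero => simp
  | succ S ih =>
    rw [show (2 : ℝ) ^ (S + 1) * θ = 2 * (2 ^ S * θ) by ring, Real.sin_two_mul, pow_succ (4 : ℝ) S]
    have h := Real.cos_sq_le_one (2 ^ S * θ)
    nlinarith [sq_nonneg (Real.sin (2 ^ S * θ))]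

/-- The `i`-th factor loses at most `4 ^ i * sin θ ^ 2`, and the powers of 4 sum to `(4 ^ S - 1) /
3`. The induction needs the version with `- 1`. -/
theorem one_sub_le_prod_cos_sq (θ : ℝ) (S : ℕ) :
    1 - 4 ^ S * Real.sin θ ^ 2 / 3 ≤ ∏ i ∈ Finset.range S, Real.cos (2 ^ i * θ) ^ 2 := by
  have h : ∀ S : ℕ, 1 - (4 ^ S - 1) * Real.sin θ ^ 2 / 3 ≤
      ∏ i ∈ Finset.range S, Real.cos (2 ^ i * θ) ^ 2 := by
    intro S
    induction S with
    | zero => simp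
    | succ S ih =>
      have h0 : 0 ≤ ∏ i ∈ Finset.range S, Real.cos (2 ^ i * θ) ^ 2 :=
        Finset.prod_nonneg fun _ _ => sq_nonneg _
      have h1 : ∏ i ∈ Finset.range S, Real.cos (2 ^ i * θ) ^ 2 ≤ 1 :=
        Finset.prod_le_one (fun _ _ => sq_nonneg _) fun _ _ => Real.cos_sq_le_one _
      have h2 := sin_sq_two_pow_mul_le θ S
      rw [Finset.prod_range_succ, Real.cos_sq' (2 ^ S * θ), pow_succ (4 : ℝ) S]
      nlinarith [sq_nonneg (Real.sin (2 ^ S * θ))]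
  have h1 := h S
  have h2 := sq_nonneg (Real.sin θ)
  nlinarith

end Grover

/-! ## The main part of the program -/

section Main

variable {n w : ℕ} {U : Matrix (Bits n) (Bits n) ℂ} {ε : ℝ} {V : ℕ}

/-- The number of code, branch and index qubits. -/
def Expr.flagLen : Expr := .add (.reg 1) (.add (.reg 3) (.lit 1))

/-- One iteration of amplitude amplification. -/
def Prog.grover : Prog :=
  .seq (.zeroPhase 20 .flagLen) (.seq (.prepare 20) (.seq (.zeroPhase 20 (.reg 5)) (.prepare 20)))

/-- One stage of the algorithm; register `13` holds the number of iterations. -/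
def Prog.stage : Prog :=
  .ite (.reg 9) .skip (.seq (.loop (.reg 13) .grover) (.seq (.compute 20 (.lit 0) .flagLen)
    (.seq (.measure (.add (.reg 5) .flagLen) 9) (.ite (.reg 9) .skip
      (.seq (.uncompute 20 (.lit 0) .flagLen)
        (.set 13 (.add (.mul (.lit 2) (.reg 13)) (.sub (.lit 1) (.reg 13)))))))))

/-- All stages; register `8` holds their number. -/
def Prog.stages : Prog := .seq (.prepare 20) (.loop (.reg 8) .stage)

theorem Layout.eval_flagLen {N k l m : ℕ} {f : ℕ → ℕ} (hf : Layout V N k n l m f) :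
    Expr.flagLen.eval f = n + 1 + m := by
  simp only [Expr.flagLen, Expr.eval, hf.reg1, hf.reg3]
  omega

theorem regsLT_flagLen : Expr.flagLen.regsLT 20 := by simp [Expr.flagLen, Expr.regsLT]

theorem Triple.grover {k l m : ℕ} {f : ℕ → ℕ} {F : QState (n + w) → QState (n + w)}
    (hf : Layout V (n + w) k n l m f) (hF : Triple U ε V 20 (.oracle 20) f 20 f F 0) :
    Triple U ε V 20 .grover f 20 f
      (groverOp (n + 1 + m + l) (n + 1 + m) (prepareOp U m F)) 4 := by
  have hroom := hf.room
  have hq := hf.qubits_le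
  have h1 := Triple.prepare hf (by omega) hF
  have h2 := Triple.zeroPhase (U := U) (ε := ε) (w := w) (V := V) (show 5 < 20 by omega)
    regsLT_flagLen hf.eval_flagLen hf.reg5 (by omega) (by omega) (by omega)
  have h3 := Triple.zeroPhase (U := U) (ε := ε) (w := w) (V := V) (L := .reg 5)
    (show 5 < 20 by omega) (show 5 < 20 by omega) hf.reg5 hf.reg5 (by omega) (by omega) (by omega)
  exact h2.seq (h1.seq (h3.seq h1))

theorem RejTriple.stage {k l m t : ℕ} {f : ℕ → ℕ} {F : QState (n + w) → QState (n + w)}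
    (hf : Layout V (n + w) k n l m f) (hF : Triple U ε V 20 (.oracle 20) f 20 f F 0)
    (h9 : f 9 = 0) (h13 : f 13 = t) (htV : 2 * t + 1 ≤ V)
    (hN : n + 1 + m + l + (n + 1 + m) < n + w) :
    RejTriple U ε V 20 .stage f 20 (Function.update f 13 (2 * t + (1 - t)))
      (stageOp (n + 1 + m + l) (n + 1 + m) hN (prepareOp U m F) t) (t * 4) := by
  have hq := hf.qubits_le
  have h1 := Triple.loop (u := fun _ => 4) (f := fun _ => f) (e := .reg 13)
    (show 13 < 20 by omega) h13 (fun i _ => Triple.grover hf hF)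
  have h2 := Triple.compute (U := U) (ε := ε) (w := w) (V := V) (lo := .lit 0)
    (show 5 < 20 by omega) trivial regsLT_flagLen rfl hf.eval_flagLen hf.reg5
    (show 0 + (n + 1 + m) ≤ _ by omega) (by omega) (by omega)
  have h3 := Triple.uncompute (U := U) (ε := ε) (w := w) (V := V) (lo := .lit 0)
    (show 5 < 20 by omega) trivial regsLT_flagLen rfl hf.eval_flagLen hf.reg5
    (show 0 + (n + 1 + m) ≤ _ by omega) (by omega) (by omega)
  have h4 := Triple.set (n := n) (w := w) (U := U) (ε := ε) (V := V) (s := 20) (s' := 20) (r := 13)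
    (f := f) (e := .add (.mul (.lit 2) (.reg 13)) (.sub (.lit 1) (.reg 13)))
    (by simp [Expr.regsLT]) (by simp only [Expr.eval, h13]; omega) (.inl le_rfl)
  have h5 : (Expr.add (.reg 5) .flagLen).eval f = n + 1 + m + l + (n + 1 + m) := by
    have := hf.eval_flagLen
    simp only [Expr.eval] at this ⊢
    rw [this, hf.reg5]
  have h6 := RejTriple.measure (q := .add (.reg 5) .flagLen) ⟨by simp [Expr.regsLT], regsLT_flagLen⟩
    (by omega) (by omega) (by rw [h5]; exact hN) h9 (h3.seq h4)
  refine RejTriple.ite (show 9 < 20 by omega) (fun h => absurd h9 h) fun _ => ?_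
  refine (Triple.seqRej h1 (Triple.seqRej h2 h6)).conseq le_rfl Env.rfl' le_rfl ?_ ?_ ?_
  · simp only [Expr.eval, h13]
    exact Env.rfl'
  · rw [opSeq_const]
    simp only [h5]
    rfl
  · simp

/-- Truncated subtraction makes one formula do both jobs: `0` becomes `1`, and a positive length
doubles. -/
theorem stageLen_succ (i : ℕ) : stageLen (i + 1) = 2 * stageLen i + (1 - stageLen i) := by
  cases i with
  | zero => rfl
  | succ i =>
    have : 0 < 2 ^ i := by positivity
    simp only [stageLen, Nat.succ_ne_zero, if_false, Nat.add_sub_cancel, pow_succ]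
    omega

theorem sum_stageLen (S : ℕ) : ∑ i ∈ Finset.range (S + 1), stageLen i = 2 ^ S - 1 := by
  induction S with
  | zero => rfl
  | succ S ih =>
    rw [Finset.sum_range_succ, ih, stageLen, if_neg (by omega), Nat.add_sub_cancel, pow_succ]
    have : 0 < 2 ^ S := by positivity
    omega

theorem stageLen_le {i S : ℕ} (h : i ≤ S) : stageLen i ≤ 2 ^ S := by
  unfold stageLen
  split_ifs
  · exact Nat.zero_le _
  · exact Nat.pow_le_pow_right (by omega) (by omega)

theorem RejTriple.stages {k l m S : ℕ} {f : ℕ → ℕ} {F : QState (n + w) → QState (n + w)}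
    (hf : Layout V (n + w) k n l m f)
    (hF : ∀ g, Layout V (n + w) k n l m g → Triple U ε V 20 (.oracle 20) g 20 g F 0)
    (h8 : f 8 = S + 1) (h9 : f 9 = 0) (h13 : f 13 = 0) (hV : 2 * 2 ^ S + 1 ≤ V)
    (hN : n + 1 + m + l + (n + 1 + m) < n + w) :
    RejTriple U ε V 20 .stages f 20 (Function.update f 13 (stageLen (S + 1)))
      (opSeq (fun i => stageOp (n + 1 + m + l) (n + 1 + m) hN (prepareOp U m F) (stageLen i))
        (S + 1) ∘ prepareOp U m F) (2 + (2 ^ S - 1) * 4) := by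
  have h1 := Triple.prepare hf (by omega) (hF f hf)
  have h2 := RejTriple.loop (U := U) (ε := ε) (V := V) (e := .reg 8) (s := 20) (P := .stage)
    (N := S + 1) (f := fun i => Function.update f 13 (stageLen i))
    (F := fun i => stageOp (n + 1 + m + l) (n + 1 + m) hN (prepareOp U m F) (stageLen i))
    (u := fun i => stageLen i * 4) (show 8 < 20 by omega) (by simp [Expr.eval, h8])
    (fun i hi => by
      have hf' := hf.update (r := 13) (by omega) (stageLen i)
      have hle := stageLen_le (show i ≤ S by omega)
      have := RejTriple.stage (t := stageLen i) hf' (hF _ hf') (by simp [h9]) (by simp)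
        (by omega) hN
      simp only [Function.update_idem] at this
      rwa [← stageLen_succ] at this)
    KeepsDead.guard
  have h0 : Function.update f 13 (stageLen 0) = f := by
    rw [show stageLen 0 = f 13 from h13.symm, Function.update_eq_self]
  refine (Triple.seqRej h1 (h2.conseq le_rfl ?_ le_rfl Env.rfl' rfl rfl)).conseq le_rfl Env.rfl'
    le_rfl Env.rfl' rfl ?_
  · simp only [h0]
    exact Env.rfl'
  · rw [← Finset.sum_mul, sum_stageLen]

end Main

/-! ## The classical precomputation -/

section Precomputation

variable {n w : ℕ} {U : Matrix (Bits n) (Bits n) ℂ} {ε : ℝ} {V : ℕ}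

/-- Store `Nat.clog 2 x` in register `11` and the corresponding power of two in register `12`, for
the contents `x` of register `10`. -/
def Prog.log : Prog :=
  .seq (.set 11 (.lit 0)) (.seq (.set 12 (.lit 1)) (.loop (.reg 10)
    (.ite (.sub (.reg 10) (.reg 12))
      (.seq (.set 11 (.add (.reg 11) (.lit 1))) (.set 12 (.mul (.lit 2) (.reg 12)))) .skip)))

theorem Triple.setTo {r v : ℕ} {e : Expr} {f : ℕ → ℕ} (he : e.regsLT 20) (hv : e.eval f = v)
    (hV : v ≤ V) :
    Triple (n := n) (w := w) U ε V 20 (.set r e) f 20 (Function.update f r v) id 0 := by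
  subst hv
  exact Triple.set he hV (.inl le_rfl)

theorem two_pow_clog_le {x : ℕ} (hx : 1 ≤ x) : 2 ^ Nat.clog 2 x ≤ 2 * x := by
  rcases hx.eq_or_lt with rfl | hx
  · simp
  · have h := Nat.pow_pred_clog_lt_self Nat.one_lt_two hx
    have h' : 0 < Nat.clog 2 x := Nat.clog_pos Nat.one_lt_two hx
    obtain ⟨c, hc⟩ := Nat.exists_eq_succ_of_ne_zero h'.ne'
    rw [hc, Nat.pred_succ] at h
    rw [hc, pow_succ]
    omega

theorem clog_le_self (x : ℕ) : Nat.clog 2 x ≤ x :=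
  (Nat.clog_le_iff_le_pow Nat.one_lt_two).2 Nat.lt_two_pow_self.le

theorem Triple.log {x : ℕ} {f : ℕ → ℕ} (hx : 1 ≤ x) (h10 : f 10 = x) (hV : 2 * x ≤ V) :
    Triple (n := n) (w := w) U ε V 20 .log f 20
      (Function.update (Function.update f 11 (Nat.clog 2 x)) 12 (2 ^ Nat.clog 2 x)) id 0 := by
  have hpow := two_pow_clog_le hx
  have hself := clog_le_self x
  have h1 : Triple (n := n) (w := w) U ε V 20 (.set 11 (.lit 0)) f 20 (Function.update f 11 0)
      id 0 := Triple.setTo trivial rfl (Nat.zero_le _)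
  have h2 : Triple (n := n) (w := w) U ε V 20 (.set 12 (.lit 1)) (Function.update f 11 0) 20
      (Function.update (Function.update f 11 0) 12 1) id 0 := Triple.setTo trivial rfl (by omega)
  have h3 := Triple.loop (n := n) (w := w) (U := U) (ε := ε) (V := V) (s := 20) (e := .reg 10)
    (P := .ite (.sub (.reg 10) (.reg 12))
      (.seq (.set 11 (.add (.reg 11) (.lit 1))) (.set 12 (.mul (.lit 2) (.reg 12)))) .skip)
    -- The body does nothing once the power has reached `x`, whence the minimum; `Nat.clog 2 x ≤ x`
    -- makes `x` rounds enough.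
    (N := x) (f := fun i => Function.update (Function.update f 11 (min i (Nat.clog 2 x))) 12
      (2 ^ min i (Nat.clog 2 x))) (F := fun _ => id) (u := fun _ => 0) (show 10 < 20 by omega)
    (by simp [Expr.eval, h10]) (fun i hi => by
      refine Triple.ite ⟨show 10 < 20 by omega, show 12 < 20 by omega⟩ (fun h => ?_) fun h => ?_
      · have hlt : i < Nat.clog 2 x := by
          by_contra hge
          rw [min_eq_right (by omega)] at h
          have := Nat.le_pow_clog Nat.one_lt_two x
          simp [Expr.eval, h10] at h
          omega
        have hle : 2 ^ (i + 1) ≤ 2 ^ Nat.clog 2 x := Nat.pow_le_pow_right (by omega) hlt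
        rw [min_eq_left hlt.le, min_eq_left (by omega)]
        refine ((Triple.setTo (v := i + 1) (by simp [Expr.regsLT]) (by simp [Expr.eval])
          (by omega)).seq (Triple.setTo (v := 2 ^ (i + 1)) (by simp [Expr.regsLT])
          (by simp [Expr.eval, pow_succ, mul_comm]) (by omega))).conseq le_rfl Env.rfl' le_rfl
          ?_ rfl rfl
        intro r _
        simp only [Function.update_apply]
        split_ifs <;> rfl
      · have hge : Nat.clog 2 x ≤ i := by
          by_contra hlt
          have := (Nat.lt_clog_iff_pow_lt Nat.one_lt_two).1 (show i < Nat.clog 2 x by omega)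
          rw [min_eq_left (by omega)] at h
          simp [Expr.eval, h10] at h
          omega
        rw [min_eq_right hge, min_eq_right (by omega)]
        exact Triple.skip)
  refine (h1.seq (h2.seq (h3.conseq le_rfl ?_ le_rfl ?_ rfl rfl))).conseq le_rfl Env.rfl' le_rfl
    Env.rfl' ?_ ?_
  · simp [Env]
  · simp [min_eq_right hself, Env]
  · rw [opSeq_const]
    simp
  · simp

/-- The numerator of the rational approximation of `1 / ε`, with denominator `scale k`. -/
noncomputable def accuracy (k : ℕ) (ε : ℝ) : ℕ := ⌊(2 : ℝ) ^ (Nat.clog 2 k + 6) / ε⌋₊ + 1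

/-- The denominator of the rational approximation of `1 / ε`. -/
def scale (k : ℕ) : ℕ := 64 * 2 ^ Nat.clog 2 k

/-- The number of index qubits. -/
noncomputable def indexLen (k : ℕ) (ε : ℝ) : ℕ := Nat.clog 2 (2 * accuracy k ε)

/-- An approximation of `8 * k / ε ^ 2`. -/
noncomputable def repetitions (k : ℕ) (ε : ℝ) : ℕ :=
  8 * accuracy k ε * accuracy k ε * k / (scale k * scale k) + 1

/-- The number of stages after the initial one. -/
noncomputable def stageCount (k : ℕ) (ε : ℝ) : ℕ := (Nat.clog 2 (repetitions k ε) + 1) / 2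

/-- The computation of the parameters. -/
def Prog.parameters : Prog :=
  .seq (.set 10 (.reg 0)) <| .seq .log <| .seq (.set 2 (.reg 11)) <|
  .seq (.set 7 (.mul (.lit 64) (.reg 12))) <| .seq (.readAccuracy 6 (.add (.reg 2) (.lit 6))) <|
  .seq (.set 6 (.add (.reg 6) (.lit 1))) <| .seq (.set 10 (.mul (.lit 2) (.reg 6))) <|
  .seq .log <| .seq (.set 3 (.reg 11)) <| .seq (.set 4 (.reg 12)) <|
  .seq (.set 5 (.add (.add (.add (.reg 1) (.lit 1)) (.reg 3)) (.reg 2))) <|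
  .seq (.set 10 (.add (.div (.mul (.mul (.mul (.lit 8) (.reg 6)) (.reg 6)) (.reg 0))
    (.mul (.reg 7) (.reg 7))) (.lit 1))) <| .seq .log <|
  .set 8 (.add (.div (.add (.reg 11) (.lit 1)) (.lit 2)) (.lit 1))

/-- A bound for the contents of the registers. -/
noncomputable def regBound (k n : ℕ) (ε : ℝ) : ℕ := 100 * (k + n + accuracy k ε + 1) ^ 2

/-- The square is expanded and some nonnegative terms are dropped, so that `omega` can treat the
square of `accuracy k ε` as an atom. -/
theorem le_regBound (k n : ℕ) (ε : ℝ) :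
    100 * (accuracy k ε * accuracy k ε) + 200 * (k + n + accuracy k ε) + 100 ≤
      regBound k n ε := by
  unfold regBound
  nlinarith [Nat.zero_le ((k + n) * (k + n + 2 * accuracy k ε))]

theorem one_le_repetitions (k : ℕ) (ε : ℝ) : 1 ≤ repetitions k ε := Nat.le_add_left _ _

theorem repetitions_le (k : ℕ) (ε : ℝ) :
    repetitions k ε ≤ 8 * accuracy k ε * accuracy k ε + 1 := by
  have h1 : k ≤ scale k * scale k := by
    have h2 := Nat.le_pow_clog Nat.one_lt_two k
    have h3 : 2 ^ Nat.clog 2 k ≤ scale k := by unfold scale; omega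
    exact (h2.trans h3).trans (Nat.le_mul_self _)
  unfold repetitions
  refine Nat.succ_le_succ (Nat.div_le_of_le_mul ?_)
  rw [mul_comm]
  exact Nat.mul_le_mul_right _ h1

theorem two_mul_repetitions_le (k n : ℕ) (ε : ℝ) : 2 * repetitions k ε ≤ regBound k n ε := by
  have h := repetitions_le k ε
  have h' := le_regBound k n ε
  rw [mul_assoc] at h
  omega

/-- A factor 2 is lost in rounding up to a power of two and another one in halving the exponent,
rounded up. -/
theorem four_pow_stageCount_le (k : ℕ) (ε : ℝ) : 4 ^ stageCount k ε ≤ 4 * repetitions k ε := by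
  have h := two_pow_clog_le (one_le_repetitions k ε)
  have h2 : 2 * stageCount k ε ≤ Nat.clog 2 (repetitions k ε) + 1 := by unfold stageCount; omega
  calc 4 ^ stageCount k ε = 2 ^ (2 * stageCount k ε) := by rw [pow_mul]; rfl
    _ ≤ 2 ^ (Nat.clog 2 (repetitions k ε) + 1) := Nat.pow_le_pow_right (by omega) h2
    _ ≤ _ := by rw [pow_succ]; omega

theorem repetitions_le_four_pow (k : ℕ) (ε : ℝ) : repetitions k ε ≤ 4 ^ stageCount k ε := by
  have h := Nat.le_pow_clog Nat.one_lt_two (repetitions k ε)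
  have h2 : Nat.clog 2 (repetitions k ε) ≤ 2 * stageCount k ε := by unfold stageCount; omega
  calc _ ≤ 2 ^ Nat.clog 2 (repetitions k ε) := h
    _ ≤ 2 ^ (2 * stageCount k ε) := Nat.pow_le_pow_right (by omega) h2
    _ = _ := by rw [pow_mul]; rfl

theorem stages_le_regBound (k n : ℕ) (ε : ℝ) : 2 * 2 ^ stageCount k ε + 1 ≤ regBound k n ε := by
  have h := four_pow_stageCount_le k ε
  have h2 := repetitions_le k ε
  have h3 : 2 ^ stageCount k ε ≤ 4 ^ stageCount k ε := Nat.pow_le_pow_left (by omega) _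
  have h' := le_regBound k n ε
  rw [mul_assoc] at h2
  omega

theorem qubits_le_regBound {k n : ℕ} (hk : 1 ≤ k) (ε : ℝ) :
    2 * (n + 1 + indexLen k ε + Nat.clog 2 k) < regBound k n ε := by
  have h1 : indexLen k ε ≤ 2 * accuracy k ε := clog_le_self _
  have h2 := clog_le_self k
  have h' := le_regBound k n ε
  omega

theorem Triple.parameters {k : ℕ} (hk : 1 ≤ k) (hn : Nat.clog 2 k ≤ n)
    (hw : regBound k n ε ≤ n + w) :
    ∃ f, Layout (regBound k n ε) (n + w) k n (Nat.clog 2 k) (indexLen k ε) f ∧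
      f 6 = accuracy k ε ∧ f 7 = scale k ∧ f 8 = stageCount k ε + 1 ∧ f 9 = 0 ∧ f 13 = 0 ∧
      Triple (n := n) (w := w) U ε (regBound k n ε) 20 .parameters (startMem k n) 20 f id 0 := by
  have hq := qubits_le_regBound (n := n) hk ε
  have hrep := two_mul_repetitions_le k n ε
  have hst := stages_le_regBound k n ε
  have hst' : stageCount k ε < 2 ^ stageCount k ε := Nat.lt_two_pow_self
  have hl := two_pow_clog_le hk
  have hm : 2 ^ indexLen k ε ≤ 2 * (2 * accuracy k ε) :=
    two_pow_clog_le (by unfold accuracy; omega)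
  have hkQ := le_regBound k n ε
  have hscale : scale k = 64 * 2 ^ Nat.clog 2 k := rfl
  have hacc : accuracy k ε = ⌊(2 : ℝ) ^ (Nat.clog 2 k + 6) / ε⌋₊ + 1 := rfl
  have hY1 := one_le_repetitions k ε
  set V := regBound k n ε
  set l := Nat.clog 2 k
  set Q := accuracy k ε
  set D := scale k
  set m := indexLen k ε
  set Y := repetitions k ε
  set S := stageCount k ε
  let f1 := Function.update (startMem k n) 10 k
  let f2 := Function.update (Function.update f1 11 l) 12 (2 ^ l)
  let f3 := Function.update f2 2 l
  let f4 := Function.update f3 7 D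
  -- The value read is a floor; the next instruction adds 1, so that `Q / D` exceeds `1 / ε`.
  let f5 := Function.update f4 6 (Q - 1)
  let f6 := Function.update f5 6 Q
  let f7 := Function.update f6 10 (2 * Q)
  let f8 := Function.update (Function.update f7 11 m) 12 (2 ^ m)
  let f9 := Function.update f8 3 m
  let f10 := Function.update f9 4 (2 ^ m)
  let f11 := Function.update f10 5 (n + 1 + m + l)
  let f12 := Function.update f11 10 Y
  let f13 := Function.update (Function.update f12 11 (Nat.clog 2 Y)) 12 (2 ^ Nat.clog 2 Y)
  let f14 := Function.update f13 8 (S + 1)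
  have t1 : Triple (n := n) (w := w) U ε V 20 (.set 10 (.reg 0)) (startMem k n) 20 f1 id 0 :=
    Triple.setTo (by simp [Expr.regsLT]) rfl (by omega)
  have t2 : Triple (n := n) (w := w) U ε V 20 .log f1 20 f2 id 0 :=
    Triple.log hk (by simp [f1]) (by omega)
  have t3 : Triple (n := n) (w := w) U ε V 20 (.set 2 (.reg 11)) f2 20 f3 id 0 :=
    Triple.setTo (by simp [Expr.regsLT]) rfl (by omega)
  have t4 : Triple (n := n) (w := w) U ε V 20 (.set 7 (.mul (.lit 64) (.reg 12))) f3 20 f4 id 0 :=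
    Triple.setTo (by simp [Expr.regsLT]) rfl (by omega)
  have t5 : Triple (n := n) (w := w) U ε V 20 (.readAccuracy 6 (.add (.reg 2) (.lit 6))) f4 20 f5
      id 0 := by
    have h : (Expr.add (.reg 2) (.lit 6)).eval f4 = l + 6 := rfl
    refine (Triple.readAccuracy (by simp [Expr.regsLT]) ?_ le_rfl).conseq le_rfl Env.rfl' le_rfl
      ?_ rfl rfl
    · rw [h]; omega
    · rw [h, show ⌊(2 : ℝ) ^ (l + 6) / ε⌋₊ = Q - 1 by omega]
      exact Env.rfl'
  have t6 : Triple (n := n) (w := w) U ε V 20 (.set 6 (.add (.reg 6) (.lit 1))) f5 20 f6 id 0 :=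
    Triple.setTo (by simp [Expr.regsLT]) (show Q - 1 + 1 = Q by omega) (by omega)
  have t7 : Triple (n := n) (w := w) U ε V 20 (.set 10 (.mul (.lit 2) (.reg 6))) f6 20 f7 id 0 :=
    Triple.setTo (by simp [Expr.regsLT]) rfl (by omega)
  have t8 : Triple (n := n) (w := w) U ε V 20 .log f7 20 f8 id 0 :=
    Triple.log (by omega) rfl (by omega)
  have t9 : Triple (n := n) (w := w) U ε V 20 (.set 3 (.reg 11)) f8 20 f9 id 0 :=
    Triple.setTo (by simp [Expr.regsLT]) rfl (by omega)
  have t10 : Triple (n := n) (w := w) U ε V 20 (.set 4 (.reg 12)) f9 20 f10 id 0 :=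
    Triple.setTo (by simp [Expr.regsLT]) rfl (by omega)
  have t11 : Triple (n := n) (w := w) U ε V 20
      (.set 5 (.add (.add (.add (.reg 1) (.lit 1)) (.reg 3)) (.reg 2))) f10 20 f11 id 0 :=
    Triple.setTo (by simp [Expr.regsLT]) rfl (by omega)
  have t12 : Triple (n := n) (w := w) U ε V 20
      (.set 10 (.add (.div (.mul (.mul (.mul (.lit 8) (.reg 6)) (.reg 6)) (.reg 0))
        (.mul (.reg 7) (.reg 7))) (.lit 1))) f11 20 f12 id 0 :=
    Triple.setTo (by simp [Expr.regsLT]) rfl (by omega)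
  have t13 : Triple (n := n) (w := w) U ε V 20 .log f12 20 f13 id 0 :=
    Triple.log hY1 (by simp [f12]) hrep
  have t14 : Triple (n := n) (w := w) U ε V 20
      (.set 8 (.add (.div (.add (.reg 11) (.lit 1)) (.lit 2)) (.lit 1))) f13 20 f14 id 0 :=
    Triple.setTo (by simp [Expr.regsLT]) rfl (by omega)
  refine ⟨f14, ?_, rfl, rfl, rfl, rfl, rfl, t1.seq <| t2.seq <| t3.seq <| t4.seq <| t5.seq <|
    t6.seq <| t7.seq <| t8.seq <| t9.seq <| t10.seq <| t11.seq <| t12.seq <| t13.seq t14⟩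
  exact
    { reg0 := rfl, reg1 := rfl, reg2 := rfl, reg3 := rfl, reg4 := rfl, reg5 := rfl
      pos := hk
      le_pow := Nat.le_pow_clog Nat.one_lt_two k
      le_n := hn
      room := by omega
      qubits_le := by omega
      pow_le := by omega
      k_le := by omega }

end Precomputation

/-! ## The tester -/

section Tester

variable {n w : ℕ} {U : Matrix (Bits n) (Bits n) ℂ} {ε : ℝ} {V : ℕ}

/-- The tester without the final output. -/
def Prog.testerBody : Prog :=
  .seq .parameters (.ite (.sub (.mul (.mul (.reg 6) (.reg 6)) (.reg 0)) (.mul (.reg 7) (.reg 7)))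
    .stages .skip)

/-- The tester. -/
def Prog.tester : Prog := .seq .testerBody (.set 0 (.sub (.lit 1) (.reg 9)))

/-- Register `9` is `0` in the surviving branch and `1` in all others, so acceptance has the squared
norm of the survivor as its probability; rejection is its complement by `sum_normSq_run`. -/
theorem RejTriple.acceptProb_seq_set {k u : ℕ} {P : Prog} {f : ℕ → ℕ}
    {F : QState (n + w) → QState (n + w)} (hU : U ∈ Matrix.unitaryGroup (Bits n) ℂ)
    (h : RejTriple U ε V 20 P (startMem k n) 20 f F u) (hV : Bdd V (startMem k n))
    (h9 : f 9 = 0) :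
    acceptProb (.seq P (.set 0 (.sub (.lit 1) (.reg 9)))) k ε U w =
      normSq (F (Pi.single (zeroBits (n + w)) 1)) ∧
    rejectProb (.seq P (.set 0 (.sub (.lit 1) (.reg 9)))) k ε U w =
      1 - normSq (F (Pi.single (zeroBits (n + w)) 1)) ∧
    ∀ c ∈ outcomes (.seq P (.set 0 (.sub (.lit 1) (.reg 9)))) k ε U w,
      c.uses ≤ u ∧ c.steps ≤ (Prog.seq P (.set 0 (.sub (.lit 1) (.reg 9)))).costBound V := by
  obtain ⟨m', t, ds, h1, h2, h3, h4, h5⟩ := h (start k n w) hV Env.rfl'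
  set out : Branch n w → Branch n w := fun c =>
    (c.tick (1 + (Expr.sub (.lit 1) (.reg 9)).cost c.mem)).write 0 (1 - c.mem 9) with hout
  set c₀ : Branch n w :=
    ⟨m', F (start k n w).state, (start k n w).uses + u, (start k n w).steps + t⟩ with hc₀
  have hrun : outcomes (.seq P (.set 0 (.sub (.lit 1) (.reg 9)))) k ε U w =
      (c₀ :: ds).map out := by
    simp only [outcomes, run, h4, ← List.map_eq_flatMap]
    rfl
  have hlive : (out c₀).mem 0 = 1 := by
    simp only [hout, hc₀, Branch.write, Function.update_self]
    rw [h2 9 (by omega), h9]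
  have hdead : ∀ d ∈ ds, (out d).mem 0 = 0 := fun d hd => by
    simp only [hout, Branch.write, Function.update_self, (h5 d hd).rej]
  have hacc : acceptProb (.seq P (.set 0 (.sub (.lit 1) (.reg 9)))) k ε U w =
      normSq (F (Pi.single (zeroBits (n + w)) 1)) := by
    rw [acceptProb, hrun, List.map_cons, List.map_cons, List.sum_cons, if_pos hlive, List.map_map,
      List.sum_eq_zero, add_zero]
    · rfl
    · intro x hx
      obtain ⟨d, hd, rfl⟩ := List.mem_map.1 hx
      simp [hdead d hd]
  have hsum : acceptProb (.seq P (.set 0 (.sub (.lit 1) (.reg 9)))) k ε U w +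
      rejectProb (.seq P (.set 0 (.sub (.lit 1) (.reg 9)))) k ε U w = 1 := by
    have h6 := sum_normSq_run hU ε (.seq P (.set 0 (.sub (.lit 1) (.reg 9)))) (start k n w)
    rw [show (start k n w).state = Pi.single (zeroBits (n + w)) 1 from rfl, normSq_single] at h6
    rw [← h6, acceptProb, rejectProb, ← List.sum_map_add, outcomes]
    congr 2
    funext c
    split_ifs <;> simp
  refine ⟨hacc, by linarith, fun c hc => ?_⟩
  rw [hrun] at hc
  obtain ⟨d, hd, rfl⟩ := List.mem_map.1 hc
  have key : Bdd V d.mem ∧ d.uses ≤ u ∧ d.steps ≤ P.costBound V := by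
    rcases List.mem_cons.1 hd with rfl | hd
    · exact ⟨h1, by simp [hc₀, start], by simpa [hc₀, start] using h3⟩
    · have h6 := h5 d hd
      exact ⟨h6.bdd, by simpa [start] using h6.uses, by simpa [start] using h6.steps⟩
  have hcost := Expr.cost_le_costBound key.1 (.sub (.lit 1) (.reg 9))
  refine ⟨key.2.1, ?_⟩
  have := key.2.2
  simp only [hout, Branch.write, Branch.tick, Prog.costBound]
  omega

theorem bdd_startMem {k : ℕ} : Bdd (regBound k n ε) (startMem k n) := by
  have h := le_regBound k n ε
  intro r
  unfold startMem
  split_ifs <;> omega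

theorem Triple.testerBody_of_le {k : ℕ} (hk : 1 ≤ k) (hn : Nat.clog 2 k ≤ n)
    (hw : regBound k n ε ≤ n + w)
    (hle : accuracy k ε * accuracy k ε * k ≤ scale k * scale k) :
    ∃ f, f 9 = 0 ∧ Triple (n := n) (w := w) U ε (regBound k n ε) 20 .testerBody (startMem k n)
      20 f id 0 := by
  obtain ⟨f, hf, h6, h7, h8, h9, h13, h⟩ := Triple.parameters (U := U) hk hn hw
  refine ⟨f, h9, h.seq (Triple.ite (by simp [Expr.regsLT]) (fun hne => absurd ?_ hne)
    fun _ => Triple.skip)⟩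
  simp only [Expr.eval, h6, h7, hf.reg0]
  omega

theorem RejTriple.testerBody_of_lt {k : ℕ} (hk : 1 ≤ k) (hn : Nat.clog 2 k ≤ n)
    (hw : regBound k n ε ≤ n + w) (hU : U ∈ Matrix.unitaryGroup (Bits n) ℂ)
    (hlt : scale k * scale k < accuracy k ε * accuracy k ε * k) :
    ∃ (f : ℕ → ℕ) (F : QState (n + w) → QState (n + w)) (θ : ℝ), f 9 = 0 ∧
      RejTriple U ε (regBound k n ε) 20 .testerBody (startMem k n) 20 f F
        (2 + (2 ^ stageCount k ε - 1) * 4) ∧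
      Real.sin θ ^ 2 = 1 / 4 * ∑ z : Bits (Nat.clog 2 k),
        (modFreq k (indexLen k ε) z - sampleProb U z) ^ 2 ∧
      normSq (F (Pi.single (zeroBits (n + w)) 1)) =
        ∏ i ∈ Finset.range (stageCount k ε + 1), Real.cos (2 ^ i * θ) ^ 2 := by
  obtain ⟨f, hf, h6, h7, h8, h9, h13, h⟩ := Triple.parameters (U := U) hk hn hw
  obtain ⟨F, hF, hT⟩ := Triple.oracle (U := U) (ε := ε) hf
  have hroom := hf.room
  set l := Nat.clog 2 k
  set m := indexLen k ε
  have hprep : IsPreparation (n + 1 + m + l) (n + 1 + m) (prepareOp U m F) :=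
    { adj := adj_prepareOp hF
      inv := prepareOp_comp_self hU hF
      supp := fun ψ hψ => Supported.prepareOp hF hψ
      le := by omega
      room := hroom }
  have hN : n + 1 + m + l + (n + 1 + m) < n + w := by omega
  have ha := normSq_zeroProj_prepareOp (k := k) hn (by omega) hU hF
  have ha1 : normSq (zeroProj (n + 1 + m) (prepState (prepareOp U m F))) ≤ 1 := by
    have h1 := normSq_sub_zeroProj (n + 1 + m) (prepState (prepareOp U m F))
    rw [hprep.normSq_prepState] at h1
    have h2 : 0 ≤ normSq (prepState (prepareOp U m F) +
        (-1 : ℂ) • zeroProj (n + 1 + m) (prepState (prepareOp U m F))) :=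
      Finset.sum_nonneg fun _ _ => sq_nonneg _
    linarith
  have ha0 : 0 ≤ normSq (zeroProj (n + 1 + m) (prepState (prepareOp U m F))) :=
    Finset.sum_nonneg fun _ _ => sq_nonneg _
  -- A squared norm of at most `1` is the squared sine of some angle; this chooses `θ`.
  have hθ : Real.sin (Real.arcsin √(normSq (zeroProj (n + 1 + m)
      (prepState (prepareOp U m F))))) ^ 2 =
      normSq (zeroProj (n + 1 + m) (prepState (prepareOp U m F))) := by
    rw [Real.sin_arcsin (by linarith [Real.sqrt_nonneg (normSq (zeroProj (n + 1 + m)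
      (prepState (prepareOp U m F))))]) (Real.sqrt_le_one.2 ha1), Real.sq_sqrt ha0]
  have h10 := RejTriple.stages (U := U) (ε := ε) hf (fun g hg => hT 20 g (by omega) hg) h8 h9 h13
    (stages_le_regBound k n ε) hN
  refine ⟨_, _, _, ?_, Triple.seqRej h (RejTriple.ite (by simp [Expr.regsLT]) (fun _ => h10)
    fun h0 => absurd h0 ?_) |>.conseq le_rfl Env.rfl' le_rfl Env.rfl' rfl (by omega),
    hθ.trans ha, ?_⟩
  · simp [h9]
  · simp only [Expr.eval, h6, h7, hf.reg0]
    omega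
  · exact hprep.normSq_stages hθ hN _

end Tester

/-! ## The samples of a synthesizer -/

section Samples

variable {k g : ℕ} {p : Fin k → ℝ}

theorem binary_injOn {l i j : ℕ} (hi : i < 2 ^ l) (hj : j < 2 ^ l) (h : binary l i = binary l j) :
    i = j := by
  refine Nat.eq_of_testBit_eq fun b => ?_
  by_cases hb : b < l
  · exact congrFun h ⟨b, hb⟩
  · have h2 : 2 ^ l ≤ 2 ^ b := Nat.pow_le_pow_right (by omega) (by omega)
    rw [Nat.testBit_lt_two_pow (by omega), Nat.testBit_lt_two_pow (by omega)]

theorem binary_clog_injective (k : ℕ) :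
    Function.Injective fun i : Fin k => binary (Nat.clog 2 k) i := fun i j h =>
  Fin.ext (binary_injOn (i.2.trans_le (Nat.le_pow_clog Nat.one_lt_two k))
    (j.2.trans_le (Nat.le_pow_clog Nat.one_lt_two k)) h)

variable {U : Matrix (Bits (codeSize k g)) (Bits (codeSize k g)) ℂ}

theorem sampleProb_eq_sum (z : Bits (Nat.clog 2 k)) :
    sampleProb U z = ∑ b : Bits g, ‖U (Fin.append z b) (zeroBits _)‖ ^ 2 := by
  refine (sum_bits_append (n := Nat.clog 2 k) (w := g) _).trans
    (Finset.sum_congr rfl fun b _ => ?_)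
  refine (Finset.sum_eq_single z (fun a _ ha => if_neg fun h => ha (funext fun i => ?_))
    (by simp)).trans (if_pos fun i => ?_)
  · rw [← h i, getBit_of_lt _ (i.2.trans_le (Nat.le_add_right _ _))]
    exact (Fin.append_left a b i).symm
  · rw [getBit_of_lt _ (i.2.trans_le (Nat.le_add_right _ _))]
    exact Fin.append_left z b i

/-- Distinct samples have distinct binary labels, and the garbage state attached to each has norm 1,
so summing over the garbage leaves `p i`. -/
theorem IsSynthesizer.sampleProb_binary (h : IsSynthesizer U p) (hp : ∀ i, 0 ≤ p i) (i : Fin k) :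
    sampleProb U (binary (Nat.clog 2 k) i) = p i := by
  obtain ⟨-, ψ, hψ, hUψ⟩ := h
  have h1 : ∀ b, U (Fin.append (binary (Nat.clog 2 k) i) b) (zeroBits _) = (√(p i) : ℂ) * ψ i b := by
    intro b
    rw [hUψ, Finset.sum_eq_single i]
    · simp
    · intro j _ hj
      exact if_neg fun e => hj (binary_clog_injective k e).symm
    · simp
  simp only [sampleProb_eq_sum, h1, norm_mul, mul_pow, ← Finset.mul_sum]
  rw [show ∑ b, ‖ψ i b‖ ^ 2 = 1 from hψ i, Complex.norm_real, Real.norm_eq_abs, sq_abs,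
    Real.sq_sqrt (hp i), mul_one]

theorem IsSynthesizer.sampleProb_of_notMem (h : IsSynthesizer U p) {z : Bits (Nat.clog 2 k)}
    (hz : z ∉ Set.range fun i : Fin k => binary (Nat.clog 2 k) i) : sampleProb U z = 0 := by
  obtain ⟨-, ψ, hψ, hUψ⟩ := h
  have h1 : ∀ b, U (Fin.append z b) (zeroBits _) = 0 := by
    intro b
    rw [hUψ]
    exact Finset.sum_eq_zero fun j _ => if_neg fun e => hz ⟨j, e.symm⟩
  simp [sampleProb_eq_sum, h1]

theorem modFreq_of_notMem (hk : 1 ≤ k) (m : ℕ) {z : Bits (Nat.clog 2 k)}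
    (hz : z ∉ Set.range fun i : Fin k => binary (Nat.clog 2 k) i) : modFreq k m z = 0 := by
  rw [modFreq, Finset.sum_eq_zero, zero_div]
  intro j _
  exact if_neg fun e => hz ⟨⟨j % k, Nat.mod_lt _ hk⟩, e⟩

theorem IsSynthesizer.sum_sq_sub (h : IsSynthesizer U p) (hp : ∀ i, 0 ≤ p i) (hk : 1 ≤ k) (m : ℕ) :
    ∑ z : Bits (Nat.clog 2 k), (modFreq k m z - sampleProb U z) ^ 2 =
      ∑ i : Fin k, (modFreq k m (binary (Nat.clog 2 k) i) - p i) ^ 2 := by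
  symm
  refine Fintype.sum_of_injective _ (binary_clog_injective k) _ _ (fun z hz => ?_) fun i => ?_
  · rw [modFreq_of_notMem hk m hz, h.sampleProb_of_notMem hz]
    simp
  · rw [h.sampleProb_binary hp]

/-- The number of `j < 2 ^ m` in a residue class modulo `k` is `2 ^ m / k` rounded down, or one
more. -/
theorem abs_modFreq_sub_le (m : ℕ) (i : Fin k) :
    |modFreq k m (binary (Nat.clog 2 k) i) - 1 / k| ≤ 1 / 2 ^ m := by
  have hk : 0 < k := i.pos
  have hk' : (0 : ℝ) < k := by exact_mod_cast hk
  have h1 : (∑ j ∈ Finset.range (2 ^ m),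
      if binary (Nat.clog 2 k) (j % k) = binary (Nat.clog 2 k) i then (1 : ℝ) else 0) =
      ((2 ^ m).count (· ≡ i [MOD k]) : ℕ) := by
    rw [Nat.count_eq_card_filter_range, Finset.card_filter]
    push_cast
    refine Finset.sum_congr rfl fun j _ => ?_
    congr 1
    rw [Nat.ModEq, Nat.mod_eq_of_lt i.2, eq_iff_iff]
    refine ⟨fun e => ?_, fun e => by rw [e]⟩
    exact congrArg Fin.val (@binary_clog_injective k ⟨j % k, Nat.mod_lt _ hk⟩ i e)
  rw [modFreq, h1, Nat.count_modEq_card _ hk]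
  have h2 : (2 ^ m : ℝ) = k * ((2 ^ m / k : ℕ) : ℝ) + ((2 ^ m % k : ℕ) : ℝ) := by
    exact_mod_cast (Nat.div_add_mod (2 ^ m) k).symm
  have h3 : ((2 ^ m % k : ℕ) : ℝ) ≤ k := by exact_mod_cast (Nat.mod_lt _ hk).le
  have h4 : (0 : ℝ) ≤ ((2 ^ m % k : ℕ) : ℝ) := Nat.cast_nonneg _
  have h5 : (1 : ℝ) / k = ((2 ^ m / k : ℕ) + ((2 ^ m % k : ℕ) : ℝ) / k) / 2 ^ m := by
    rw [eq_div_iff (by positivity), h2]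
    field_simp
  have h6 : ((2 ^ m % k : ℕ) : ℝ) / k ≤ 1 := (div_le_one hk').2 h3
  have h7 : 0 ≤ ((2 ^ m % k : ℕ) : ℝ) / k := by positivity
  rw [h5, ← sub_div, abs_div, abs_of_pos (show (0 : ℝ) < 2 ^ m by positivity)]
  refine div_le_div_of_nonneg_right ?_ (by positivity)
  push_cast
  rw [abs_le]
  split_ifs <;> constructor <;> linarith

end Samples

/-! ## The chi-squared divergence from the uniform distribution -/

section ChiSquare

variable {k : ℕ} {p : Fin k → ℝ}

theorem chiSquare_uniform (hk : 1 ≤ k) :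
    chiSquare p (uniform k) = k * ∑ i, (p i - 1 / k) ^ 2 := by
  simp only [chiSquare, uniform, Finset.mul_sum]
  exact Finset.sum_congr rfl fun i _ => by
    have : (k : ℝ) ≠ 0 := by positivity
    field_simp

theorem chiSquare_uniform_le (hk : 1 ≤ k) (hp : p ∈ stdSimplex ℝ (Fin k)) :
    chiSquare p (uniform k) ≤ k := by
  have hk' : (1 : ℝ) ≤ k := by exact_mod_cast hk
  have h1 : ∀ i, p i ≤ 1 := fun i => hp.2 ▸
    Finset.single_le_sum (f := p) (fun j _ => hp.1 j) (Finset.mem_univ i)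
  rw [chiSquare_uniform hk]
  have h2 : ∑ i, (p i - 1 / k) ^ 2 ≤ ∑ i, (p i * (1 - 2 / k) + 1 / k * (1 / k)) := by
    refine Finset.sum_le_sum fun i _ => ?_
    have := mul_le_mul_of_nonneg_left (h1 i) (hp.1 i)
    have h3 : p i * (2 / k) = 2 * (p i * (1 / k)) := by ring
    nlinarith
  rw [Finset.sum_add_distrib, ← Finset.sum_mul, hp.2] at h2
  simp only [Finset.sum_const, Finset.card_univ, Fintype.card_fin, nsmul_eq_mul] at h2
  have h3 : (k : ℝ) * (1 / k * (1 / k)) = 1 / k := by field_simp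
  have h4 : (0 : ℝ) ≤ 1 / k := by positivity
  have h5 : (2 : ℝ) / k = 2 * (1 / k) := by ring
  have h6 : ∑ i, (p i - 1 / k) ^ 2 ≤ 1 := by rw [h3, h5] at h2; linarith
  nlinarith

/-- From (x − y)² ≤ 2x² + 2y²; the companion below exchanges the roles of the two distances. The
factors 2 are part of the gap between the two cases. -/
theorem sum_sq_sub_le {c : Fin k → ℝ} {δ : ℝ} (hk : 1 ≤ k) (hc : ∀ i, |c i - 1 / k| ≤ δ) :
    k * ∑ i, (c i - p i) ^ 2 ≤ 2 * chiSquare p (uniform k) + 2 * (k * δ) ^ 2 := by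
  rw [chiSquare_uniform hk]
  have h : ∑ i, (c i - p i) ^ 2 ≤ ∑ i, (2 * (p i - 1 / k) ^ 2 + 2 * δ ^ 2) := by
    refine Finset.sum_le_sum fun i _ => ?_
    have h1 := sq_le_sq' (abs_le.1 (hc i)).1 (abs_le.1 (hc i)).2
    nlinarith [sq_nonneg (c i - 1 / k + (p i - 1 / k))]
  rw [Finset.sum_add_distrib, ← Finset.mul_sum] at h
  simp only [Finset.sum_const, Finset.card_univ, Fintype.card_fin, nsmul_eq_mul] at h
  have := mul_le_mul_of_nonneg_left h (Nat.cast_nonneg k : (0 : ℝ) ≤ k)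
  linarith

theorem chiSquare_uniform_le_sum_sq_sub {c : Fin k → ℝ} {δ : ℝ} (hk : 1 ≤ k)
    (hc : ∀ i, |c i - 1 / k| ≤ δ) :
    chiSquare p (uniform k) ≤ 2 * (k * ∑ i, (c i - p i) ^ 2) + 2 * (k * δ) ^ 2 := by
  rw [chiSquare_uniform hk]
  have h : ∑ i, (p i - 1 / k) ^ 2 ≤ ∑ i, (2 * (c i - p i) ^ 2 + 2 * δ ^ 2) := by
    refine Finset.sum_le_sum fun i _ => ?_
    have h1 := sq_le_sq' (abs_le.1 (hc i)).1 (abs_le.1 (hc i)).2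
    nlinarith [sq_nonneg (c i - 1 / k + (c i - p i))]
  rw [Finset.sum_add_distrib, ← Finset.mul_sum] at h
  simp only [Finset.sum_const, Finset.card_univ, Fintype.card_fin, nsmul_eq_mul] at h
  have := mul_le_mul_of_nonneg_left h (Nat.cast_nonneg k : (0 : ℝ) ≤ k)
  linarith

end ChiSquare

/-! ## Bounds for the parameters -/

section Parameters

variable {k : ℕ} {ε : ℝ}

theorem scale_cast (k : ℕ) : (scale k : ℝ) = 2 ^ (Nat.clog 2 k + 6) := by
  simp only [scale, pow_add]
  push_cast
  ring

theorem le_scale (k : ℕ) : (64 * k : ℝ) ≤ scale k := by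
  have h := Nat.le_pow_clog Nat.one_lt_two k
  unfold scale
  exact_mod_cast Nat.mul_le_mul_left 64 h

theorem scale_le (hk : 1 ≤ k) : (scale k : ℝ) ≤ 128 * k := by
  have h := two_pow_clog_le hk
  have : scale k ≤ 128 * k := by unfold scale; omega
  exact_mod_cast this

theorem scale_div_lt_accuracy (k : ℕ) (ε : ℝ) : scale k / ε < accuracy k ε := by
  rw [scale_cast, accuracy]
  push_cast
  exact Nat.lt_floor_add_one _

theorem accuracy_le (k : ℕ) (hε : 0 < ε) : (accuracy k ε : ℝ) ≤ scale k / ε + 1 := by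
  rw [scale_cast, accuracy]
  push_cast
  exact add_le_add_left (Nat.floor_le (by positivity)) 1

/-- `2 ^ m ≥ 2 * Q > 2 * D / ε ≥ 128 * k / ε`, with `Q` the accuracy and `D` the scale. -/
theorem mul_one_div_two_pow_le (k : ℕ) (hε : 0 < ε) :
    (k : ℝ) * (1 / 2 ^ indexLen k ε) ≤ ε / 128 := by
  have h1 : (2 * accuracy k ε : ℝ) ≤ 2 ^ indexLen k ε := by
    exact_mod_cast Nat.le_pow_clog Nat.one_lt_two (2 * accuracy k ε)
  have h2 := scale_div_lt_accuracy k ε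
  have h3 := le_scale k
  rw [div_lt_iff₀ hε] at h2
  rw [mul_one_div, div_le_iff₀ (by positivity)]
  nlinarith

/-- With `D < Q * ε` the hypothesis gives `Q² * k ≤ D² < Q² * ε²`. Since the divergence is at most
`k`, accepting at once is then correct. -/
theorem sq_lt_of_mul_le (hk : 1 ≤ k) (hε : 0 < ε)
    (hle : accuracy k ε * accuracy k ε * k ≤ scale k * scale k) : (k : ℝ) < ε ^ 2 := by
  have hk' : (1 : ℝ) ≤ k := by exact_mod_cast hk
  have h2 := scale_div_lt_accuracy k ε
  have h3 := le_scale k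
  rw [div_lt_iff₀ hε] at h2
  have h4 : (accuracy k ε * accuracy k ε * k : ℝ) ≤ scale k * scale k := by exact_mod_cast hle
  have h5 : (scale k * scale k : ℝ) < (accuracy k ε * ε) * (accuracy k ε * ε) :=
    mul_self_lt_mul_self (by positivity) h2
  have h6 : (0 : ℝ) < accuracy k ε * accuracy k ε := by
    have : 0 < accuracy k ε := Nat.succ_pos _
    positivity
  have h7 : (accuracy k ε * accuracy k ε : ℝ) * k < (accuracy k ε * accuracy k ε) * ε ^ 2 := by
    nlinarith
  exact lt_of_mul_lt_mul_left h7 h6.le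

/-- `Q / D > 1 / ε`, and the added 1 outweighs the integer division. -/
theorem eight_mul_le_repetitions (hk : 1 ≤ k) (hε : 0 < ε) :
    8 * (k / ε ^ 2) ≤ (repetitions k ε : ℝ) := by
  have hk' : (1 : ℝ) ≤ k := by exact_mod_cast hk
  have h2 := scale_div_lt_accuracy k ε
  have h3 := le_scale k
  have hD : (0 : ℝ) < scale k := by linarith
  have h4 : (scale k / ε) * (scale k / ε) ≤ (accuracy k ε * accuracy k ε : ℝ) :=
    mul_self_le_mul_self (by positivity) h2.le
  have h5 : (8 * accuracy k ε * accuracy k ε * k : ℝ) < (repetitions k ε : ℝ) *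
      (scale k * scale k) := by
    have hD' : 0 < scale k * scale k := by
      have : 0 < scale k := by exact_mod_cast hD
      positivity
    have := Nat.lt_mul_of_div_lt (Nat.lt_succ_self
      (8 * accuracy k ε * accuracy k ε * k / (scale k * scale k))) hD'
    exact_mod_cast this
  have h6 : 8 * (k / ε ^ 2) * (scale k * scale k) = 8 * k * ((scale k / ε) * (scale k / ε)) := by
    field_simp
  have h7 : 8 * (k / ε ^ 2) * (scale k * scale k) ≤ (repetitions k ε : ℝ) *
      (scale k * scale k) := by
    rw [h6]
    refine le_trans ?_ h5.le
    nlinarith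
  exact le_of_mul_le_mul_right h7 (by positivity)

/-- Rounding `1 / ε` up and adding 1 would be ruinous for tiny `k / ε²`; the hypothesis keeps this
quantity away from 0, so both become bounded relative errors. -/
theorem repetitions_le_mul (hk : 1 ≤ k) (hε : 0 < ε)
    (hlt : scale k * scale k < accuracy k ε * accuracy k ε * k) :
    (repetitions k ε : ℝ) ≤ 9.3 * (k / ε ^ 2) := by
  have hk' : (1 : ℝ) ≤ k := by exact_mod_cast hk
  have h3 := le_scale k
  have hD : (0 : ℝ) < scale k := by linarith
  have hQ := accuracy_le k hε
  have hlt' : (scale k * scale k : ℝ) < accuracy k ε * accuracy k ε * k := by exact_mod_cast hlt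
  set D : ℝ := (scale k : ℝ)
  set Q : ℝ := (accuracy k ε : ℝ)
  have hQ0 : 0 ≤ Q := Nat.cast_nonneg _
  set r := √(k : ℝ)
  have hr : r ^ 2 = k := Real.sq_sqrt (by linarith)
  have hr1 : 1 ≤ r := Real.one_le_sqrt.2 hk'
  set s := r / ε with hs
  have hs2 : s ^ 2 = k / ε ^ 2 := by rw [hs, div_pow, hr]
  have h4 : Q * r / D ≤ s + 1 / 64 := by
    have h5 : Q * r / D ≤ (D / ε + 1) * r / D := by gcongr
    have h6 : (D / ε + 1) * r / D = s + r / D := by rw [hs]; field_simp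
    -- `√k ≤ k`, and the scale is at least `64 * k`.
    have h7 : r / D ≤ 1 / 64 := by
      rw [div_le_div_iff₀ hD (by norm_num)]
      nlinarith
    linarith
  have h5 : (Q * r / D) ^ 2 = Q * Q * k / (D * D) := by
    rw [div_pow, mul_pow, hr]; ring
  have h6 : 1 < (Q * r / D) ^ 2 := by
    rw [h5, lt_div_iff₀ (by positivity)]
    linarith
  have h0 : 0 ≤ Q * r / D := by positivity
  have h7 : 1 < Q * r / D := by nlinarith
  -- From this point on, `8 * (s + 1 / 64) ^ 2 + 1 ≤ 9.3 * s ^ 2`, almost with equality at `s = 63 /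
  -- 64`.
  have h8 : 63 / 64 < s := by linarith
  have h9 : (repetitions k ε : ℝ) ≤ 8 * (Q * r / D) ^ 2 + 1 := by
    rw [h5, repetitions]
    push_cast
    refine add_le_add_left (Nat.cast_div_le.trans (le_of_eq ?_)) 1
    push_cast
    ring
  rw [← hs2]
  nlinarith

/-- With X = k + g + 1/ε ≥ 1 the base of the square is at most 133·X², the main term being 128·k/ε;
and 100·133² + 1 < 2·10⁶. -/
theorem regBound_le (hk : 1 ≤ k) (hε : 0 < ε) (g : ℕ) :
    (regBound k (codeSize k g) ε : ℝ) + 1 ≤ 2000000 * (k + g + 1 / ε) ^ 4 := by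
  have hk' : (1 : ℝ) ≤ k := by exact_mod_cast hk
  have hl : (Nat.clog 2 k : ℝ) ≤ k := by exact_mod_cast clog_le_self k
  have hε' : 0 < 1 / ε := by positivity
  have hg : (0 : ℝ) ≤ g := Nat.cast_nonneg g
  have hQ := accuracy_le k hε
  have hD := scale_le hk
  set X : ℝ := k + g + 1 / ε with hX
  have hX1 : 1 ≤ X := by linarith
  have h1 : (scale k : ℝ) / ε ≤ 128 * X ^ 2 := by
    have h2 : (scale k : ℝ) / ε ≤ 128 * k * (1 / ε) := by
      rw [mul_one_div]; gcongr
    have h3 : (k : ℝ) * (1 / ε) ≤ X * X :=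
      mul_le_mul (by linarith) (by linarith) hε'.le (by linarith)
    nlinarith
  have h4 : (k + (Nat.clog 2 k + g) + accuracy k ε + 1 : ℝ) ≤ 133 * X ^ 2 := by
    nlinarith
  have h5 : (regBound k (codeSize k g) ε : ℝ) ≤ 100 * (133 * X ^ 2) ^ 2 := by
    rw [regBound]
    push_cast
    gcongr
  have h6 : 1 ≤ X ^ 4 := one_le_pow₀ hX1
  nlinarith

end Parameters

/-! ## Correctness of the tester -/

section Correctness

variable {k g w : ℕ} {ε : ℝ} {p : Fin k → ℝ}
  {U : Matrix (Bits (codeSize k g)) (Bits (codeSize k g)) ℂ}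

/-- The tester when the accuracy parameter exceeds all values of the divergence. -/
theorem tester_of_le (hk : 1 ≤ k) (hε : 0 < ε) (hw : regBound k (codeSize k g) ε ≤ w)
    (hp : p ∈ stdSimplex ℝ (Fin k)) (hU : IsSynthesizer U p)
    (hle : accuracy k ε * accuracy k ε * k ≤ scale k * scale k) :
    (∀ c ∈ outcomes Prog.tester k ε U w, (c.uses : ℝ) ≤ 25 * (√(k : ℝ) / ε) ∧
      c.steps ≤ Prog.tester.costBound (regBound k (codeSize k g) ε)) ∧
    2 / 3 ≤ acceptProb Prog.tester k ε U w ∧ ¬ ε ^ 2 < chiSquare p (uniform k) := by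
  obtain ⟨f, h9, h⟩ := Triple.testerBody_of_le (U := U) (w := w) hk (Nat.le_add_right _ _)
    (hw.trans (Nat.le_add_left _ _)) hle
  obtain ⟨h1, -, h3⟩ := h.toRej.acceptProb_seq_set hU.1 bdd_startMem h9
  refine ⟨fun c hc => ⟨?_, (h3 c hc).2⟩, ?_, not_lt.2 ?_⟩
  · have : (c.uses : ℝ) ≤ (0 : ℕ) := by exact_mod_cast (h3 c hc).1
    have h4 : 0 ≤ √(k : ℝ) / ε := by positivity
    push_cast at this
    linarith
  · rw [Prog.tester, h1, id, normSq_single]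
    norm_num
  · exact (chiSquare_uniform_le hk hp).trans (sq_lt_of_mul_le hk hε hle).le

/-- The tester when the accuracy parameter does not exceed all values of the divergence. -/
theorem tester_of_lt (hk : 1 ≤ k) (hε : 0 < ε) (hw : regBound k (codeSize k g) ε ≤ w)
    (hp : p ∈ stdSimplex ℝ (Fin k)) (hU : IsSynthesizer U p)
    (hlt : scale k * scale k < accuracy k ε * accuracy k ε * k) :
    (∀ c ∈ outcomes Prog.tester k ε U w, (c.uses : ℝ) ≤ 25 * (√(k : ℝ) / ε) ∧
      c.steps ≤ Prog.tester.costBound (regBound k (codeSize k g) ε)) ∧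
    (chiSquare p (uniform k) ≤ ε ^ 2 / 144 → 2 / 3 ≤ acceptProb Prog.tester k ε U w) ∧
    (ε ^ 2 < chiSquare p (uniform k) → 2 / 3 ≤ rejectProb Prog.tester k ε U w) := by
  have hk' : (1 : ℝ) ≤ k := by exact_mod_cast hk
  obtain ⟨f, F, θ, h9, h, hθ, hF⟩ := RejTriple.testerBody_of_lt (U := U) (w := w) hk
    (Nat.le_add_right _ _) (hw.trans (Nat.le_add_left _ _)) hU.1 hlt
  obtain ⟨h1, h2, h3⟩ := h.acceptProb_seq_set hU.1 bdd_startMem h9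
  rw [hU.sum_sq_sub hp.1 hk] at hθ
  have hc := fun i : Fin k => abs_modFreq_sub_le (indexLen k ε) i
  have hc1 := sum_sq_sub_le (p := p) hk hc
  have hc2 := chiSquare_uniform_le_sum_sq_sub (p := p) hk hc
  have hδ := pow_le_pow_left₀ (by positivity) (mul_one_div_two_pow_le k hε) 2
  have hY1 := eight_mul_le_repetitions hk hε
  have hY2 := repetitions_le_mul hk hε hlt
  have hS1 : (repetitions k ε : ℝ) ≤ 4 ^ stageCount k ε := by
    exact_mod_cast repetitions_le_four_pow k ε
  have hS2 : (4 : ℝ) ^ stageCount k ε ≤ 4 * repetitions k ε := by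
    exact_mod_cast four_pow_stageCount_le k ε
  have hacc1 := four_pow_mul_prod_cos_sq_le θ (stageCount k ε + 1)
  have hacc2 := one_sub_le_prod_cos_sq θ (stageCount k ε + 1)
  rw [← hF] at hacc1 hacc2
  rw [Prog.tester, h1, h2]
  set T : ℝ := (k : ℝ) * ∑ i : Fin k,
    (modFreq k (indexLen k ε) (binary (Nat.clog 2 k) i) - p i) ^ 2 with hT
  set χ := chiSquare p (uniform k)
  set a := normSq (F (Pi.single (zeroBits (codeSize k g + w)) 1))
  have hsin : (k : ℝ) * Real.sin θ ^ 2 = T / 4 := by rw [hθ, hT]; ring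
  have hε2 : 0 < ε ^ 2 := by positivity
  have hkε : (k / ε ^ 2 : ℝ) * ε ^ 2 = k := by field_simp
  set P : ℝ := 4 ^ stageCount k ε
  set t : ℝ := k / ε ^ 2 with ht
  have ht0 : 0 < t := by positivity
  have hsin' : t * Real.sin θ ^ 2 = T / 4 / ε ^ 2 := by
    rw [eq_div_iff hε2.ne', ← hsin, ← hkε]
    ring
  have hsin0 := sq_nonneg (Real.sin θ)
  refine ⟨fun c hc => ⟨?_, (h3 c hc).2⟩, fun hχ => ?_, fun hχ => ?_⟩
  · have h4 : (c.uses : ℝ) ≤ 4 * 2 ^ stageCount k ε := by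
      have h5 := (h3 c hc).1
      have h6 : 0 < 2 ^ stageCount k ε := by positivity
      have h7 : c.uses ≤ 4 * 2 ^ stageCount k ε := by omega
      exact_mod_cast h7
    -- `16 * 4 ^ S ≤ 16 * 4 * 9.3 * t = 595.2 * t`, which is below `25 ^ 2 * t`.
    have h5 : (4 * 2 ^ stageCount k ε : ℝ) ^ 2 ≤ (25 * (√(k : ℝ) / ε)) ^ 2 := by
      have h6 : (√(k : ℝ) / ε) ^ 2 = t := by rw [div_pow, Real.sq_sqrt (by linarith)]
      have h7 : ((2 : ℝ) ^ stageCount k ε) ^ 2 = P := by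
        rw [← pow_mul, mul_comm, pow_mul]; norm_num [P]
      rw [mul_pow, mul_pow, h6, h7]
      linarith
    exact h4.trans (le_of_sq_le_sq h5 (by positivity))
  · have hT1 : T / 4 / ε ^ 2 ≤ 0.0036 := by
      rw [div_le_iff₀ hε2]
      nlinarith
    have h4 : P * Real.sin θ ^ 2 ≤ 37.2 * (t * Real.sin θ ^ 2) := by
      rw [← mul_assoc]
      exact mul_le_mul_of_nonneg_right (by linarith) hsin0
    rw [pow_succ (4 : ℝ)] at hacc2
    linarith
  · have hT1 : 0.1249 ≤ T / 4 / ε ^ 2 := by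
      rw [le_div_iff₀ hε2]
      nlinarith
    have h4 : 8 * (t * Real.sin θ ^ 2) ≤ P * Real.sin θ ^ 2 := by
      rw [← mul_assoc]
      exact mul_le_mul_of_nonneg_right (by linarith) hsin0
    have ha0 : 0 ≤ a := Finset.sum_nonneg fun _ _ => sq_nonneg _
    -- `4 * 8 * 0.1249 > 3`, so the acceptance probability is at most `1 / 3`.
    have h5 : 3 ≤ 4 ^ (stageCount k ε + 1) * Real.sin θ ^ 2 := by
      rw [pow_succ]
      linarith
    nlinarith

/-- The register bound is quartic in k + g + 1/ε, and the cost is polynomial in it. The exponent `d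
+ 1` and the factor `C + 1` let one polynomial dominate both, even if `d` or `C` is 0; one of the
bounds guarantees enough work qubits. -/
theorem exists_polynomial_bound (P : Prog) :
    ∃ (B : ℝ) (d : ℕ), ∀ (k : ℕ), 1 ≤ k → ∀ (ε : ℝ), 0 < ε → ∀ g : ℕ,
      (regBound k (codeSize k g) ε : ℝ) ≤ B * ((k : ℝ) + g + 1 / ε) ^ d ∧
      (P.costBound (regBound k (codeSize k g) ε) : ℝ) ≤ B * ((k : ℝ) + g + 1 / ε) ^ d := by
  obtain ⟨C, d, hC⟩ := P.polyBdd_costBound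
  refine ⟨(C + 1) * 2000000 ^ (d + 1), 4 * (d + 1), fun k hk ε hε g => ?_⟩
  have hV := regBound_le hk hε g
  set V := regBound k (codeSize k g) ε
  have h1 : (1 : ℝ) ≤ V + 1 := by
    have : (0 : ℝ) ≤ V := Nat.cast_nonneg _
    linarith
  have h2 : ((V : ℝ) + 1) ^ (d + 1) ≤
      2000000 ^ (d + 1) * ((k : ℝ) + g + 1 / ε) ^ (4 * (d + 1)) := by
    rw [pow_mul, ← mul_pow]
    gcongr
  have hC0 : (0 : ℝ) ≤ C := Nat.cast_nonneg _
  have key : ∀ x : ℝ, x ≤ (C + 1) * ((V : ℝ) + 1) ^ (d + 1) →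
      x ≤ (C + 1) * 2000000 ^ (d + 1) * ((k : ℝ) + g + 1 / ε) ^ (4 * (d + 1)) := fun x hx =>
    hx.trans (by rw [mul_assoc]; gcongr)
  refine ⟨key _ ?_, key _ ?_⟩
  · have h3 : ((V : ℝ) + 1) ^ 1 ≤ ((V : ℝ) + 1) ^ (d + 1) := pow_le_pow_right₀ h1 (by omega)
    nlinarith
  · have h3 : ((V : ℝ) + 1) ^ d ≤ ((V : ℝ) + 1) ^ (d + 1) := pow_le_pow_right₀ h1 (by omega)
    have h4 : (P.costBound V : ℝ) ≤ C * ((V : ℝ) + 1) ^ d := by exact_mod_cast hC V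
    have h5 : (0 : ℝ) ≤ ((V : ℝ) + 1) ^ (d + 1) := by positivity
    nlinarith

end Correctness

end QTest

theorem mainTheorem5 :
    ∃ (P : QTest.Prog) (A B : ℝ) (d : ℕ),
      ∀ (k : ℕ), 1 ≤ k → ∀ (ε : ℝ), 0 < ε → ∀ (g w : ℕ),
        B * ((k : ℝ) + g + 1 / ε) ^ d ≤ (w : ℝ) →
      ∀ (p : Fin k → ℝ), p ∈ stdSimplex ℝ (Fin k) →
      ∀ (U : Matrix (QTest.Bits (QTest.codeSize k g)) (QTest.Bits (QTest.codeSize k g)) ℂ),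
        QTest.IsSynthesizer U p →
        (∀ c ∈ QTest.outcomes P k ε U w, c.state ≠ 0 →
          (c.uses : ℝ) ≤ A * (√(k : ℝ) / ε) ∧
          (c.steps : ℝ) ≤ B * ((k : ℝ) + g + 1 / ε) ^ d) ∧
        (QTest.chiSquare p (QTest.uniform k) ≤ ε ^ 2 / 144 →
          2 / 3 ≤ QTest.acceptProb P k ε U w) ∧
        (ε ^ 2 < QTest.chiSquare p (QTest.uniform k) →
          2 / 3 ≤ QTest.rejectProb P k ε U w) := by
  obtain ⟨B, d, hB⟩ := QTest.exists_polynomial_bound QTest.Prog.tester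
  refine ⟨QTest.Prog.tester, 25, B, d, fun k hk ε hε g w hw p hp U hU => ?_⟩
  obtain ⟨hV, hsteps⟩ := hB k hk ε hε g
  have hw' : QTest.regBound k (QTest.codeSize k g) ε ≤ w := by exact_mod_cast hV.trans hw
  -- This is the comparison that the program makes before touching the code: in the first case it
  -- accepts at once, in the second it runs the stages.
  rcases le_or_gt (QTest.accuracy k ε * QTest.accuracy k ε * k) (QTest.scale k * QTest.scale k)
    with hle | hlt
  · obtain ⟨h1, h2, h3⟩ := QTest.tester_of_le hk hε hw' hp hU hle
    exact ⟨fun c hc _ => ⟨(h1 c hc).1, (Nat.cast_le.2 (h1 c hc).2).trans hsteps⟩, fun _ => h2,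
      fun h => absurd h h3⟩
  · obtain ⟨h1, h2, h3⟩ := QTest.tester_of_lt hk hε hw' hp hU hlt
    exact ⟨fun c hc _ => ⟨(h1 c hc).1, (Nat.cast_le.2 (h1 c hc).2).trans hsteps⟩, h2, h3⟩
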